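/- Let $(M,g,J)$ be a Kähler surface, i.e. a smooth real $4$-manifold with a Riemannian metric $g$ and a $g$-orthogonal almost complex structure $J$ that is parallel for the Levi-Civita connection; put $\omega(X,Y)=g(JX,Y)$. Suppose that $(M,g,J)$ is orthotoric: there are smooth functions $\xi,\eta$ on $M$ and two Killing vector fields $K_1,K_2$, linearly independent at every point, which are Hamiltonian with momentum maps $\xi\eta$ and $\xi+\eta$ respectively ($\omega(K_1,\cdot)=-d(\xi\eta)$, $\omega(K_2,\cdot)=-d(\xi+\eta)$), such that the momentum maps Poisson commute ($\omega(K_1,K_2)=0$) and $d\xi$, $d\eta$ are orthogonal. Then $(M,g,J)$ is a QCH Kähler surface: there is a smooth $J$-invariant distribution $\mathcal D\subset TM$ of rank $2$ such that for every unit vector $X\in T_xM$ the holomorphic sectional curvature $R(X,JX,JX,X)$ depends only on $x$ and on the length $|X_{\mathcal D}|$ of the orthogonal projection $X_{\mathcal D}$ of $X$ on $\mathcal D$. More precisely, there is a Hermitian structure $\bar J$ on $(M,g)$ (a smooth integrable $g$-orthogonal almost complex structure) inducing the orientation opposite to that of $J$, with $\bar J\,\mathrm{grad}\,\xi=J\,\mathrm{grad}\,\xi$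 and $\bar J\,\mathrm{grad}\,\eta=-J\,\mathrm{grad}\,\eta$, such that $\bar J$ preserves the Ricci tensor, $\mathrm{Ric}(\bar JX,\bar JY)=\mathrm{Ric}(X,Y)$; the trace-free Ricci form $\rho_0(X,Y)=\mathrm{Ric}_0(JX,Y)$ satisfies $\rho_0=\delta\,\bar\omega$ for a smooth function $\delta$, where $\bar\omega(X,Y)=g(\bar JX,Y)$; and $(M,g,J)$ is QCH with respect to the distribution $\mathcal D=\ker(J\bar J+\mathrm{Id})$. -/

import Mathlib

open Bundle
open scoped Manifold ContDiff

noncomputable section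

/-! ### Tensor calculus on an open subset of a finite-dimensional real vector space

Here `G`, `J`, `K` are a metric, an endomorphism field and a vector field on the model space, given
by their components with respect to the linear coordinates. -/

namespace ChartCalculus

variable {E : Type*} [NormedAddCommGroup E] [NormedSpace ℝ E]

/-- Christoffel symbols of the first kind, as a covector in the third argument:
`½ (∂ᵤ G(v, ·) + ∂ᵥ G(u, ·) - ∂. G(u, v))`. -/
def christoffelFirst (G : E → E →L[ℝ] E →L[ℝ] ℝ) (y u v : E) : E →L[ℝ] ℝ :=
  (1 / 2 : ℝ) • (fderiv ℝ G y u v + fderiv ℝ G y v u - ((fderiv ℝ G y).flip u).flip v)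

/-- Christoffel symbols of the second kind: the Levi-Civita connection of `G` is
`∇ᵤ V = ∂ᵤ V + Γ(u, V)`. -/
def christoffel (G : E → E →L[ℝ] E →L[ℝ] ℝ) (y u v : E) : E :=
  (G y).inverse (christoffelFirst G y u v)

theorem christoffelFirst_apply (G : E → E →L[ℝ] E →L[ℝ] ℝ) (y u v w : E) :
    christoffelFirst G y u v w = 1 / 2 *
      (fderiv ℝ G y u v w + fderiv ℝ G y v u w - fderiv ℝ G y w u v) := rfl

theorem christoffel_add_left (G : E → E →L[ℝ] E →L[ℝ] ℝ) (y u u' v : E) :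
    christoffel G y (u + u') v = christoffel G y u v + christoffel G y u' v := by
  refine (congrArg (G y).inverse (ContinuousLinearMap.ext fun w => ?_)).trans
    ((G y).inverse.map_add _ _)
  rw [add_apply, christoffelFirst_apply, christoffelFirst_apply, christoffelFirst_apply,
    (fderiv ℝ G y).map_add, (fderiv ℝ G y v).map_add, (fderiv ℝ G y w).map_add]
  simp only [add_apply]
  ring

theorem christoffel_smul_left (G : E → E →L[ℝ] E →L[ℝ] ℝ) (y : E) (c : ℝ) (u v : E) :
    christoffel G y (c • u) v = c • christoffel G y u v := by
  refine (congrArg (G y).inverse (ContinuousLinearMap.ext fun w => ?_)).trans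
    ((G y).inverse.map_smul _ _)
  rw [smul_apply, christoffelFirst_apply, christoffelFirst_apply,
    (fderiv ℝ G y).map_smul, (fderiv ℝ G y v).map_smul, (fderiv ℝ G y w).map_smul]
  simp only [smul_apply, smul_eq_mul]
  ring

theorem christoffel_add_right (G : E → E →L[ℝ] E →L[ℝ] ℝ) (y u v v' : E) :
    christoffel G y u (v + v') = christoffel G y u v + christoffel G y u v' := by
  refine (congrArg (G y).inverse (ContinuousLinearMap.ext fun w => ?_)).trans
    ((G y).inverse.map_add _ _)
  rw [add_apply, christoffelFirst_apply, christoffelFirst_apply, christoffelFirst_apply,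
    (fderiv ℝ G y).map_add, (fderiv ℝ G y u).map_add, (fderiv ℝ G y w u).map_add]
  simp only [add_apply]
  ring

theorem christoffel_smul_right (G : E → E →L[ℝ] E →L[ℝ] ℝ) (y : E) (c : ℝ) (u v : E) :
    christoffel G y u (c • v) = c • christoffel G y u v := by
  refine (congrArg (G y).inverse (ContinuousLinearMap.ext fun w => ?_)).trans
    ((G y).inverse.map_smul _ _)
  rw [smul_apply, christoffelFirst_apply, christoffelFirst_apply,
    (fderiv ℝ G y).map_smul, (fderiv ℝ G y u).map_smul, (fderiv ℝ G y w u).map_smul]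
  simp only [smul_apply, smul_eq_mul]
  ring

variable [FiniteDimensional ℝ E]

/-- The Christoffel symbols at `y` as a bilinear map. -/
def christoffelBilin (G : E → E →L[ℝ] E →L[ℝ] ℝ) (y : E) : E →L[ℝ] E →L[ℝ] E :=
  LinearMap.toContinuousLinearMap
    { toFun := fun u => LinearMap.toContinuousLinearMap
        { toFun := fun v => christoffel G y u v
          map_add' := christoffel_add_right G y u
          map_smul' := fun c v => christoffel_smul_right G y c u v }
      map_add' := fun u u' => ContinuousLinearMap.ext fun v => christoffel_add_left G y u u' v
      map_smul' := fun c u => ContinuousLinearMap.ext fun v => christoffel_smul_left G y c u v }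

/-- The curvature `R(u, v) w = ([∇ᵤ, ∇ᵥ] - ∇_[u,v]) w` of the connection `∇ = ∂ + Γ`, evaluated on
coordinate vectors `u`, `v`, `w`. -/
def curvature (Γ : E → E →L[ℝ] E →L[ℝ] E) (y u v w : E) : E :=
  fderiv ℝ Γ y u v w - fderiv ℝ Γ y v u w + Γ y u (Γ y v w) - Γ y v (Γ y u w)

/-- The endomorphism `u ↦ R(u, v) w`. -/
def curvatureEnd (Γ : E → E →L[ℝ] E →L[ℝ] E) (y v w : E) : E →ₗ[ℝ] E where
  toFun u := curvature Γ y u v w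
  map_add' u u' := by
    unfold curvature
    rw [(fderiv ℝ Γ y).map_add, (fderiv ℝ Γ y v).map_add, (Γ y).map_add]
    simp only [add_apply, (Γ y v).map_add]
    abel
  map_smul' c u := by
    unfold curvature
    rw [(fderiv ℝ Γ y).map_smul, (fderiv ℝ Γ y v).map_smul, (Γ y).map_smul]
    simp only [smul_apply, (Γ y v).map_smul, RingHom.id_apply, smul_sub, smul_add]

/-- The Ricci tensor `Ric(v, w) = tr (u ↦ R(u, v) w)` of the connection `∇ = ∂ + Γ`, as a bilinear
form. -/
def ricciForm (Γ : E → E →L[ℝ] E →L[ℝ] E) (y : E) : E →ₗ[ℝ] E →ₗ[ℝ] ℝ :=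
  LinearMap.mk₂ ℝ (fun v w => LinearMap.trace ℝ E (curvatureEnd Γ y v w))
    (fun v v' w => by
      refine (congrArg (LinearMap.trace ℝ E) (LinearMap.ext fun u => ?_)).trans
        ((LinearMap.trace ℝ E).map_add _ _)
      change curvature Γ y u (v + v') w = curvature Γ y u v w + curvature Γ y u v' w
      unfold curvature
      rw [(fderiv ℝ Γ y).map_add, (fderiv ℝ Γ y u).map_add, (Γ y).map_add]
      simp only [add_apply, (Γ y u).map_add]
      abel)
    (fun c v w => by
      refine (congrArg (LinearMap.trace ℝ E) (LinearMap.ext fun u => ?_)).trans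
        ((LinearMap.trace ℝ E).map_smul _ _)
      change curvature Γ y u (c • v) w = c • curvature Γ y u v w
      unfold curvature
      rw [(fderiv ℝ Γ y).map_smul, (fderiv ℝ Γ y u).map_smul, (Γ y).map_smul]
      simp only [smul_apply, (Γ y u).map_smul, smul_sub, smul_add])
    (fun v w w' => by
      refine (congrArg (LinearMap.trace ℝ E) (LinearMap.ext fun u => ?_)).trans
        ((LinearMap.trace ℝ E).map_add _ _)
      change curvature Γ y u v (w + w') = curvature Γ y u v w + curvature Γ y u v w'
      unfold curvature
      rw [(fderiv ℝ Γ y u v).map_add, (fderiv ℝ Γ y v u).map_add, (Γ y v).map_add,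
        (Γ y u).map_add, (Γ y u).map_add, (Γ y v).map_add]
      abel)
    (fun c v w => by
      refine (congrArg (LinearMap.trace ℝ E) (LinearMap.ext fun u => ?_)).trans
        ((LinearMap.trace ℝ E).map_smul _ _)
      change curvature Γ y u v (c • w) = c • curvature Γ y u v w
      unfold curvature
      rw [(fderiv ℝ Γ y u v).map_smul, (fderiv ℝ Γ y v u).map_smul, (Γ y v).map_smul,
        (Γ y u).map_smul, (Γ y u).map_smul, (Γ y v).map_smul]
      simp only [smul_sub, smul_add])

/-- The scalar curvature: the trace of the endomorphism `Q` with `G(Q v, w) = Ric(v, w)`. -/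
def scalarCurvature (G : E → E →L[ℝ] E →L[ℝ] ℝ) (y : E) : ℝ :=
  LinearMap.trace ℝ E
    ((G y).inverse.toLinearMap ∘ₗ
      (LinearMap.toContinuousLinearMap (𝕜 := ℝ) (E := E) (F' := ℝ)).toLinearMap ∘ₗ
        ricciForm (christoffelBilin G) y)

/-- The covariant derivative `(∇ᵤ J) v` of an endomorphism field `J`. -/
def covDerivEnd (G : E → E →L[ℝ] E →L[ℝ] ℝ) (J : E → E →L[ℝ] E) (y u v : E) : E :=
  fderiv ℝ J y u v + christoffel G y u (J y v) - J y (christoffel G y u v)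

/-- The Nijenhuis tensor `N(u, v) = [Ju, Jv] - J[Ju, v] - J[u, Jv] - [u, v]` of `J`, where `u`, `v`
are extended to constant vector fields. -/
def nijenhuis (J : E → E →L[ℝ] E) (y u v : E) : E :=
  VectorField.lieBracket ℝ (fun z => J z u) (fun z => J z v) y
    - J y (VectorField.lieBracket ℝ (fun z => J z u) (fun _ => v) y)
    - J y (VectorField.lieBracket ℝ (fun _ => u) (fun z => J z v) y)
    - VectorField.lieBracket ℝ (fun _ => u) (fun _ => v) y

/-- The Lie derivative `(L_K G)(u, v)` of the metric along the vector field `K`. -/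
def lieDerivMetric (G : E → E →L[ℝ] E →L[ℝ] ℝ) (K : E → E) (y u v : E) : ℝ :=
  fderiv ℝ G y (K y) u v + G y (fderiv ℝ K y u) v + G y u (fderiv ℝ K y v)

end ChartCalculus

/-! ### Four-dimensional manifolds -/

namespace KahlerSurface

/-- The model space of a real four-dimensional manifold. -/
abbrev E4 : Type := EuclideanSpace ℝ (Fin 4)

variable {M : Type*} [TopologicalSpace M] [ChartedSpace E4 M]

/-- A smooth Riemannian metric on a four-dimensional manifold. -/
abbrev Metric (M : Type*) [TopologicalSpace M] [ChartedSpace E4 M] [IsManifold (𝓡 4) ∞ M] : Type _ :=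
  ContMDiffRiemannianMetric (𝓡 4) ∞ E4 (TangentSpace (𝓡 4) : M → Type _)

/-- A field of endomorphisms of the tangent spaces. -/
abbrev EndField (M : Type*) [TopologicalSpace M] [ChartedSpace E4 M] : Type _ :=
  (x : M) → TangentSpace (𝓡 4) x →L[ℝ] TangentSpace (𝓡 4) x

/-- A vector field. -/
abbrev VecField (M : Type*) [TopologicalSpace M] [ChartedSpace E4 M] : Type _ :=
  (x : M) → TangentSpace (𝓡 4) x

/-- The field `J` of endomorphisms is smooth. -/
def SmoothEnd [IsManifold (𝓡 4) ∞ M] (J : EndField M) : Prop :=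
  ContMDiff (𝓡 4) ((𝓡 4).prod 𝓘(ℝ, E4 →L[ℝ] E4)) ∞
    (fun x => TotalSpace.mk' (E4 →L[ℝ] E4)
      (E := fun x : M => TangentSpace (𝓡 4) x →L[ℝ] TangentSpace (𝓡 4) x) x (J x))

/-- The vector field `X` is smooth near `x`. -/
def SmoothVecAt [IsManifold (𝓡 4) ∞ M] (X : VecField M) (x : M) : Prop :=
  ContMDiffAt (𝓡 4) ((𝓡 4).prod 𝓘(ℝ, E4)) ∞
    (fun y => TotalSpace.mk' E4 (E := (TangentSpace (𝓡 4) : M → Type _)) y (X y)) x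

/-- The coordinates of the point `x` in the preferred chart around `x`. -/
def chartPt (x : M) : E4 := extChartAt (𝓡 4) x x

/-- The differential at `x` of the preferred chart around `x`. -/
def toChart (x : M) : TangentSpace (𝓡 4) x →L[ℝ] E4 :=
  mfderiv (𝓡 4) 𝓘(ℝ, E4) (extChartAt (𝓡 4) x) x

/-- The differential at `y` of the inverse of the preferred chart around `x`. -/
def ofChart (x : M) (y : E4) : E4 →L[ℝ] TangentSpace (𝓡 4) ((extChartAt (𝓡 4) x).symm y) :=
  mfderiv 𝓘(ℝ, E4) (𝓡 4) (extChartAt (𝓡 4) x).symm y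

/-- The components of the metric in the preferred chart around `x`. -/
def metricInChart [IsManifold (𝓡 4) ∞ M] (g : Metric M) (x : M) (y : E4) : E4 →L[ℝ] E4 →L[ℝ] ℝ :=
  (ContinuousLinearMap.precomp ℝ (ofChart x y)) ∘L
    (g.inner ((extChartAt (𝓡 4) x).symm y)) ∘L ofChart x y

/-- The components of an endomorphism field in the preferred chart around `x`. -/
def endInChart (J : EndField M) (x : M) (y : E4) : E4 →L[ℝ] E4 :=
  (ofChart x y).inverse ∘L J ((extChartAt (𝓡 4) x).symm y) ∘L ofChart x y

/-- The components of a vector field in the preferred chart around `x`. -/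
def vecInChart (K : VecField M) (x : M) (y : E4) : E4 :=
  (ofChart x y).inverse (K ((extChartAt (𝓡 4) x).symm y))

section Riemannian

variable [IsManifold (𝓡 4) ∞ M] (g : Metric M)

/-- The curvature tensor `R(X, Y, Z, W) = g(R(X, Y) Z, W)`. -/
def riemann (x : M) (X Y Z W : TangentSpace (𝓡 4) x) : ℝ :=
  metricInChart g x (chartPt x)
    (ChartCalculus.curvature (ChartCalculus.christoffelBilin (metricInChart g x)) (chartPt x)
      (toChart x X) (toChart x Y) (toChart x Z)) (toChart x W)

/-- The Ricci tensor. -/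
def ric (x : M) (X Y : TangentSpace (𝓡 4) x) : ℝ :=
  ChartCalculus.ricciForm (ChartCalculus.christoffelBilin (metricInChart g x)) (chartPt x)
    (toChart x X) (toChart x Y)

/-- The scalar curvature. -/
def scal (x : M) : ℝ :=
  ChartCalculus.scalarCurvature (metricInChart g x) (chartPt x)

/-- The trace-free Ricci tensor. -/
def ricTraceFree (x : M) (X Y : TangentSpace (𝓡 4) x) : ℝ :=
  ric g x X Y - scal g x / 4 * g.inner x X Y

/-- The 2-form `ω(X, Y) = g(J X, Y)`. -/
def fundForm (J : EndField M) (x : M) (X Y : TangentSpace (𝓡 4) x) : ℝ :=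
  g.inner x (J x X) Y

/-- The trace-free part `ρ₀(X, Y) = Ric₀(J X, Y)` of the Ricci form. -/
def ricciFormTraceFree (J : EndField M) (x : M) (X Y : TangentSpace (𝓡 4) x) : ℝ :=
  ricTraceFree g x (J x X) Y

/-- The differential of a real function. -/
def differential (f : M → ℝ) (x : M) : TangentSpace (𝓡 4) x →L[ℝ] ℝ :=
  mvfderiv (𝓡 4) f x

/-- The gradient, defined by `g(grad f, ·) = df`. -/
def grad (f : M → ℝ) (x : M) : TangentSpace (𝓡 4) x :=
  (g.inner x).inverse (differential f x)

/-- `(g, J)` is an almost Hermitian structure. -/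
structure IsAlmostHermitian (J : EndField M) : Prop where
  smooth : SmoothEnd J
  sq : ∀ (x : M) (X : TangentSpace (𝓡 4) x), J x (J x X) = -X
  isometry : ∀ (x : M) (X Y : TangentSpace (𝓡 4) x),
    g.inner x (J x X) (J x Y) = g.inner x X Y

/-- `(g, J)` is a Hermitian structure: `J` is moreover integrable. -/
structure IsHermitian (J : EndField M) : Prop extends IsAlmostHermitian g J where
  integrable : ∀ (x : M) (u v : E4), ChartCalculus.nijenhuis (endInChart J x) (chartPt x) u v = 0

/-- `(M, g, J)` is a Kähler surface: `J` is moreover parallel for the Levi-Civita connection. -/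
structure IsKahler (J : EndField M) : Prop extends IsAlmostHermitian g J where
  parallel : ∀ (x : M) (u v : E4),
    ChartCalculus.covDerivEnd (metricInChart g x) (endInChart J x) (chartPt x) u v = 0

/-- The value of `½ ω ∧ ω` on four vectors, for the fundamental form `ω` of `(g, J)`. -/
def volForm (J : EndField M) (x : M) (X Y Z W : TangentSpace (𝓡 4) x) : ℝ :=
  fundForm g J x X Y * fundForm g J x Z W - fundForm g J x X Z * fundForm g J x Y W
    + fundForm g J x X W * fundForm g J x Y Z

/-- `J` and `J'` induce opposite orientations: `½ ω ∧ ω` and `½ ω' ∧ ω'` have opposite signs. -/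
def OppositeOrientation (J J' : EndField M) : Prop :=
  ∀ (x : M) (X Y Z W : TangentSpace (𝓡 4) x), LinearIndependent ℝ ![X, Y, Z, W] →
    volForm g J x X Y Z W * volForm g J' x X Y Z W < 0

/-- `J'` preserves the Ricci tensor: `Ric(J' ·, J' ·) = Ric`. -/
def PreservesRicci (J' : EndField M) : Prop :=
  ∀ (x : M) (X Y : TangentSpace (𝓡 4) x), ric g x (J' x X) (J' x Y) = ric g x X Y

/-- `K` is a Killing vector field. -/
def IsKilling (K : VecField M) : Prop :=
  (∀ x : M, SmoothVecAt K x) ∧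
    ∀ (x : M) (u v : E4),
      ChartCalculus.lieDerivMetric (metricInChart g x) (vecInChart K x) (chartPt x) u v = 0

/-- `K` is the Hamiltonian vector field with momentum map `f`, i.e. `ω(K, ·) = -df`; equivalently
`K = J grad f`. -/
def IsHamiltonian (J : EndField M) (K : VecField M) (f : M → ℝ) : Prop :=
  ∀ (x : M) (X : TangentSpace (𝓡 4) x), fundForm g J x (K x) X = -differential f x X

/-- `(M, g, J)` is orthotoric with respect to the functions `ξ` and `η`: there are two independent
Hamiltonian Killing vector fields with Poisson-commuting momentum maps `ξ η` and `ξ + η`, and `dξ`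
and `dη` are orthogonal. -/
structure IsOrthotoric (J : EndField M) (ξ η : M → ℝ) : Prop where
  smooth_fst : ContMDiff (𝓡 4) 𝓘(ℝ, ℝ) ∞ ξ
  smooth_snd : ContMDiff (𝓡 4) 𝓘(ℝ, ℝ) ∞ η
  exists_killing : ∃ K₁ K₂ : VecField M,
    IsKilling g K₁ ∧ IsKilling g K₂ ∧
    IsHamiltonian g J K₁ (fun x => ξ x * η x) ∧ IsHamiltonian g J K₂ (fun x => ξ x + η x) ∧
    (∀ x : M, LinearIndependent ℝ ![K₁ x, K₂ x]) ∧
    (∀ x : M, fundForm g J x (K₁ x) (K₂ x) = 0)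
  orthogonal : ∀ x : M, g.inner x (grad g ξ x) (grad g η x) = 0

/-- `P` is the `g`-orthogonal projection of `X` on the subspace `D`. -/
def IsOrthProj {x : M} (D : Submodule ℝ (TangentSpace (𝓡 4) x)) (X P : TangentSpace (𝓡 4) x) :
    Prop :=
  P ∈ D ∧ ∀ Z ∈ D, g.inner x (X - P) Z = 0

/-- `D` is a smooth distribution of rank two. -/
def IsPlaneDistribution (D : (x : M) → Submodule ℝ (TangentSpace (𝓡 4) x)) : Prop :=
  (∀ x : M, Module.finrank ℝ (D x) = 2) ∧
    ∀ x : M, ∃ X Y : VecField M, SmoothVecAt X x ∧ SmoothVecAt Y x ∧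
      ∀ᶠ y in nhds x, D y = Submodule.span ℝ {X y, Y y}

/-- `(M, g, J)` has quasi-constant holomorphic sectional curvature with respect to the distribution
`D`: `D` is a `J`-invariant plane distribution and, for unit vectors `X`, the holomorphic sectional
curvature `R(X, JX, JX, X)` depends only on the base point `x` and the length of the component of
`X` in `D`. -/
structure IsQCHWith (J : EndField M) (D : (x : M) → Submodule ℝ (TangentSpace (𝓡 4) x)) :
    Prop where
  distribution : IsPlaneDistribution D
  invariant : ∀ (x : M), ∀ X ∈ D x, J x X ∈ D x
  curvature : ∃ φ : M → ℝ → ℝ, ∀ (x : M) (X P : TangentSpace (𝓡 4) x),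
    g.inner x X X = 1 → IsOrthProj g (D x) X P →
      riemann g x X (J x X) (J x X) X = φ x (Real.sqrt (g.inner x P P))

/-- `(M, g, J)` is a QCH surface. -/
def IsQCH (J : EndField M) : Prop :=
  ∃ D : (x : M) → Submodule ℝ (TangentSpace (𝓡 4) x), IsQCHWith g J D

end Riemannian

/-- The distribution `ker (J J' + Id)`. -/
def kerDistribution (J J' : EndField M) (x : M) : Submodule ℝ (TangentSpace (𝓡 4) x) :=
  LinearMap.ker ((J x ∘L J' x + ContinuousLinearMap.id ℝ (TangentSpace (𝓡 4) x)).toLinearMap)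

end KahlerSurface

end

/-! Write a = grad ξ, b = grad η, A = |a|², B = |b|². The Hamiltonian condition says K₁ = J grad(ξη)
and K₂ = J grad(ξ + η). Independence of K₁, K₂ forces ξ ≠ η, a ≠ 0 and b ≠ 0 everywhere, and 0 =
ω(K₁, K₂) = (η - ξ) g(Ja, b) gives g(Ja, b) = 0. Together with g(a, b) = 0 this makes a, Ja, b, Jb
an orthogonal frame.

The two Killing equations and the derivatives of g(a, b) = 0 and g(Ja, b) = 0 are linear in Hess ξ
and Hess η. Solving them (`IsAdaptedFrame.hess_eq`) expresses Hess ξ by A, B, ξ - η and one unknown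
function P = Hess ξ(a, a)/A², which is `hessRatio`; Hess η follows by symmetry. So dA is explicit,
and d(dA) = 0 determines dP up to its normal derivative (`fderiv_hessRatio`). The connection is now
explicit in the frame, and Cartan's structure equation (`inner_curvature_eq_dForm`) gives the
curvature. Since R(u, v) is skew and commutes with J, four components determine it, and R depends on
three coefficients only (`curvature_eq`): C_ξ and C_η (`curvPlane` and its swap) and m
(`curvMixed`).

Let J̄ be J on span(a, Ja) and -J on span(b, Jb). The Ricci endomorphism is the scalar -(C_ξ + 2m)
on the first plane and -(C_η + 2m) on the second. Hence J̄ preserves Ric, and ρ₀ = δ ω̄ with δ =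
(C_η - C_ξ)/2. The first plane is ker(J J̄ + Id); a unit vector X whose component in it has squared
length s has holomorphic sectional curvature -(C_ξ s² + C_η (1 - s)² + 8 m s(1 - s)). Integrability
holds because the Nijenhuis tensor is algebraic in ∇J̄, whose components are mixed Hessian entries,
and these cancel (`nijenhuis_conjEnd`).

Tensors at x are computed in the preferred chart around x, and the hypotheses on J and on the
Killing fields are imposed only at chart centres. Coordinate changes are local isometries, so
naturality spreads the hypotheses over a whole chart and shows that C_ξ, C_η, and with them δ, are
smooth on M. -/

noncomputable section

/-! ### Levi-Civita calculus on an open subset of a vector space -/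

namespace ChartCalculus

variable {E : Type*} [NormedAddCommGroup E] [NormedSpace ℝ E]

/-- `G` is a smooth Riemannian metric on the open set `U`. -/
structure IsMetricOn (G : E → E →L[ℝ] E →L[ℝ] ℝ) (U : Set E) : Prop where
  isOpen : IsOpen U
  contDiffOn : ContDiffOn ℝ ∞ G U
  symm : ∀ y ∈ U, ∀ u v, G y u v = G y v u
  pos : ∀ y ∈ U, ∀ u, u ≠ 0 → 0 < G y u u

/-- The covariant derivative `∇ᵤ V` of a vector field `V` at `y`. -/
def covDeriv (G : E → E →L[ℝ] E →L[ℝ] ℝ) (V : E → E) (y u : E) : E :=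
  fderiv ℝ V y u + christoffel G y u (V y)

/-- The gradient of a function. -/
def gradient (G : E → E →L[ℝ] E →L[ℝ] ℝ) (f : E → ℝ) (y : E) : E :=
  (G y).inverse (fderiv ℝ f y)

variable {G : E → E →L[ℝ] E →L[ℝ] ℝ} {U : Set E} {y : E}

theorem fderiv_clm_apply_apply {F H : Type*} [NormedAddCommGroup F] [NormedSpace ℝ F]
    [NormedAddCommGroup H] [NormedSpace ℝ H] {c : E → F →L[ℝ] H} {V : E → F}
    (hc : DifferentiableAt ℝ c y) (hV : DifferentiableAt ℝ V y) (u : E) :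
    fderiv ℝ (fun z => c z (V z)) y u = fderiv ℝ c y u (V y) + c y (fderiv ℝ V y u) := by
  rw [fderiv_clm_apply hc hV]
  simp [add_comm]

theorem isInvertible_of_pos [FiniteDimensional ℝ E] {B : E →L[ℝ] E →L[ℝ] ℝ}
    (hB : ∀ u, u ≠ 0 → 0 < B u u) : B.IsInvertible := by
  have hinj : Function.Injective (B : E →ₗ[ℝ] E →L[ℝ] ℝ) := by
    refine (injective_iff_map_eq_zero _).mpr fun u hu => ?_
    by_contra hne
    have h0 := hB u hne
    rw [show B u = 0 from hu] at h0
    exact lt_irrefl _ h0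
  have hfr : Module.finrank ℝ E = Module.finrank ℝ (E →L[ℝ] ℝ) := by
    rw [← (LinearMap.toContinuousLinearMap (𝕜 := ℝ) (E := E) (F' := ℝ)).finrank_eq]
    exact (Subspace.dual_finrank_eq (K := ℝ) (V := E)).symm
  refine ⟨(LinearEquiv.ofInjectiveOfFinrankEq (B : E →ₗ[ℝ] E →L[ℝ] ℝ) hinj
    hfr).toContinuousLinearEquiv, ?_⟩
  ext v w
  rfl

namespace IsMetricOn

theorem mem_nhds (h : IsMetricOn G U) (hy : y ∈ U) : U ∈ nhds y := h.isOpen.mem_nhds hy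

theorem contDiffAt (h : IsMetricOn G U) (hy : y ∈ U) : ContDiffAt ℝ ∞ G y :=
  h.contDiffOn.contDiffAt (h.mem_nhds hy)

theorem differentiableAt (h : IsMetricOn G U) (hy : y ∈ U) : DifferentiableAt ℝ G y :=
  (h.contDiffAt hy).differentiableAt (by simp)

theorem ext (h : IsMetricOn G U) (hy : y ∈ U) {v w : E} (hvw : ∀ x, G y v x = G y w x) :
    v = w := by
  by_contra hne
  have := h.pos y hy (v - w) (sub_ne_zero.mpr hne)
  rw [(G y).map_sub, sub_apply, hvw, sub_self] at this
  exact lt_irrefl _ this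

theorem fderiv_symm (h : IsMetricOn G U) (hy : y ∈ U) (u v w : E) :
    fderiv ℝ G y u v w = fderiv ℝ G y u w v := by
  have key : ∀ v w : E, fderiv ℝ (fun z => G z v w) y u = fderiv ℝ G y u v w := by
    intro v w
    rw [fderiv_clm_apply_apply ((h.differentiableAt hy).clm_apply (differentiableAt_const v))
      (differentiableAt_const w), fderiv_clm_apply_apply (h.differentiableAt hy)
      (differentiableAt_const v)]
    simp
  rw [← key, ← key]
  congr 1
  apply Filter.EventuallyEq.fderiv_eq
  filter_upwards [h.mem_nhds hy] with z hz using h.symm z hz v w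

theorem christoffelFirst_symm (h : IsMetricOn G U) (hy : y ∈ U) (u v w : E) :
    christoffelFirst G y u v w = christoffelFirst G y v u w := by
  rw [christoffelFirst_apply, christoffelFirst_apply, h.fderiv_symm hy w u v]
  ring

theorem contDiffOn_fderiv {F : Type*} [NormedAddCommGroup F] [NormedSpace ℝ F] {f : E → F}
    (h : IsMetricOn G U) (hf : ContDiffOn ℝ ∞ f U) : ContDiffOn ℝ ∞ (fderiv ℝ f) U :=
  hf.fderiv_of_isOpen h.isOpen (by simp)

variable [FiniteDimensional ℝ E]

theorem isInvertible (h : IsMetricOn G U) (hy : y ∈ U) : (G y).IsInvertible :=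
  isInvertible_of_pos (h.pos y hy)

theorem apply_inverse (h : IsMetricOn G U) (hy : y ∈ U) (φ : E →L[ℝ] ℝ) :
    G y ((G y).inverse φ) = φ := (h.isInvertible hy).self_apply_inverse φ

theorem apply_gradient (h : IsMetricOn G U) (hy : y ∈ U) (f : E → ℝ) (u : E) :
    G y (gradient G f y) u = fderiv ℝ f y u := by
  rw [gradient, h.apply_inverse hy]

theorem apply_christoffel (h : IsMetricOn G U) (hy : y ∈ U) (u v w : E) :
    G y (christoffel G y u v) w = christoffelFirst G y u v w := by
  rw [christoffel, h.apply_inverse hy]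

theorem christoffel_symm (h : IsMetricOn G U) (hy : y ∈ U) (u v : E) :
    christoffel G y u v = christoffel G y v u :=
  h.ext hy fun w => by
    rw [h.apply_christoffel hy, h.apply_christoffel hy, h.christoffelFirst_symm hy]

theorem contDiffOn_inverse (h : IsMetricOn G U) :
    ContDiffOn ℝ ∞ (fun z => (G z).inverse) U := fun _ hz =>
  ((h.isInvertible hz).contDiffAt_map_inverse.comp _ (h.contDiffAt hz)).contDiffWithinAt

theorem contDiffOn_gradient (h : IsMetricOn G U) {f : E → ℝ} (hf : ContDiffOn ℝ ∞ f U) :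
    ContDiffOn ℝ ∞ (gradient G f) U :=
  h.contDiffOn_inverse.clm_apply (h.contDiffOn_fderiv hf)

set_option synthInstance.maxHeartbeats 80000 in
theorem contDiffOn_christoffelFirst (h : IsMetricOn G U) (u v : E) :
    ContDiffOn ℝ ∞ (fun z => christoffelFirst G z u v) U := by
  have hG := h.contDiffOn_fderiv h.contDiffOn
  refine contDiffOn_clm_apply.mpr fun w => ?_
  simp only [christoffelFirst_apply]
  have key : ∀ a b c : E, ContDiffOn ℝ ∞ (fun z => fderiv ℝ G z a b c) U := fun a b c =>
    ((hG.clm_apply contDiffOn_const).clm_apply contDiffOn_const).clm_apply contDiffOn_const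
  exact contDiffOn_const.mul (((key u v w).add (key v u w)).sub (key w u v))

theorem contDiffOn_christoffelBilin (h : IsMetricOn G U) :
    ContDiffOn ℝ ∞ (christoffelBilin G) U := by
  refine contDiffOn_clm_apply.mpr fun u => contDiffOn_clm_apply.mpr fun v => ?_
  exact h.contDiffOn_inverse.clm_apply (h.contDiffOn_christoffelFirst u v)

/-- Metric compatibility: in the sum of the two Christoffel terms of the first kind all derivatives
of `G` cancel except the one along u. -/
theorem fderiv_inner (h : IsMetricOn G U) (hy : y ∈ U) {V W : E → E}
    (hV : DifferentiableAt ℝ V y) (hW : DifferentiableAt ℝ W y) (u : E) :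
    fderiv ℝ (fun z => G z (V z) (W z)) y u =
      G y (covDeriv G V y u) (W y) + G y (V y) (covDeriv G W y u) := by
  rw [fderiv_clm_apply_apply ((h.differentiableAt hy).clm_apply hV) hW,
    fderiv_clm_apply_apply (h.differentiableAt hy) hV]
  simp only [covDeriv, map_add, add_apply]
  rw [h.symm y hy (V y) (christoffel G y u (W y)), h.apply_christoffel hy,
    h.apply_christoffel hy, christoffelFirst_apply, christoffelFirst_apply,
    h.fderiv_symm hy u (W y) (V y), h.fderiv_symm hy (V y) u (W y), h.fderiv_symm hy (W y) u (V y)]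
  ring

end IsMetricOn

theorem fderiv_fderiv_symm {F : Type*} [NormedAddCommGroup F] [NormedSpace ℝ F] {f : E → F}
    (hf : ContDiffAt ℝ ∞ f y) (u v : E) :
    fderiv ℝ (fun z => fderiv ℝ f z v) y u = fderiv ℝ (fun z => fderiv ℝ f z u) y v := by
  have hd : DifferentiableAt ℝ (fderiv ℝ f) y :=
    (hf.fderiv_right (m := ∞) (by simp)).differentiableAt (by simp)
  rw [fderiv_clm_apply_apply hd (differentiableAt_const v),
    fderiv_clm_apply_apply hd (differentiableAt_const u)]
  simpa using (hf.isSymmSndFDerivAt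
    (by
      rw [minSmoothness_of_isRCLikeNormedField]
      exact WithTop.coe_le_coe.mpr (le_top : (2 : ℕ∞) ≤ ⊤))).eq u v

theorem covDeriv_congr {V W : E → E} (hVW : V =ᶠ[nhds y] W) (u : E) :
    covDeriv G V y u = covDeriv G W y u := by
  rw [covDeriv, covDeriv, hVW.fderiv_eq, hVW.eq_of_nhds]

/-- `(G, J)` is a Kähler structure on the open set `U`. -/
structure IsKahlerOn (G : E → E →L[ℝ] E →L[ℝ] ℝ) (J : E → E →L[ℝ] E) (U : Set E) : Prop
    extends IsMetricOn G U where
  contDiffOn_end : ContDiffOn ℝ ∞ J U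
  sq : ∀ y ∈ U, ∀ v, J y (J y v) = -v
  isometry : ∀ y ∈ U, ∀ u v, G y (J y u) (J y v) = G y u v
  parallel : ∀ y ∈ U, ∀ u v, covDerivEnd G J y u v = 0

namespace IsKahlerOn

variable {J : E → E →L[ℝ] E}

theorem covDeriv_end (h : IsKahlerOn G J U) (hy : y ∈ U) {V : E → E}
    (hV : DifferentiableAt ℝ V y) (u : E) :
    covDeriv G (fun z => J z (V z)) y u = J y (covDeriv G V y u) := by
  have hJ : DifferentiableAt ℝ J y :=
    (h.contDiffOn_end.contDiffAt (h.mem_nhds hy)).differentiableAt (by simp)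
  have := h.parallel y hy u (V y)
  rw [covDerivEnd, sub_eq_zero] at this
  rw [covDeriv, fderiv_clm_apply_apply hJ hV, covDeriv, map_add, ← this]
  abel

theorem contDiffOn_end_apply (h : IsKahlerOn G J U) {V : E → E} (hV : ContDiffOn ℝ ∞ V U) :
    ContDiffOn ℝ ∞ (fun z => J z (V z)) U := h.contDiffOn_end.clm_apply hV

end IsKahlerOn

variable [FiniteDimensional ℝ E]

/-- The curvature as the commutator of covariant derivatives. -/
theorem curvature_apply (h : IsMetricOn G U) (hy : y ∈ U) {V : E → E}
    (hV : ContDiffOn ℝ ∞ V U) (u v : E) :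
    curvature (christoffelBilin G) y u v (V y) =
      covDeriv G (fun z => covDeriv G V z v) y u - covDeriv G (fun z => covDeriv G V z u) y v := by
  have hV' := (h.contDiffOn_fderiv hV).contDiffAt (h.mem_nhds hy)
  have hVy := hV.contDiffAt (h.mem_nhds hy)
  have hd : DifferentiableAt ℝ (fderiv ℝ V) y := hV'.differentiableAt (by simp)
  have hdV : DifferentiableAt ℝ V y := hVy.differentiableAt (by simp)
  have hΓ : DifferentiableAt ℝ (christoffelBilin G) y :=
    (h.contDiffOn_christoffelBilin.contDiffAt (h.mem_nhds hy)).differentiableAt (by simp)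
  have key : ∀ u v, covDeriv G (fun z => covDeriv G V z v) y u =
      fderiv ℝ (fun z => fderiv ℝ V z v) y u + (fderiv ℝ (christoffelBilin G) y u v (V y)
        + christoffel G y v (fderiv ℝ V y u)) + (christoffel G y u (fderiv ℝ V y v) +
        christoffel G y u (christoffel G y v (V y))) := by
    intro u v
    have e1 : fderiv ℝ (fun z => fderiv ℝ V z v + christoffelBilin G z v (V z)) y u =
        fderiv ℝ (fun z => fderiv ℝ V z v) y u + (fderiv ℝ (christoffelBilin G) y u v (V y)
        + christoffel G y v (fderiv ℝ V y u)) := by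
      rw [fderiv_fun_add (hd.clm_apply (differentiableAt_const v))
        ((hΓ.clm_apply (differentiableAt_const v)).clm_apply hdV), add_apply,
        fderiv_clm_apply_apply (hΓ.clm_apply (differentiableAt_const v)) hdV,
        fderiv_clm_apply_apply hΓ (differentiableAt_const v)]
      simp
      rfl
    rw [← e1, ← christoffel_add_right]
    rfl
  -- The second derivatives of V and the cross terms Γ(v, ∂ᵤV) + Γ(u, ∂ᵥV) are symmetric in u, v and
  -- drop out. There is no bracket term because u and v are constant fields.
  rw [key, key, fderiv_fderiv_symm hVy u v]
  change fderiv ℝ (christoffelBilin G) y u v (V y) - fderiv ℝ (christoffelBilin G) y v u (V y)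
    + christoffel G y u (christoffel G y v (V y)) - christoffel G y v (christoffel G y u (V y)) = _
  abel

theorem contDiffOn_covDeriv (h : IsMetricOn G U) {V : E → E} (hV : ContDiffOn ℝ ∞ V U) (v : E) :
    ContDiffOn ℝ ∞ (fun z => covDeriv G V z v) U :=
  ((h.contDiffOn_fderiv hV).clm_apply contDiffOn_const).add
    ((h.contDiffOn_christoffelBilin.clm_apply contDiffOn_const).clm_apply hV)

/-- Metric compatibility moves the outer covariant derivative off ∇V. With V and W taken from a
frame, only scalar functions have to be differentiated. -/
theorem inner_curvature (h : IsMetricOn G U) (hy : y ∈ U) {V W : E → E}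
    (hV : ContDiffOn ℝ ∞ V U) (hW : ContDiffOn ℝ ∞ W U) (u v : E) :
    G y (curvature (christoffelBilin G) y u v (V y)) (W y) =
      fderiv ℝ (fun z => G z (covDeriv G V z v) (W z)) y u
      - fderiv ℝ (fun z => G z (covDeriv G V z u) (W z)) y v
      - G y (covDeriv G V y v) (covDeriv G W y u) + G y (covDeriv G V y u) (covDeriv G W y v) := by
  have hWd : DifferentiableAt ℝ W y := (hW.contDiffAt (h.mem_nhds hy)).differentiableAt (by simp)
  have hd : ∀ v, DifferentiableAt ℝ (fun z => covDeriv G V z v) y := fun v =>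
    ((contDiffOn_covDeriv h hV v).contDiffAt (h.mem_nhds hy)).differentiableAt (by simp)
  rw [curvature_apply h hy hV, h.fderiv_inner hy (hd v) hWd, h.fderiv_inner hy (hd u) hWd,
    map_sub, sub_apply]
  ring

/-- `R(u, v)` is skew-symmetric. -/
theorem inner_curvature_skew (h : IsMetricOn G U) (hy : y ∈ U) (u v w t : E) :
    G y (curvature (christoffelBilin G) y u v w) t =
      -G y (curvature (christoffelBilin G) y u v t) w := by
  have hc : ∀ w : E, ContDiffOn ℝ ∞ (fun _ : E => w) U := fun w => contDiffOn_const
  have h1 := inner_curvature h hy (hc w) (hc t) u v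
  have h2 := inner_curvature h hy (hc t) (hc w) u v
  have hd : ∀ w v, DifferentiableAt ℝ (fun z => covDeriv G (fun _ => w) z v) y := fun w v =>
    ((contDiffOn_covDeriv h (hc w) v).contDiffAt (h.mem_nhds hy)).differentiableAt (by simp)
  have hD : ∀ w t v, DifferentiableAt ℝ (fun z => G z (covDeriv G (fun _ => w) z v) t) y :=
    fun w t v => ((h.differentiableAt hy).clm_apply (hd w v)).clm_apply (differentiableAt_const t)
  -- The part symmetric in w, t is a second derivative of G(w, t), hence symmetric in u, v, and
  -- disappears on antisymmetrising.
  have hsum : ∀ u v, fderiv ℝ (fun z => G z (covDeriv G (fun _ => w) z v) t) y u +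
      fderiv ℝ (fun z => G z (covDeriv G (fun _ => t) z v) w) y u =
      fderiv ℝ (fun z => fderiv ℝ (fun z' => G z' w t) z v) y u := by
    intro u v
    rw [← add_apply, ← fderiv_fun_add (hD w t v) (hD t w v)]
    congr 1
    apply Filter.EventuallyEq.fderiv_eq
    filter_upwards [h.mem_nhds hy] with z hz
    rw [h.fderiv_inner hz (differentiableAt_const w) (differentiableAt_const t),
      h.symm z hz w]
  have hsm : ContDiffAt ℝ ∞ (fun z' => G z' w t) y :=
    ((h.contDiffAt hy).clm_apply contDiffAt_const).clm_apply contDiffAt_const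
  have h3 := hsum u v
  have h4 := hsum v u
  rw [fderiv_fderiv_symm hsm] at h3
  rw [h.symm y hy (covDeriv G (fun _ => t) y v), h.symm y hy (covDeriv G (fun _ => t) y u)] at h2
  linarith

namespace IsKahlerOn

variable {J : E → E →L[ℝ] E}

/-- As J is parallel, it commutes with each of the covariant derivatives whose commutator is R(u,
v). -/
theorem curvature_end (h : IsKahlerOn G J U) (hy : y ∈ U) (u v w : E) :
    curvature (christoffelBilin G) y u v (J y w) =
      J y (curvature (christoffelBilin G) y u v w) := by
  have hc : ContDiffOn ℝ ∞ (fun _ : E => w) U := contDiffOn_const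
  have hm := h.toIsMetricOn
  have hd : ∀ v, DifferentiableAt ℝ (fun z => covDeriv G (fun _ => w) z v) y := fun v =>
    ((contDiffOn_covDeriv hm hc v).contDiffAt (h.mem_nhds hy)).differentiableAt (by simp)
  have key : ∀ v, (fun z => covDeriv G (fun z' => J z' w) z v) =ᶠ[nhds y]
      fun z => J z (covDeriv G (fun _ => w) z v) := by
    intro v
    filter_upwards [h.mem_nhds hy] with z hz
    exact h.covDeriv_end hz (differentiableAt_const w) v
  have e1 := curvature_apply hm hy (V := fun z => J z w) (h.contDiffOn_end_apply hc) u v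
  have e2 := curvature_apply hm hy hc u v
  rw [covDeriv_congr (key v), covDeriv_congr (key u), h.covDeriv_end hy (hd v),
    h.covDeriv_end hy (hd u), ← map_sub, ← e2] at e1
  exact e1

end IsKahlerOn

/-- Turns the Killing equation into skew-symmetry of ∇K: the two Christoffel terms add up to the
derivative of `G` along K. -/
theorem IsMetricOn.lieDerivMetric_eq (h : IsMetricOn G U) (hy : y ∈ U) (K : E → E)
    (u v : E) : lieDerivMetric G K y u v =
      G y (covDeriv G K y u) v + G y (covDeriv G K y v) u := by
  simp only [lieDerivMetric, covDeriv, map_add, add_apply]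
  rw [h.apply_christoffel hy, h.apply_christoffel hy, christoffelFirst_apply,
    christoffelFirst_apply, h.symm y hy u (fderiv ℝ K y v), h.fderiv_symm hy u (K y) v,
    h.fderiv_symm hy (K y) u v, h.fderiv_symm hy v u (K y), h.fderiv_symm hy u v (K y),
    h.fderiv_symm hy v (K y) u]
  ring

/-- The Hessian is the second derivative of f minus df(Γ(u, v)), and both are symmetric, the latter
because the connection is torsion-free. -/
theorem IsMetricOn.covDeriv_gradient_symm (h : IsMetricOn G U) (hy : y ∈ U) {f : E → ℝ}
    (hf : ContDiffOn ℝ ∞ f U) (u v : E) :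
    G y (covDeriv G (gradient G f) y u) v = G y (covDeriv G (gradient G f) y v) u := by
  have hd : DifferentiableAt ℝ (gradient G f) y :=
    ((h.contDiffOn_gradient hf).contDiffAt (h.mem_nhds hy)).differentiableAt (by simp)
  have key : ∀ u v, fderiv ℝ (fun z => fderiv ℝ f z v) y u =
      G y (covDeriv G (gradient G f) y u) v + G y (gradient G f y) (christoffel G y u v) := by
    intro u v
    have := h.fderiv_inner hy hd (differentiableAt_const v) u
    simp only [covDeriv, fderiv_fun_const, Pi.zero_apply, zero_apply, zero_add] at this
    rw [covDeriv, ← this]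
    congr 1
    apply Filter.EventuallyEq.fderiv_eq
    filter_upwards [h.mem_nhds hy] with z hz
    rw [h.apply_gradient hz]
  have h1 := key u v
  have h2 := key v u
  rw [fderiv_fderiv_symm (hf.contDiffAt (h.mem_nhds hy)), h2, h.christoffel_symm hy v u] at h1
  linarith

end ChartCalculus

/-! ### Linear algebra of the frame a, ja, b, jb and the opposite complex structure -/

namespace ChartCalculus

variable {E : Type*} [NormedAddCommGroup E] [NormedSpace ℝ E]

/-- `a, j a, b, j b` is an orthogonal frame for the inner product `g`, to which the complex structure
`j` is orthogonal. -/
structure IsAdaptedFrame (g : E →L[ℝ] E →L[ℝ] ℝ) (j : E →L[ℝ] E) (a b : E) : Prop where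
  symm : ∀ u v, g u v = g v u
  pos : ∀ u, u ≠ 0 → 0 < g u u
  sq : ∀ u, j (j u) = -u
  isometry : ∀ u v, g (j u) (j v) = g u v
  ne_fst : a ≠ 0
  ne_snd : b ≠ 0
  inner_eq_zero : g a b = 0
  inner_end_eq_zero : g (j a) b = 0
  finrank_eq : Module.finrank ℝ E = 4

/-- The almost complex structure equal to `j` on the span of `a, j a` and to `-j` on its orthogonal
complement. -/
def conjEnd (g : E →L[ℝ] E →L[ℝ] ℝ) (j : E →L[ℝ] E) (a : E) : E →L[ℝ] E :=
  (2 / g a a) • ((g a).smulRight (j a) - (g (j a)).smulRight a) - j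

theorem conjEnd_apply (g : E →L[ℝ] E →L[ℝ] ℝ) (j : E →L[ℝ] E) (a v : E) :
    conjEnd g j a v = (2 / g a a) • (g a v • j a - g (j a) v • a) - j v := rfl

namespace IsAdaptedFrame

variable {g : E →L[ℝ] E →L[ℝ] ℝ} {j : E →L[ℝ] E} {a b : E}

theorem skew (h : IsAdaptedFrame g j a b) (u v : E) : g (j u) v = -g u (j v) := by
  rw [← h.isometry (j u) v, h.sq, map_neg, neg_apply]

theorem inner_self_end (h : IsAdaptedFrame g j a b) (u : E) : g u (j u) = 0 := by
  have := h.skew u u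
  rw [h.symm] at this
  linarith

theorem swap (h : IsAdaptedFrame g j a b) : IsAdaptedFrame g j b a where
  symm := h.symm
  pos := h.pos
  sq := h.sq
  isometry := h.isometry
  ne_fst := h.ne_snd
  ne_snd := h.ne_fst
  inner_eq_zero := by rw [h.symm, h.inner_eq_zero]
  inner_end_eq_zero := by rw [h.skew, h.symm, h.inner_end_eq_zero, neg_zero]
  finrank_eq := h.finrank_eq

theorem pos_fst (h : IsAdaptedFrame g j a b) : 0 < g a a := h.pos a h.ne_fst

theorem pos_snd (h : IsAdaptedFrame g j a b) : 0 < g b b := h.pos b h.ne_snd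

/-- The Gram matrix of the frame. -/
theorem gram (h : IsAdaptedFrame g j a b) :
    g a (j a) = 0 ∧ g (j a) a = 0 ∧ g (j a) (j a) = g a a ∧ g a b = 0 ∧ g a (j b) = 0 ∧
    g (j a) b = 0 ∧ g (j a) (j b) = 0 ∧ g b a = 0 ∧ g b (j a) = 0 ∧ g (j b) a = 0 ∧
    g (j b) (j a) = 0 ∧ g b (j b) = 0 ∧ g (j b) b = 0 ∧ g (j b) (j b) = g b b := by
  have h1 := h.inner_self_end a
  have h2 := h.inner_self_end b
  have h3 := h.inner_end_eq_zero
  have h4 := h.inner_eq_zero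
  have h5 : g a (j b) = 0 := by rw [← neg_eq_zero, ← h.skew, h3]
  refine ⟨h1, by rw [h.symm, h1], h.isometry a a, h4, h5, h3, by rw [h.isometry, h4],
    by rw [h.symm, h4], by rw [h.symm, h3], by rw [h.symm, h5], by rw [h.isometry, h.symm, h4], h2,
    by rw [h.symm, h2], h.isometry b b⟩

theorem linearIndependent (h : IsAdaptedFrame g j a b) :
    LinearIndependent ℝ ![a, j a, b, j b] := by
  obtain ⟨g1, g2, g3, g4, g5, g6, g7, g8, g9, g10, g11, g12, g13, g14⟩ := h.gram
  have hA := h.pos_fst.ne'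
  have hB := h.pos_snd.ne'
  rw [Fintype.linearIndependent_iff]
  intro c hc
  simp only [Fin.sum_univ_four, Matrix.cons_val] at hc
  have e1 := congrArg (g a) hc
  have e2 := congrArg (g (j a)) hc
  have e3 := congrArg (g b) hc
  have e4 := congrArg (g (j b)) hc
  simp only [map_add, map_smul, smul_eq_mul, map_zero, g1, g2, g3, g4, g5, g6, g7, g8, g9, g10,
    g11, g12, g13, g14, mul_zero, add_zero, zero_add, mul_eq_zero, hA, hB, or_false] at e1 e2 e3 e4
  intro i
  fin_cases i <;> assumption

/-- The frame as a basis. -/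
def basis (h : IsAdaptedFrame g j a b) : Module.Basis (Fin 4) ℝ E :=
  haveI : FiniteDimensional ℝ E := .of_finrank_pos (by rw [h.finrank_eq]; norm_num)
  basisOfLinearIndependentOfCardEqFinrank h.linearIndependent (by simp [h.finrank_eq])

theorem coe_basis (h : IsAdaptedFrame g j a b) : ⇑h.basis = ![a, j a, b, j b] := by
  simp [basis]

theorem decomp (h : IsAdaptedFrame g j a b) (v : E) :
    v = (g a v / g a a) • a + (g (j a) v / g a a) • j a + (g b v / g b b) • b +
      (g (j b) v / g b b) • j b := by
  obtain ⟨g1, g2, g3, g4, g5, g6, g7, g8, g9, g10, g11, g12, g13, g14⟩ := h.gram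
  have hA := h.pos_fst.ne'
  have hB := h.pos_snd.ne'
  have hs := h.basis.sum_repr v
  simp only [Fin.sum_univ_four, coe_basis, Matrix.cons_val] at hs
  have e1 := congrArg (g a) hs
  have e2 := congrArg (g (j a)) hs
  have e3 := congrArg (g b) hs
  have e4 := congrArg (g (j b)) hs
  simp only [map_add, map_smul, smul_eq_mul, g1, g2, g3, g4, g5, g6, g7, g8, g9, g10,
    g11, g12, g13, g14, mul_zero, add_zero, zero_add] at e1 e2 e3 e4
  rw [← e1, ← e2, ← e3, ← e4, mul_div_cancel_right₀ _ hA, mul_div_cancel_right₀ _ hA,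
    mul_div_cancel_right₀ _ hB, mul_div_cancel_right₀ _ hB]
  exact hs.symm

theorem repr_apply (h : IsAdaptedFrame g j a b) (v : E) :
    ⇑(h.basis.repr v) = ![g a v / g a a, g (j a) v / g a a, g b v / g b b, g (j b) v / g b b] := by
  have : v = ∑ i, ![g a v / g a a, g (j a) v / g a a, g b v / g b b, g (j b) v / g b b] i •
      h.basis i := by
    simp only [Fin.sum_univ_four, coe_basis, Matrix.cons_val]
    exact h.decomp v
  conv_lhs => rw [this]
  rw [h.basis.repr_sum_self]

theorem ext (h : IsAdaptedFrame g j a b) {v w : E} (h1 : g a v = g a w)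
    (h2 : g (j a) v = g (j a) w) (h3 : g b v = g b w) (h4 : g (j b) v = g (j b) w) : v = w := by
  rw [h.decomp v, h.decomp w, h1, h2, h3, h4]

theorem inner_eq (h : IsAdaptedFrame g j a b) (v w : E) :
    g v w = (g a v * g a w + g (j a) v * g (j a) w) / g a a +
      (g b v * g b w + g (j b) v * g (j b) w) / g b b := by
  conv_lhs => rw [h.decomp v]
  simp only [map_add, map_smul, smul_eq_mul, add_apply, smul_apply]
  ring

theorem trace_eq (h : IsAdaptedFrame g j a b) (f : E →ₗ[ℝ] E) :
    LinearMap.trace ℝ E f = (g a (f a) + g (j a) (f (j a))) / g a a +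
      (g b (f b) + g (j b) (f (j b))) / g b b := by
  rw [LinearMap.trace_eq_matrix_trace ℝ h.basis, Matrix.trace]
  simp only [Matrix.diag_apply, LinearMap.toMatrix_apply, Fin.sum_univ_four, repr_apply, coe_basis,
    Matrix.cons_val]
  ring

/-- The components of `j v` in the frame. -/
theorem inner_end (h : IsAdaptedFrame g j a b) (v : E) :
    g a (j v) = -g (j a) v ∧ g (j a) (j v) = g a v ∧
    g b (j v) = -g (j b) v ∧ g (j b) (j v) = g b v :=
  ⟨by rw [h.skew, neg_neg], h.isometry a v, by rw [h.skew, neg_neg], h.isometry b v⟩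

/-- The components of `conjEnd g j a v` in the frame. -/
theorem inner_conjEnd (h : IsAdaptedFrame g j a b) (v : E) :
    g a (conjEnd g j a v) = -g (j a) v ∧ g (j a) (conjEnd g j a v) = g a v ∧
    g b (conjEnd g j a v) = g (j b) v ∧ g (j b) (conjEnd g j a v) = -g b v := by
  obtain ⟨g1, g2, g3, g4, g5, g6, g7, g8, g9, g10, g11, g12, g13, g14⟩ := h.gram
  obtain ⟨j1, j2, j3, j4⟩ := h.inner_end v
  have hA := h.pos_fst.ne'
  simp only [conjEnd_apply, map_sub, map_smul, smul_eq_mul, j1, j2, j3, j4, g1, g2, g3, g8, g9,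
    g10, g11]
  refine ⟨?_, ?_, ?_, ?_⟩ <;> field_simp <;> ring

theorem conjEnd_fst (h : IsAdaptedFrame g j a b) : conjEnd g j a a = j a := by
  obtain ⟨c1, c2, c3, c4⟩ := h.inner_conjEnd a
  obtain ⟨j1, j2, j3, j4⟩ := h.inner_end a
  obtain ⟨g1, g2, g3, g4, g5, g6, g7, g8, g9, g10, g11, g12, g13, g14⟩ := h.gram
  exact h.ext (by rw [c1, j1]) (by rw [c2, j2]) (by rw [c3, j3, g10, neg_zero])
    (by rw [c4, j4, g8, neg_zero])

theorem conjEnd_snd (h : IsAdaptedFrame g j a b) : conjEnd g j a b = -j b := by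
  obtain ⟨c1, c2, c3, c4⟩ := h.inner_conjEnd b
  obtain ⟨j1, j2, j3, j4⟩ := h.inner_end b
  obtain ⟨g1, g2, g3, g4, g5, g6, g7, g8, g9, g10, g11, g12, g13, g14⟩ := h.gram
  refine h.ext ?_ ?_ ?_ ?_ <;> rw [map_neg]
  · rw [c1, j1, g6, neg_zero, neg_zero]
  · rw [c2, j2, g4, neg_zero]
  · rw [c3, j3, neg_neg]
  · rw [c4, j4]

theorem conjEnd_sq (h : IsAdaptedFrame g j a b) (v : E) :
    conjEnd g j a (conjEnd g j a v) = -v := by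
  obtain ⟨c1, c2, c3, c4⟩ := h.inner_conjEnd v
  obtain ⟨d1, d2, d3, d4⟩ := h.inner_conjEnd (conjEnd g j a v)
  refine h.ext ?_ ?_ ?_ ?_ <;> simp only [d1, d2, d3, d4, c1, c2, c3, c4, map_neg]

theorem conjEnd_isometry (h : IsAdaptedFrame g j a b) (v w : E) :
    g (conjEnd g j a v) (conjEnd g j a w) = g v w := by
  obtain ⟨c1, c2, c3, c4⟩ := h.inner_conjEnd v
  obtain ⟨d1, d2, d3, d4⟩ := h.inner_conjEnd w
  rw [h.inner_eq, h.inner_eq v w]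
  simp only [d1, d2, d3, d4, c1, c2, c3, c4]
  ring

/-- The kernel of `j ∘ conjEnd g j a + id` is the plane spanned by `a` and `j a`. -/
theorem end_conjEnd_eq_neg_iff (h : IsAdaptedFrame g j a b) (v : E) :
    j (conjEnd g j a v) + v = 0 ↔ g b v = 0 ∧ g (j b) v = 0 := by
  obtain ⟨c1, c2, c3, c4⟩ := h.inner_conjEnd v
  obtain ⟨d1, d2, d3, d4⟩ := h.inner_end (conjEnd g j a v)
  constructor
  · intro hv
    have e3 := congrArg (g b) hv
    have e4 := congrArg (g (j b)) hv
    simp only [map_add, map_zero, d3, d4, c3, c4] at e3 e4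
    constructor <;> linarith
  · rintro ⟨e3, e4⟩
    refine h.ext ?_ ?_ ?_ ?_ <;>
      simp only [map_add, d1, d2, d3, d4, c1, c2, c3, c4, e3, e4, map_zero] <;> ring

/-- ½ ω ∧ ω is a top-degree form whose value on the frame is |a|²|b|²; this identity yields its
nonvanishing on independent vectors. -/
theorem volume_eq (h : IsAdaptedFrame g j a b) (X : Fin 4 → E) :
    g (j (X 0)) (X 1) * g (j (X 2)) (X 3) - g (j (X 0)) (X 2) * g (j (X 1)) (X 3)
      + g (j (X 0)) (X 3) * g (j (X 1)) (X 2) =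
    g a a * g b b * (h.basis.toMatrix X).det := by
  have hA := h.pos_fst.ne'
  have hB := h.pos_snd.ne'
  simp only [h.inner_eq (j (X 0)), h.inner_eq (j (X 1)), h.inner_eq (j (X 2))]
  simp only [h.inner_end, Matrix.det_succ_row_zero, Fin.sum_univ_succ, Module.Basis.toMatrix_apply,
    repr_apply]
  simp [Fin.succAbove, Fin.succ, Module.Basis.toMatrix_apply, repr_apply]
  field_simp
  ring

/-- If ω = ω₁ + ω₂ along the two planes, the form of `conjEnd` is ω₁ - ω₂. As ωᵢ ∧ ωᵢ = 0, half the
square is ω₁ ∧ ω₂ for the first and -ω₁ ∧ ω₂ for the second. -/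
theorem conj_volume_eq (h : IsAdaptedFrame g j a b) (X : Fin 4 → E) :
    g (conjEnd g j a (X 0)) (X 1) * g (conjEnd g j a (X 2)) (X 3)
      - g (conjEnd g j a (X 0)) (X 2) * g (conjEnd g j a (X 1)) (X 3)
      + g (conjEnd g j a (X 0)) (X 3) * g (conjEnd g j a (X 1)) (X 2) =
    -(g (j (X 0)) (X 1) * g (j (X 2)) (X 3) - g (j (X 0)) (X 2) * g (j (X 1)) (X 3)
      + g (j (X 0)) (X 3) * g (j (X 1)) (X 2)) := by
  simp only [h.inner_eq (j (X 0)), h.inner_eq (j (X 1)), h.inner_eq (j (X 2)),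
    h.inner_eq (conjEnd g j a (X 0)), h.inner_eq (conjEnd g j a (X 1)),
    h.inner_eq (conjEnd g j a (X 2))]
  simp only [h.inner_end, h.inner_conjEnd]
  ring

theorem volume_ne_zero (h : IsAdaptedFrame g j a b) {X : Fin 4 → E}
    (hX : LinearIndependent ℝ X) :
    g (j (X 0)) (X 1) * g (j (X 2)) (X 3) - g (j (X 0)) (X 2) * g (j (X 1)) (X 3)
      + g (j (X 0)) (X 3) * g (j (X 1)) (X 2) ≠ 0 := by
  rw [h.volume_eq]
  refine mul_ne_zero (mul_ne_zero h.pos_fst.ne' h.pos_snd.ne') ?_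
  have : FiniteDimensional ℝ E := .of_finrank_pos (by rw [h.finrank_eq]; norm_num)
  have hu := (h.basis.is_basis_iff_det (v := X)).mp
    ⟨hX, hX.span_eq_top_of_card_eq_finrank (by simp [h.finrank_eq])⟩
  rw [Module.Basis.det_apply] at hu
  exact hu.ne_zero

end IsAdaptedFrame

end ChartCalculus

/-! ### Orthotoric data in a chart and the Hessians of ξ and η -/

namespace ChartCalculus

variable {E : Type*} [NormedAddCommGroup E] [NormedSpace ℝ E]

theorem gradient_add {G : E → E →L[ℝ] E →L[ℝ] ℝ} {f k : E → ℝ} {y : E}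
    (hf : DifferentiableAt ℝ f y) (hk : DifferentiableAt ℝ k y) :
    gradient G (fun w => f w + k w) y = gradient G f y + gradient G k y := by
  rw [gradient, fderiv_fun_add hf hk, map_add]
  rfl

theorem gradient_mul {G : E → E →L[ℝ] E →L[ℝ] ℝ} {f k : E → ℝ} {y : E}
    (hf : DifferentiableAt ℝ f y) (hk : DifferentiableAt ℝ k y) :
    gradient G (fun w => f w * k w) y = k y • gradient G f y + f y • gradient G k y := by
  rw [gradient, fderiv_fun_mul hf hk, map_add, map_smul, map_smul, add_comm]
  rfl

/-- The data of an orthotoric Kähler surface on an open set `U` of a vector space. -/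
structure IsOrthotoricOn (G : E → E →L[ℝ] E →L[ℝ] ℝ) (J : E → E →L[ℝ] E) (ξ η : E → ℝ)
    (U : Set E) : Prop extends IsKahlerOn G J U where
  contDiffOn_fst : ContDiffOn ℝ ∞ ξ U
  contDiffOn_snd : ContDiffOn ℝ ∞ η U
  killing_mul : ∀ y ∈ U, ∀ u v,
    lieDerivMetric G (fun z => J z (gradient G (fun w => ξ w * η w) z)) y u v = 0
  killing_add : ∀ y ∈ U, ∀ u v,
    lieDerivMetric G (fun z => J z (gradient G (fun w => ξ w + η w) z)) y u v = 0
  ne : ∀ y ∈ U, ξ y ≠ η y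
  frame : ∀ y ∈ U, IsAdaptedFrame (G y) (J y) (gradient G ξ y) (gradient G η y)

/-- The squared length of the gradient of `f`. -/
def gradSq (G : E → E →L[ℝ] E →L[ℝ] ℝ) (f : E → ℝ) (y : E) : ℝ :=
  G y (gradient G f y) (gradient G f y)

/-- The Hessian of `f` on its gradient, divided by the fourth power of the length of the gradient. -/
def hessRatio (G : E → E →L[ℝ] E →L[ℝ] ℝ) (f : E → ℝ) (y : E) : ℝ :=
  fderiv ℝ (gradSq G f) y (gradient G f y) / (2 * gradSq G f y ^ 2)

/-- The normal derivative of `hessRatio G f`. -/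
def hessRatioDeriv (G : E → E →L[ℝ] E →L[ℝ] ℝ) (f : E → ℝ) (y : E) : ℝ :=
  fderiv ℝ (hessRatio G f) y (gradient G f y) / gradSq G f y

theorem IsAdaptedFrame.hess_eq {g : E →L[ℝ] E →L[ℝ] ℝ} {j : E →L[ℝ] E} {a b : E}
    (h : IsAdaptedFrame g j a b) {Ha Hb : E → E} {x y A B P : ℝ} (hxy : x - y ≠ 0)
    (hA : g a a = A) (hB : g b b = B)
    (hsa : ∀ u v, g (Ha u) v = g (Ha v) u) (hsb : ∀ u v, g (Hb u) v = g (Hb v) u)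
    (hadd : ∀ u v, g (j (Ha u)) v + g (j (Hb u)) v + (g (j (Ha v)) u + g (j (Hb v)) u) = 0)
    (hmul : ∀ u v, g b u * g (j a) v + y * g (j (Ha u)) v + g a u * g (j b) v +
      x * g (j (Hb u)) v + (g b v * g (j a) u + y * g (j (Ha v)) u + g a v * g (j b) u +
      x * g (j (Hb v)) u) = 0)
    (horth : ∀ u, g (Ha u) b + g a (Hb u) = 0)
    (hpoisson : ∀ u, g (j (Ha u)) b + g (j a) (Hb u) = 0)
    (hP : g a (Ha a) = A ^ 2 * P) (u : E) :
    g a (Ha u) = A * (P * g a u + g b u / (2 * (x - y))) ∧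
    g (j a) (Ha u) = A * (P * g (j a) u - g (j b) u / (2 * (x - y))) ∧
    g b (Ha u) = (A * g b u + B * g a u) / (2 * (x - y)) ∧
    g (j b) (Ha u) = (A * g (j b) u - B * g (j a) u) / (2 * (x - y)) := by
  have hA0 : A ≠ 0 := hA ▸ h.pos_fst.ne'
  have hB0 : B ≠ 0 := hB ▸ h.pos_snd.ne'
  obtain ⟨g1, g2, g3, g4, g5, g6, g7, g8, g9, g10, g11, g12, g13, g14⟩ := h.gram
  rw [hA] at g3
  rw [hB] at g14
  -- Eliminating `Hb` from the two Killing equations leaves a condition on `Ha` alone; `kB`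
  -- eliminates `Ha` instead. Dividing by x - y is what requires ξ ≠ η.
  have kA : ∀ u v, (x - y) * (g (Ha u) (j v) + g (Ha v) (j u)) =
      -(g b u * g (j a) v + g a u * g (j b) v + g b v * g (j a) u + g a v * g (j b) u) := by
    intro u v
    have e1 := hadd u v
    have e2 := hmul u v
    simp only [h.skew (Ha _), h.skew (Hb _)] at e1 e2
    linear_combination e2 - x * e1
  have kB : ∀ u v, (x - y) * (g (Hb u) (j v) + g (Hb v) (j u)) =
      g b u * g (j a) v + g a u * g (j b) v + g b v * g (j a) u + g a v * g (j b) u := by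
    intro u v
    have e1 := hadd u v
    have e2 := hmul u v
    simp only [h.skew (Ha _), h.skew (Hb _)] at e1 e2
    linear_combination -e2 + y * e1
  have ho : ∀ u, g (Ha u) b + g (Hb u) a = 0 := fun u => by rw [h.symm (Hb u), horth]
  have hp : ∀ u, -g (Ha u) (j b) + g (Hb u) (j a) = 0 := fun u => by
    rw [← h.skew, h.symm (Hb u), hpoisson]
  rw [h.symm] at hP
  have s21 := hsa (j a) a
  have s31 := hsa b a
  have s41 := hsa (j b) a
  have s32 := hsa b (j a)
  have s42 := hsa (j b) (j a)
  have s43 := hsa (j b) b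
  have t21 := hsb (j a) a
  have t31 := hsb b a
  have t41 := hsb (j b) a
  have t32 := hsb b (j a)
  have t42 := hsb (j b) (j a)
  have t43 := hsb (j b) b
  have a11 := kA a a
  have a12 := kA a (j a)
  have a13 := kA a b
  have a14 := kA a (j b)
  have a33 := kA b b
  have a34 := kA b (j b)
  have b11 := kB a a
  have b12 := kB a (j a)
  have b14 := kB a (j b)
  simp only [h.sq, map_neg, hA, hB, g1, g2, g3, g4, g5, g6, g7, g8, g9, g10, g11, g12, g13, g14,
    mul_zero, zero_mul, add_zero, zero_add, neg_zero, mul_eq_zero, hxy, false_or]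
    at a11 a12 a13 a14 a33 a34 b11 b12 b14
  have o1 := ho a
  have o2 := ho (j a)
  have o3 := ho b
  have o4 := ho (j b)
  have p1 := hp a
  have p2 := hp (j a)
  have p3 := hp b
  have p4 := hp (j b)
  have h12 : g (Ha a) (j a) = 0 := by linarith
  have h22 : g (Ha (j a)) (j a) = A ^ 2 * P := by linarith
  have h14 : g (Ha a) (j b) = 0 := by linarith
  have h23 : g (Ha (j a)) b = 0 := by linarith
  have h13 : g (Ha a) b = A * B / (2 * (x - y)) := by
    field_simp
    have e : g (Ha (j a)) (j b) = -g (Ha a) b := by linarith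
    rw [s41, s42] at *
    rw [e] at a14
    linarith
  have h24 : g (Ha (j a)) (j b) = -(A * B / (2 * (x - y))) := by linarith
  have h34 : g (Ha b) (j b) = 0 := by linarith
  have k13 : g (Hb a) b = -(A * B / (2 * (x - y))) := by
    have e : g (Hb (j b)) (j a) = -g (Hb a) b := by linarith
    rw [e] at b14
    field_simp
    linarith
  have h33 : g (Ha b) b = A * B / (2 * (x - y)) := by linarith
  have h44 : g (Ha (j b)) (j b) = A * B / (2 * (x - y)) := by linarith
  -- All entries of `Ha` are known; expanding u in the frame gives the formulas for arbitrary u.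
  have hd := h.decomp u
  have expand : ∀ w, g w (Ha u) = g a u / A * g (Ha w) a + g (j a) u / A * g (Ha w) (j a) +
      g b u / B * g (Ha w) b + g (j b) u / B * g (Ha w) (j b) := by
    intro w
    rw [h.symm, hsa]
    conv_lhs => rw [hd]
    rw [hA, hB]
    simp only [map_add, map_smul, smul_eq_mul]
  rw [expand, expand, expand, expand, s21, s31, s41, s32, s42, s43, hP, h12, h22, h14, h23, h13,
    h24, h34, h33, h44]
  refine ⟨?_, ?_, ?_, ?_⟩ <;> field_simp <;> ring

namespace IsOrthotoricOn

variable {G : E → E →L[ℝ] E →L[ℝ] ℝ} {J : E → E →L[ℝ] E} {ξ η : E → ℝ} {U : Set E} {y : E}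

/-- The data are symmetric in ξ and η, so every formula proved for ξ also yields the one for η. -/
theorem swap (h : IsOrthotoricOn G J ξ η U) : IsOrthotoricOn G J η ξ U where
  toIsKahlerOn := h.toIsKahlerOn
  contDiffOn_fst := h.contDiffOn_snd
  contDiffOn_snd := h.contDiffOn_fst
  killing_mul := by simpa only [mul_comm] using h.killing_mul
  killing_add := by simpa only [add_comm] using h.killing_add
  ne y hy := (h.ne y hy).symm
  frame y hy := (h.frame y hy).swap

theorem differentiableAt_fst (h : IsOrthotoricOn G J ξ η U) (hy : y ∈ U) :
    DifferentiableAt ℝ ξ y :=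
  (h.contDiffOn_fst.contDiffAt (h.mem_nhds hy)).differentiableAt (by simp)

theorem gradient_add (h : IsOrthotoricOn G J ξ η U) {z : E} (hz : z ∈ U) :
    gradient G (fun w => ξ w + η w) z = gradient G ξ z + gradient G η z :=
  ChartCalculus.gradient_add (h.differentiableAt_fst hz) (h.swap.differentiableAt_fst hz)

theorem gradient_mul (h : IsOrthotoricOn G J ξ η U) {z : E} (hz : z ∈ U) :
    gradient G (fun w => ξ w * η w) z = η z • gradient G ξ z + ξ z • gradient G η z :=
  ChartCalculus.gradient_mul (h.differentiableAt_fst hz) (h.swap.differentiableAt_fst hz)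

variable [FiniteDimensional ℝ E]

theorem contDiffOn_grad (h : IsOrthotoricOn G J ξ η U) : ContDiffOn ℝ ∞ (gradient G ξ) U :=
  h.contDiffOn_gradient h.contDiffOn_fst

theorem differentiableAt_grad (h : IsOrthotoricOn G J ξ η U) (hy : y ∈ U) :
    DifferentiableAt ℝ (gradient G ξ) y :=
  (h.contDiffOn_grad.contDiffAt (h.mem_nhds hy)).differentiableAt (by simp)

/-- The Killing equation for `J grad (ξ + η)`. -/
theorem hess_add (h : IsOrthotoricOn G J ξ η U) (hy : y ∈ U) (u v : E) :
    G y (J y (covDeriv G (gradient G ξ) y u)) v + G y (J y (covDeriv G (gradient G η) y u)) v +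
    (G y (J y (covDeriv G (gradient G ξ) y v)) u +
      G y (J y (covDeriv G (gradient G η) y v)) u) = 0 := by
  have hc : ∀ u, covDeriv G (fun z => J z (gradient G (fun w => ξ w + η w) z)) y u =
      J y (covDeriv G (gradient G ξ) y u) + J y (covDeriv G (gradient G η) y u) := by
    intro u
    have he : (fun z => J z (gradient G (fun w => ξ w + η w) z)) =ᶠ[nhds y]
        fun z => J z (gradient G ξ z + gradient G η z) := by
      filter_upwards [h.mem_nhds hy] with z hz
      rw [h.gradient_add hz]
    rw [covDeriv_congr he, h.covDeriv_end hy
      ((h.differentiableAt_grad hy).fun_add (h.swap.differentiableAt_grad hy)), ← map_add]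
    simp only [covDeriv]
    rw [fderiv_fun_add (h.differentiableAt_grad hy) (h.swap.differentiableAt_grad hy),
      christoffel_add_right]
    simp only [add_apply]
    congr 1
    abel
  have := h.killing_add y hy u v
  rw [h.lieDerivMetric_eq hy, hc, hc] at this
  simpa only [map_add, add_apply] using this

/-- The Killing equation for `J grad (ξ η)`. -/
theorem hess_mul (h : IsOrthotoricOn G J ξ η U) (hy : y ∈ U) (u v : E) :
    G y (gradient G η y) u * G y (J y (gradient G ξ y)) v +
    η y * G y (J y (covDeriv G (gradient G ξ) y u)) v +
    G y (gradient G ξ y) u * G y (J y (gradient G η y)) v +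
    ξ y * G y (J y (covDeriv G (gradient G η) y u)) v +
    (G y (gradient G η y) v * G y (J y (gradient G ξ y)) u +
    η y * G y (J y (covDeriv G (gradient G ξ) y v)) u +
    G y (gradient G ξ y) v * G y (J y (gradient G η y)) u +
    ξ y * G y (J y (covDeriv G (gradient G η) y v)) u) = 0 := by
  have hc : ∀ u, covDeriv G (fun z => J z (gradient G (fun w => ξ w * η w) z)) y u =
      G y (gradient G η y) u • J y (gradient G ξ y) + η y • J y (covDeriv G (gradient G ξ) y u) +
      (G y (gradient G ξ y) u • J y (gradient G η y) +
        ξ y • J y (covDeriv G (gradient G η) y u)) := by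
    intro u
    have he : (fun z => J z (gradient G (fun w => ξ w * η w) z)) =ᶠ[nhds y]
        fun z => J z (η z • gradient G ξ z + ξ z • gradient G η z) := by
      filter_upwards [h.mem_nhds hy] with z hz
      rw [h.gradient_mul hz]
    have d1 := (h.swap.differentiableAt_fst hy).fun_smul (h.differentiableAt_grad hy)
    have d2 := (h.differentiableAt_fst hy).fun_smul (h.swap.differentiableAt_grad hy)
    rw [covDeriv_congr he, h.covDeriv_end hy (d1.fun_add d2)]
    simp only [← map_smul, ← map_add]
    congr 1
    simp only [covDeriv]
    rw [fderiv_fun_add d1 d2, fderiv_fun_smul (h.swap.differentiableAt_fst hy)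
      (h.differentiableAt_grad hy), fderiv_fun_smul (h.differentiableAt_fst hy)
      (h.swap.differentiableAt_grad hy), christoffel_add_right, christoffel_smul_right,
      christoffel_smul_right, h.apply_gradient hy, h.apply_gradient hy]
    simp only [add_apply, smul_apply, ContinuousLinearMap.smulRight_apply, smul_add]
    abel
  have := h.killing_mul y hy u v
  rw [h.lieDerivMetric_eq hy, hc, hc] at this
  simp only [map_add, add_apply, map_smul, smul_apply, smul_eq_mul] at this
  linarith

/-- The derivative of `g(grad ξ, grad η) = 0`. -/
theorem inner_hess_add (h : IsOrthotoricOn G J ξ η U) (hy : y ∈ U) (u : E) :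
    G y (covDeriv G (gradient G ξ) y u) (gradient G η y) +
      G y (gradient G ξ y) (covDeriv G (gradient G η) y u) = 0 := by
  rw [← h.fderiv_inner hy (h.differentiableAt_grad hy) (h.swap.differentiableAt_grad hy)]
  have : (fun z => G z (gradient G ξ z) (gradient G η z)) =ᶠ[nhds y] fun _ => 0 := by
    filter_upwards [h.mem_nhds hy] with z hz using (h.frame z hz).inner_eq_zero
  rw [this.fderiv_eq]
  simp

/-- The derivative of `g(J grad ξ, grad η) = 0`. -/
theorem inner_end_hess_add (h : IsOrthotoricOn G J ξ η U) (hy : y ∈ U) (u : E) :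
    G y (J y (covDeriv G (gradient G ξ) y u)) (gradient G η y) +
      G y (J y (gradient G ξ y)) (covDeriv G (gradient G η) y u) = 0 := by
  have hd : DifferentiableAt ℝ (fun z => J z (gradient G ξ z)) y :=
    ((h.contDiffOn_end_apply h.contDiffOn_grad).contDiffAt (h.mem_nhds hy)).differentiableAt
      (by simp)
  rw [← h.covDeriv_end hy (h.differentiableAt_grad hy),
    ← h.fderiv_inner hy hd (h.swap.differentiableAt_grad hy)]
  have : (fun z => G z (J z (gradient G ξ z)) (gradient G η z)) =ᶠ[nhds y] fun _ => 0 := by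
    filter_upwards [h.mem_nhds hy] with z hz using (h.frame z hz).inner_end_eq_zero
  rw [this.fderiv_eq]
  simp

theorem fderiv_gradSq (h : IsOrthotoricOn G J ξ η U) (hy : y ∈ U) (u : E) :
    fderiv ℝ (gradSq G ξ) y u =
      2 * G y (gradient G ξ y) (covDeriv G (gradient G ξ) y u) := by
  unfold gradSq
  rw [h.fderiv_inner hy (h.differentiableAt_grad hy) (h.differentiableAt_grad hy), h.symm y hy,
    two_mul]

/-- The Hessian of `ξ`, in terms of the frame given by the gradients. -/
theorem hess_eq (h : IsOrthotoricOn G J ξ η U) (hy : y ∈ U) (u : E) :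
    G y (gradient G ξ y) (covDeriv G (gradient G ξ) y u) = gradSq G ξ y *
      (hessRatio G ξ y * G y (gradient G ξ y) u + G y (gradient G η y) u / (2 * (ξ y - η y))) ∧
    G y (J y (gradient G ξ y)) (covDeriv G (gradient G ξ) y u) = gradSq G ξ y *
      (hessRatio G ξ y * G y (J y (gradient G ξ y)) u
        - G y (J y (gradient G η y)) u / (2 * (ξ y - η y))) ∧
    G y (gradient G η y) (covDeriv G (gradient G ξ) y u) =
      (gradSq G ξ y * G y (gradient G η y) u + gradSq G η y * G y (gradient G ξ y) u) /
        (2 * (ξ y - η y)) ∧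
    G y (J y (gradient G η y)) (covDeriv G (gradient G ξ) y u) =
      (gradSq G ξ y * G y (J y (gradient G η y)) u -
        gradSq G η y * G y (J y (gradient G ξ y)) u) / (2 * (ξ y - η y)) := by
  have hF := h.frame y hy
  have hs : ξ y - η y ≠ 0 := sub_ne_zero.mpr (h.ne y hy)
  have hA : gradSq G ξ y ≠ 0 := hF.pos_fst.ne'
  have hB : gradSq G η y ≠ 0 := hF.pos_snd.ne'
  -- dA(a) = 2 Hess ξ(a, a), whence the factor 2 in the denominator of `hessRatio`.
  have hP := h.fderiv_gradSq hy (gradient G ξ y)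
  have hPdef : hessRatio G ξ y = fderiv ℝ (gradSq G ξ) y (gradient G ξ y) /
    (2 * gradSq G ξ y ^ 2) := rfl
  rw [hP] at hPdef
  refine hF.hess_eq hs rfl rfl (h.covDeriv_gradient_symm hy h.contDiffOn_fst)
    (h.covDeriv_gradient_symm hy h.contDiffOn_snd) (h.hess_add hy) (h.hess_mul hy)
    (h.inner_hess_add hy) (h.inner_end_hess_add hy) ?_ u
  rw [hPdef]
  change _ = gradSq G ξ y ^ 2 * _
  field_simp

end IsOrthotoricOn

end ChartCalculus

/-! ### Exterior derivatives and the curvature components in the frame -/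

namespace ChartCalculus

variable {E : Type*} [NormedAddCommGroup E] [NormedSpace ℝ E]

/-- The exterior derivative of a field `θ` of linear forms, on constant vectors `u`, `v`. -/
def dForm (θ : E → E → ℝ) (y u v : E) : ℝ :=
  fderiv ℝ (fun z => θ z v) y u - fderiv ℝ (fun z => θ z u) y v

theorem dForm_congr {θ θ' : E → E → ℝ} {U : Set E} {y : E} (hU : U ∈ nhds y)
    (h : ∀ z ∈ U, ∀ v, θ z v = θ' z v) (u v : E) : dForm θ y u v = dForm θ' y u v := by
  have key : ∀ v, (fun z => θ z v) =ᶠ[nhds y] fun z => θ' z v := fun v => by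
    filter_upwards [hU] with z hz using h z hz v
  rw [dForm, dForm, (key v).fderiv_eq, (key u).fderiv_eq]

/-- The connection forms used below, like dA itself, are combinations of two frame covectors, so
this one Leibniz rule serves for all of them. -/
theorem dForm_comb {c d : E → ℝ} {θ θ' : E → E → ℝ} {y : E} (hc : DifferentiableAt ℝ c y)
    (hd : DifferentiableAt ℝ d y) (hθ : ∀ v, DifferentiableAt ℝ (fun z => θ z v) y)
    (hθ' : ∀ v, DifferentiableAt ℝ (fun z => θ' z v) y) (u v : E) :
    dForm (fun z w => c z * θ z w + d z * θ' z w) y u v =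
      fderiv ℝ c y u * θ y v - fderiv ℝ c y v * θ y u + c y * dForm θ y u v +
      (fderiv ℝ d y u * θ' y v - fderiv ℝ d y v * θ' y u + d y * dForm θ' y u v) := by
  have key : ∀ u v, fderiv ℝ (fun z => c z * θ z v + d z * θ' z v) y u =
      fderiv ℝ c y u * θ y v + c y * fderiv ℝ (fun z => θ z v) y u +
      (fderiv ℝ d y u * θ' y v + d y * fderiv ℝ (fun z => θ' z v) y u) := by
    intro u v
    rw [fderiv_fun_add (hc.fun_mul (hθ v)) (hd.fun_mul (hθ' v)), fderiv_fun_mul hc (hθ v),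
      fderiv_fun_mul hd (hθ' v)]
    simp only [add_apply, smul_apply, smul_eq_mul]
    ring
  simp only [dForm, key]
  ring

theorem differentiableAt_div {f g : E → ℝ} {y : E} (hf : DifferentiableAt ℝ f y)
    (hg : DifferentiableAt ℝ g y) (h0 : g y ≠ 0) :
    DifferentiableAt ℝ (fun z => f z / g z) y := by
  simp only [div_eq_mul_inv]
  exact hf.fun_mul (hg.inv h0)

theorem fderiv_div_apply {f g : E → ℝ} {y : E} (hf : DifferentiableAt ℝ f y)
    (hg : DifferentiableAt ℝ g y) (h0 : g y ≠ 0) (u : E) :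
    fderiv ℝ (fun z => f z / g z) y u =
      (fderiv ℝ f y u * g y - f y * fderiv ℝ g y u) / g y ^ 2 := by
  have hq : DifferentiableAt ℝ (fun z => f z / g z) y := differentiableAt_div hf hg h0
  have he : f =ᶠ[nhds y] fun z => f z / g z * g z := by
    filter_upwards [hg.continuousAt.eventually_ne h0] with z hz
    rw [div_mul_cancel₀ _ hz]
  have := congrArg (fun φ : E →L[ℝ] ℝ => φ u) he.fderiv_eq
  simp only [fderiv_fun_mul hq hg, add_apply, smul_apply, smul_eq_mul] at this
  rw [this]
  field_simp
  ring

theorem IsMetricOn.dForm_inner {G : E → E →L[ℝ] E →L[ℝ] ℝ} {U : Set E} {y : E}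
    [FiniteDimensional ℝ E] (h : IsMetricOn G U) (hy : y ∈ U) {V : E → E}
    (hV : DifferentiableAt ℝ V y) (u v : E) :
    dForm (fun z w => G z (V z) w) y u v =
      G y (covDeriv G V y u) v - G y (covDeriv G V y v) u := by
  rw [dForm, h.fderiv_inner hy hV (differentiableAt_const v),
    h.fderiv_inner hy hV (differentiableAt_const u)]
  simp only [covDeriv, fderiv_fun_const, Pi.zero_apply, zero_apply, zero_add]
  rw [h.christoffel_symm hy v u]
  ring

/-- Cartan's second structure equation for the connection form g(W, ∇V), with the quadratic terms
left as inner products to be expanded in the frame. -/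
theorem inner_curvature_eq_dForm {G : E → E →L[ℝ] E →L[ℝ] ℝ} {U : Set E} {y : E}
    [FiniteDimensional ℝ E] (h : IsMetricOn G U) (hy : y ∈ U) {V W : E → E}
    (hV : ContDiffOn ℝ ∞ V U) (hW : ContDiffOn ℝ ∞ W U) (u v : E) :
    G y (curvature (christoffelBilin G) y u v (V y)) (W y) =
      dForm (fun z w => G z (W z) (covDeriv G V z w)) y u v
      - G y (covDeriv G V y v) (covDeriv G W y u) + G y (covDeriv G V y u) (covDeriv G W y v) := by
  rw [inner_curvature h hy hV hW, ← dForm_congr (h.mem_nhds hy)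
    (θ := fun z w => G z (covDeriv G V z w) (W z)) (fun z hz v => h.symm z hz _ _), dForm]

/-- The curvature coefficient of the plane of `grad ξ` and `J grad ξ`. -/
def curvPlane (G : E → E →L[ℝ] E →L[ℝ] ℝ) (ξ η : E → ℝ) (y : E) : ℝ :=
  gradSq G ξ y * hessRatioDeriv G ξ y + 2 * gradSq G ξ y * hessRatio G ξ y ^ 2 +
    gradSq G η y / (ξ y - η y) ^ 2

/-- The curvature coefficient that mixes the gradients of `ξ` and `η`. -/
def curvMixed (G : E → E →L[ℝ] E →L[ℝ] ℝ) (ξ η : E → ℝ) (y : E) : ℝ :=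
  (gradSq G ξ y * hessRatio G ξ y - gradSq G η y * hessRatio G η y) / (2 * (ξ y - η y)) -
    (gradSq G ξ y + gradSq G η y) / (4 * (ξ y - η y) ^ 2)

theorem curvMixed_swap (G : E → E →L[ℝ] E →L[ℝ] ℝ) (ξ η : E → ℝ) (y : E) :
    curvMixed G η ξ y = curvMixed G ξ η y := by
  unfold curvMixed
  rw [← neg_sub (ξ y) (η y), neg_sq, mul_neg, div_neg, ← neg_div, neg_sub,
    add_comm (gradSq G η y)]

namespace IsOrthotoricOn

variable {G : E → E →L[ℝ] E →L[ℝ] ℝ} {J : E → E →L[ℝ] E} {ξ η : E → ℝ} {U : Set E} {y : E}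

theorem gradSq_ne_zero (h : IsOrthotoricOn G J ξ η U) (hy : y ∈ U) : gradSq G ξ y ≠ 0 :=
  (h.frame y hy).pos_fst.ne'

theorem differentiableAt_of_contDiffOn (h : IsOrthotoricOn G J ξ η U) (hy : y ∈ U) {F : Type*}
    [NormedAddCommGroup F] [NormedSpace ℝ F] {f : E → F} (hf : ContDiffOn ℝ ∞ f U) :
    DifferentiableAt ℝ f y :=
  (hf.contDiffAt (h.mem_nhds hy)).differentiableAt (by simp)

variable [FiniteDimensional ℝ E]

theorem contDiffOn_gradSq (h : IsOrthotoricOn G J ξ η U) : ContDiffOn ℝ ∞ (gradSq G ξ) U :=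
  (h.contDiffOn.clm_apply h.contDiffOn_grad).clm_apply h.contDiffOn_grad

theorem contDiffOn_hessRatio (h : IsOrthotoricOn G J ξ η U) :
    ContDiffOn ℝ ∞ (hessRatio G ξ) U :=
  ((h.contDiffOn_fderiv h.contDiffOn_gradSq).clm_apply h.contDiffOn_grad).div
    (contDiffOn_const.mul (h.contDiffOn_gradSq.pow 2))
    fun _ hz => mul_ne_zero two_ne_zero (pow_ne_zero 2 (h.gradSq_ne_zero hz))

theorem contDiffOn_hessRatioDeriv (h : IsOrthotoricOn G J ξ η U) :
    ContDiffOn ℝ ∞ (hessRatioDeriv G ξ) U :=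
  ((h.contDiffOn_fderiv h.contDiffOn_hessRatio).clm_apply h.contDiffOn_grad).div
    h.contDiffOn_gradSq fun _ hz => h.gradSq_ne_zero hz

theorem contDiffOn_curvPlane (h : IsOrthotoricOn G J ξ η U) :
    ContDiffOn ℝ ∞ (curvPlane G ξ η) U :=
  ((h.contDiffOn_gradSq.mul h.contDiffOn_hessRatioDeriv).add
    ((contDiffOn_const.mul h.contDiffOn_gradSq).mul (h.contDiffOn_hessRatio.pow 2))).add
    (h.swap.contDiffOn_gradSq.div ((h.contDiffOn_fst.sub h.contDiffOn_snd).pow 2)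
      fun z hz => pow_ne_zero 2 (sub_ne_zero.mpr (h.ne z hz)))

theorem fderiv_gradSq_eq (h : IsOrthotoricOn G J ξ η U) (hy : y ∈ U) (u : E) :
    fderiv ℝ (gradSq G ξ) y u = 2 * gradSq G ξ y * (hessRatio G ξ y * G y (gradient G ξ y) u +
      G y (gradient G η y) u / (2 * (ξ y - η y))) := by
  rw [h.fderiv_gradSq hy, (h.hess_eq hy u).1, mul_assoc]

theorem fderiv_sub (h : IsOrthotoricOn G J ξ η U) (hy : y ∈ U) (u : E) :
    fderiv ℝ (fun z => ξ z - η z) y u = G y (gradient G ξ y) u - G y (gradient G η y) u := by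
  rw [fderiv_fun_sub (h.differentiableAt_fst hy) (h.swap.differentiableAt_fst hy), sub_apply,
    h.apply_gradient hy, h.apply_gradient hy]

theorem differentiableAt_inner_grad (h : IsOrthotoricOn G J ξ η U) (hy : y ∈ U) (v : E) :
    DifferentiableAt ℝ (fun z => G z (gradient G ξ z) v) y :=
  ((h.toIsMetricOn.differentiableAt hy).clm_apply (h.differentiableAt_grad hy)).clm_apply
    (differentiableAt_const v)

theorem differentiableAt_end_grad (h : IsOrthotoricOn G J ξ η U) (hy : y ∈ U) :
    DifferentiableAt ℝ (fun z => J z (gradient G ξ z)) y :=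
  h.differentiableAt_of_contDiffOn hy (h.contDiffOn_end_apply h.contDiffOn_grad)

theorem differentiableAt_inner_end_grad (h : IsOrthotoricOn G J ξ η U) (hy : y ∈ U) (v : E) :
    DifferentiableAt ℝ (fun z => G z (J z (gradient G ξ z)) v) y :=
  ((h.toIsMetricOn.differentiableAt hy).clm_apply (h.differentiableAt_end_grad hy)).clm_apply
    (differentiableAt_const v)

theorem dForm_grad (h : IsOrthotoricOn G J ξ η U) (hy : y ∈ U) (u v : E) :
    dForm (fun z w => G z (gradient G ξ z) w) y u v = 0 := by
  rw [h.dForm_inner hy (h.differentiableAt_grad hy),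
    h.covDeriv_gradient_symm hy h.contDiffOn_fst, sub_self]

/-- Since J is parallel, ∇(J grad ξ) is J composed with the Hessian. Its skew part retains only the
two plane forms: the entries mixing a and b cancel. -/
theorem dForm_end_grad (h : IsOrthotoricOn G J ξ η U) (hy : y ∈ U) (u v : E) :
    dForm (fun z w => G z (J z (gradient G ξ z)) w) y u v =
      2 * hessRatio G ξ y * (G y (gradient G ξ y) u * G y (J y (gradient G ξ y)) v -
        G y (gradient G ξ y) v * G y (J y (gradient G ξ y)) u) +
      gradSq G ξ y / (gradSq G η y * (ξ y - η y)) *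
        (G y (gradient G η y) u * G y (J y (gradient G η y)) v -
        G y (gradient G η y) v * G y (J y (gradient G η y)) u) := by
  have hF := h.frame y hy
  have hs : ξ y - η y ≠ 0 := sub_ne_zero.mpr (h.ne y hy)
  have hA : gradSq G ξ y ≠ 0 := h.gradSq_ne_zero hy
  have hB : gradSq G η y ≠ 0 := h.swap.gradSq_ne_zero hy
  rw [h.dForm_inner hy (h.differentiableAt_end_grad hy),
    h.covDeriv_end hy (h.differentiableAt_grad hy), h.covDeriv_end hy (h.differentiableAt_grad hy)]
  rw [hF.inner_eq _ v, hF.inner_eq _ u]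
  obtain ⟨u1, u2, u3, u4⟩ := h.hess_eq hy u
  obtain ⟨v1, v2, v3, v4⟩ := h.hess_eq hy v
  simp only [hF.inner_end, u1, u2, u3, u4, v1, v2, v3, v4]
  change _ / gradSq G ξ y + _ / gradSq G η y - (_ / gradSq G ξ y + _ / gradSq G η y) = _
  field_simp
  ring

/-- The differential of `hessRatio G ξ`. -/
theorem fderiv_hessRatio (h : IsOrthotoricOn G J ξ η U) (hy : y ∈ U) (u : E) :
    fderiv ℝ (hessRatio G ξ) y u = hessRatioDeriv G ξ y * G y (gradient G ξ y) u -
      G y (gradient G η y) u / (2 * (ξ y - η y) ^ 2) := by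
  have hF := h.frame y hy
  have hs : ξ y - η y ≠ 0 := sub_ne_zero.mpr (h.ne y hy)
  have hA : gradSq G ξ y ≠ 0 := h.gradSq_ne_zero hy
  have hdA := h.differentiableAt_of_contDiffOn hy h.contDiffOn_gradSq
  have hdP := h.differentiableAt_of_contDiffOn hy h.contDiffOn_hessRatio
  have hds : DifferentiableAt ℝ (fun z => ξ z - η z) y :=
    (h.differentiableAt_fst hy).sub (h.swap.differentiableAt_fst hy)
  have hs2 : ∀ z ∈ U, ξ z - η z ≠ 0 := fun z hz => sub_ne_zero.mpr (h.ne z hz)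
  -- The form is dA = 2AP dξ + A/(ξ - η) dη, which is exact and therefore closed.
  have key : ∀ u v, dForm (fun z w => (2 * (gradSq G ξ z * hessRatio G ξ z)) *
      G z (gradient G ξ z) w + (gradSq G ξ z / (ξ z - η z)) * G z (gradient G η z) w) y u v
        = 0 := by
    intro u v
    rw [← dForm_congr (h.mem_nhds hy) (θ := fun z w => fderiv ℝ (gradSq G ξ) z w), dForm,
      fderiv_fderiv_symm (h.contDiffOn_gradSq.contDiffAt (h.mem_nhds hy)), sub_self]
    intro z hz w
    have := hs2 z hz
    rw [h.fderiv_gradSq_eq hz]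
    field_simp
  obtain ⟨g1, g2, g3, g4, g5, g6, g7, g8, g9, g10, g11, g12, g13, g14⟩ := hF.gram
  have hq : DifferentiableAt ℝ (fun z => gradSq G ξ z / (ξ z - η z)) y := differentiableAt_div hdA hds hs
  -- Contracting d(dA) = 0 with grad ξ isolates dP(u); the other derivative of P that occurs,
  -- dP(grad ξ), is A times `hessRatioDeriv` by definition.
  have hk := key u (gradient G ξ y)
  rw [dForm_comb ((hdA.fun_mul hdP).const_mul 2) hq
    (h.differentiableAt_inner_grad hy) (h.swap.differentiableAt_inner_grad hy), h.dForm_grad hy,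
    h.swap.dForm_grad hy, fderiv_const_mul (hdA.fun_mul hdP), fderiv_fun_mul hdA hdP] at hk
  simp only [add_apply, smul_apply, smul_eq_mul, g8,
    fderiv_div_apply hdA hds hs,
    h.fderiv_sub hy, h.fderiv_gradSq_eq hy] at hk
  rw [hessRatioDeriv]
  have eA : G y (gradient G ξ y) (gradient G ξ y) = gradSq G ξ y := rfl
  rw [eA] at hk
  field_simp at hk ⊢
  apply mul_left_cancel₀ hA
  linear_combination hk

/-- The component `g(R(u, v) grad ξ, J grad ξ)` of the curvature. -/
theorem curvature_fst_fst (h : IsOrthotoricOn G J ξ η U) (hy : y ∈ U) (u v : E) :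
    G y (curvature (christoffelBilin G) y u v (gradient G ξ y)) (J y (gradient G ξ y)) =
      curvPlane G ξ η y * (G y (gradient G ξ y) u * G y (J y (gradient G ξ y)) v -
        G y (gradient G ξ y) v * G y (J y (gradient G ξ y)) u) +
      2 * gradSq G ξ y / gradSq G η y * curvMixed G ξ η y *
        (G y (gradient G η y) u * G y (J y (gradient G η y)) v -
        G y (gradient G η y) v * G y (J y (gradient G η y)) u) := by
  have hF := h.frame y hy
  have hs : ξ y - η y ≠ 0 := sub_ne_zero.mpr (h.ne y hy)
  have hA : gradSq G ξ y ≠ 0 := h.gradSq_ne_zero hy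
  have hB : gradSq G η y ≠ 0 := h.swap.gradSq_ne_zero hy
  have hdA := h.differentiableAt_of_contDiffOn hy h.contDiffOn_gradSq
  have hdP := h.differentiableAt_of_contDiffOn hy h.contDiffOn_hessRatio
  have hds : DifferentiableAt ℝ (fun z => ξ z - η z) y :=
    (h.differentiableAt_fst hy).sub (h.swap.differentiableAt_fst hy)
  have hdd := differentiableAt_div hdA hds hs
  -- The connection form of the pair a, Ja, read off from the Hessian. Differentiating its
  -- coefficient AP brings in dP, and thus `hessRatioDeriv` in `curvPlane`.
  have hθ : ∀ z ∈ U, ∀ w, G z (J z (gradient G ξ z)) (covDeriv G (gradient G ξ) z w) =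
      (gradSq G ξ z * hessRatio G ξ z) * G z (J z (gradient G ξ z)) w +
      (-(1 / 2) * (gradSq G ξ z / (ξ z - η z))) * G z (J z (gradient G η z)) w := by
    intro z hz w
    have : ξ z - η z ≠ 0 := sub_ne_zero.mpr (h.ne z hz)
    rw [(h.hess_eq hz w).2.1]
    field_simp
    ring
  rw [inner_curvature_eq_dForm h.toIsMetricOn hy h.contDiffOn_grad
    (h.contDiffOn_end_apply h.contDiffOn_grad), dForm_congr (h.mem_nhds hy) hθ,
    dForm_comb (hdA.fun_mul hdP) (hdd.const_mul _) (h.differentiableAt_inner_end_grad hy)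
      (h.swap.differentiableAt_inner_end_grad hy), h.dForm_end_grad hy, h.swap.dForm_end_grad hy,
    fderiv_fun_mul hdA hdP, fderiv_const_mul hdd, h.covDeriv_end hy (h.differentiableAt_grad hy),
    h.covDeriv_end hy (h.differentiableAt_grad hy), hF.inner_eq (covDeriv _ _ _ _),
    hF.inner_eq (covDeriv G (gradient G ξ) y u)]
  obtain ⟨u1, u2, u3, u4⟩ := h.hess_eq hy u
  obtain ⟨v1, v2, v3, v4⟩ := h.hess_eq hy v
  have eA : G y (gradient G ξ y) (gradient G ξ y) = gradSq G ξ y := rfl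
  have eB : G y (gradient G η y) (gradient G η y) = gradSq G η y := rfl
  simp only [hF.inner_end, u1, u2, u3, u4, v1, v2, v3, v4, eA, eB, add_apply, smul_apply,
    smul_eq_mul, fderiv_div_apply hdA hds hs, h.fderiv_sub hy, h.fderiv_gradSq_eq hy,
    h.fderiv_hessRatio hy, curvPlane, curvMixed]
  -- Formulas obtained through `swap` carry η - ξ. Writing every denominator in one nonzero symbol s
  -- lets `field_simp` clear them all.
  have hneg : η y - ξ y = -(ξ y - η y) := by ring
  simp only [hneg]
  generalize ξ y - η y = s at *
  field_simp
  ring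

/-- The component `g(R(u, v) grad ξ, grad η)` of the curvature. -/
theorem curvature_fst_snd (h : IsOrthotoricOn G J ξ η U) (hy : y ∈ U) (u v : E) :
    G y (curvature (christoffelBilin G) y u v (gradient G ξ y)) (gradient G η y) =
      curvMixed G ξ η y * (G y (gradient G ξ y) u * G y (gradient G η y) v -
        G y (gradient G ξ y) v * G y (gradient G η y) u +
        (G y (J y (gradient G ξ y)) u * G y (J y (gradient G η y)) v -
        G y (J y (gradient G ξ y)) v * G y (J y (gradient G η y)) u)) := by
  have hF := h.frame y hy
  have hs : ξ y - η y ≠ 0 := sub_ne_zero.mpr (h.ne y hy)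
  have hA : gradSq G ξ y ≠ 0 := h.gradSq_ne_zero hy
  have hB : gradSq G η y ≠ 0 := h.swap.gradSq_ne_zero hy
  have hdA := h.differentiableAt_of_contDiffOn hy h.contDiffOn_gradSq
  have hdB := h.differentiableAt_of_contDiffOn hy h.swap.contDiffOn_gradSq
  have hds : DifferentiableAt ℝ (fun z => ξ z - η z) y :=
    (h.differentiableAt_fst hy).sub (h.swap.differentiableAt_fst hy)
  have hdd := differentiableAt_div hdA hds hs
  have hde := differentiableAt_div hdB hds hs
  -- The connection form of the pair a, b. It does not involve P; in the final answer P enters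
  -- through dA, dB and the quadratic terms.
  have hθ : ∀ z ∈ U, ∀ w, G z (gradient G η z) (covDeriv G (gradient G ξ) z w) =
      (1 / 2 * (gradSq G ξ z / (ξ z - η z))) * G z (gradient G η z) w +
      (1 / 2 * (gradSq G η z / (ξ z - η z))) * G z (gradient G ξ z) w := by
    intro z hz w
    have : ξ z - η z ≠ 0 := sub_ne_zero.mpr (h.ne z hz)
    rw [(h.hess_eq hz w).2.2.1]
    field_simp
  rw [inner_curvature_eq_dForm h.toIsMetricOn hy h.contDiffOn_grad h.swap.contDiffOn_grad,
    dForm_congr (h.mem_nhds hy) hθ,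
    dForm_comb (hdd.const_mul _) (hde.const_mul _) (h.swap.differentiableAt_inner_grad hy)
      (h.differentiableAt_inner_grad hy), h.dForm_grad hy, h.swap.dForm_grad hy,
    fderiv_const_mul hdd, fderiv_const_mul hde, hF.inner_eq (covDeriv _ _ _ _),
    hF.inner_eq (covDeriv G (gradient G ξ) y u)]
  obtain ⟨u1, u2, u3, u4⟩ := h.hess_eq hy u
  obtain ⟨v1, v2, v3, v4⟩ := h.hess_eq hy v
  obtain ⟨p3, p4, p1, p2⟩ := h.swap.hess_eq hy u
  obtain ⟨q3, q4, q1, q2⟩ := h.swap.hess_eq hy v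
  have eA : G y (gradient G ξ y) (gradient G ξ y) = gradSq G ξ y := rfl
  have eB : G y (gradient G η y) (gradient G η y) = gradSq G η y := rfl
  simp only [u1, u2, u3, u4, v1, v2, v3, v4, p1, p2, p3, p4, q1, q2, q3, q4, eA, eB, smul_apply,
    smul_eq_mul, fderiv_div_apply hdA hds hs, fderiv_div_apply hdB hds hs, h.fderiv_sub hy,
    h.fderiv_gradSq_eq hy, h.swap.fderiv_gradSq_eq hy, curvMixed]
  have hneg : η y - ξ y = -(ξ y - η y) := by ring
  simp only [hneg]
  generalize ξ y - η y = s at *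
  field_simp
  ring

/-- The component `g(R(u, v) grad ξ, J grad η)` of the curvature. -/
theorem curvature_fst_end_snd (h : IsOrthotoricOn G J ξ η U) (hy : y ∈ U) (u v : E) :
    G y (curvature (christoffelBilin G) y u v (gradient G ξ y)) (J y (gradient G η y)) =
      curvMixed G ξ η y * (G y (gradient G ξ y) u * G y (J y (gradient G η y)) v -
        G y (gradient G ξ y) v * G y (J y (gradient G η y)) u -
        (G y (J y (gradient G ξ y)) u * G y (gradient G η y) v -
        G y (J y (gradient G ξ y)) v * G y (gradient G η y) u)) := by
  have hF := h.frame y hy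
  have hs : ξ y - η y ≠ 0 := sub_ne_zero.mpr (h.ne y hy)
  have hA : gradSq G ξ y ≠ 0 := h.gradSq_ne_zero hy
  have hB : gradSq G η y ≠ 0 := h.swap.gradSq_ne_zero hy
  have hdA := h.differentiableAt_of_contDiffOn hy h.contDiffOn_gradSq
  have hdB := h.differentiableAt_of_contDiffOn hy h.swap.contDiffOn_gradSq
  have hds : DifferentiableAt ℝ (fun z => ξ z - η z) y :=
    (h.differentiableAt_fst hy).sub (h.swap.differentiableAt_fst hy)
  have hdd := differentiableAt_div hdA hds hs
  have hde := differentiableAt_div hdB hds hs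
  have hθ : ∀ z ∈ U, ∀ w, G z (J z (gradient G η z)) (covDeriv G (gradient G ξ) z w) =
      (1 / 2 * (gradSq G ξ z / (ξ z - η z))) * G z (J z (gradient G η z)) w +
      (-(1 / 2) * (gradSq G η z / (ξ z - η z))) * G z (J z (gradient G ξ z)) w := by
    intro z hz w
    have : ξ z - η z ≠ 0 := sub_ne_zero.mpr (h.ne z hz)
    rw [(h.hess_eq hz w).2.2.2]
    field_simp
    ring
  rw [inner_curvature_eq_dForm h.toIsMetricOn hy h.contDiffOn_grad
    (h.contDiffOn_end_apply h.swap.contDiffOn_grad), dForm_congr (h.mem_nhds hy) hθ,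
    dForm_comb (hdd.const_mul _) (hde.const_mul _) (h.swap.differentiableAt_inner_end_grad hy)
      (h.differentiableAt_inner_end_grad hy), h.dForm_end_grad hy, h.swap.dForm_end_grad hy,
    fderiv_const_mul hdd, fderiv_const_mul hde, h.covDeriv_end hy (h.swap.differentiableAt_grad hy),
    h.covDeriv_end hy (h.swap.differentiableAt_grad hy), hF.inner_eq (covDeriv _ _ _ _),
    hF.inner_eq (covDeriv G (gradient G ξ) y u)]
  obtain ⟨u1, u2, u3, u4⟩ := h.hess_eq hy u
  obtain ⟨v1, v2, v3, v4⟩ := h.hess_eq hy v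
  obtain ⟨p3, p4, p1, p2⟩ := h.swap.hess_eq hy u
  obtain ⟨q3, q4, q1, q2⟩ := h.swap.hess_eq hy v
  have eA : G y (gradient G ξ y) (gradient G ξ y) = gradSq G ξ y := rfl
  have eB : G y (gradient G η y) (gradient G η y) = gradSq G η y := rfl
  simp only [hF.inner_end, u1, u2, u3, u4, v1, v2, v3, v4, p1, p2, p3, p4, q1, q2, q3, q4, eA, eB,
    smul_apply, smul_eq_mul, fderiv_div_apply hdA hds hs, fderiv_div_apply hdB hds hs,
    h.fderiv_sub hy, h.fderiv_gradSq_eq hy, h.swap.fderiv_gradSq_eq hy, curvMixed]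
  have hneg : η y - ξ y = -(ξ y - η y) := by ring
  simp only [hneg]
  generalize ξ y - η y = s at *
  field_simp
  ring

end IsOrthotoricOn

end ChartCalculus

/-! ### The full curvature tensor, Ricci and scalar curvature -/

namespace ChartCalculus

variable {E : Type*} [NormedAddCommGroup E] [NormedSpace ℝ E]

/-- The 2-form `a ∧ j a`. -/
def planeForm (g : E →L[ℝ] E →L[ℝ] ℝ) (j : E →L[ℝ] E) (a u v : E) : ℝ :=
  g a u * g (j a) v - g a v * g (j a) u

/-- The 2-form `a ∧ b + j a ∧ j b`. -/
def mixedForm (g : E →L[ℝ] E →L[ℝ] ℝ) (j : E →L[ℝ] E) (a b u v : E) : ℝ :=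
  g a u * g b v - g a v * g b u + (g (j a) u * g (j b) v - g (j a) v * g (j b) u)

namespace IsOrthotoricOn

variable {G : E → E →L[ℝ] E →L[ℝ] ℝ} {J : E → E →L[ℝ] E} {ξ η : E → ℝ} {U : Set E} {y : E}
  [FiniteDimensional ℝ E]

/-- The curvature tensor of an orthotoric surface. -/
theorem curvature_eq (h : IsOrthotoricOn G J ξ η U) (hy : y ∈ U) (u v w t : E) :
    G y (curvature (christoffelBilin G) y u v w) t =
      curvPlane G ξ η y / gradSq G ξ y ^ 2 *
        (planeForm (G y) (J y) (gradient G ξ y) u v * planeForm (G y) (J y) (gradient G ξ y) w t) +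
      curvPlane G η ξ y / gradSq G η y ^ 2 *
        (planeForm (G y) (J y) (gradient G η y) u v * planeForm (G y) (J y) (gradient G η y) w t) +
      2 * curvMixed G ξ η y / (gradSq G ξ y * gradSq G η y) *
        (planeForm (G y) (J y) (gradient G ξ y) u v * planeForm (G y) (J y) (gradient G η y) w t +
        planeForm (G y) (J y) (gradient G η y) u v * planeForm (G y) (J y) (gradient G ξ y) w t) +
      curvMixed G ξ η y / (gradSq G ξ y * gradSq G η y) *
        (mixedForm (G y) (J y) (gradient G ξ y) (gradient G η y) u v *
          mixedForm (G y) (J y) (gradient G ξ y) (gradient G η y) w t +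
        mixedForm (G y) (J y) (gradient G ξ y) (J y (gradient G η y)) u v *
          mixedForm (G y) (J y) (gradient G ξ y) (J y (gradient G η y)) w t) := by
  have hF := h.frame y hy
  have hA : gradSq G ξ y ≠ 0 := h.gradSq_ne_zero hy
  have hB : gradSq G η y ≠ 0 := h.swap.gradSq_ne_zero hy
  have hsk := inner_curvature_skew h.toIsMetricOn hy u v
  have hRJ := h.curvature_end hy u v
  have X1 := h.curvature_fst_fst hy u v
  have X3 := h.curvature_fst_snd hy u v
  have X4 := h.curvature_fst_end_snd hy u v
  have Y1 := h.swap.curvature_fst_fst hy u v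
  rw [curvMixed_swap] at Y1
  have eA : G y (gradient G ξ y) (gradient G ξ y) = gradSq G ξ y := rfl
  have eB : G y (gradient G η y) (gradient G η y) = gradSq G η y := rfl
  have hJJ := h.sq y hy
  generalize gradient G ξ y = a at *
  generalize gradient G η y = b at *
  -- R(u, v) is skew and commutes with J, so in the frame it has four independent components: `X1`,
  -- `X3`, `X4` and `Y1`. The following facts reduce all others to these.
  have X0 : G y (curvature (christoffelBilin G) y u v a) a = 0 := by
    have := hsk a a
    linarith
  have Y0 : G y (curvature (christoffelBilin G) y u v b) b = 0 := by
    have := hsk b b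
    linarith
  have Y3 := hsk b a
  have Y4 : G y (curvature (christoffelBilin G) y u v b) (J y a) =
      G y (curvature (christoffelBilin G) y u v a) (J y b) := by
    rw [hsk, hRJ, hF.skew, neg_neg]
  have Fa : ∀ w, G y (curvature (christoffelBilin G) y u v a) w =
      G y (curvature (christoffelBilin G) y u v a) (J y a) * G y (J y a) w / gradSq G ξ y +
      (G y (curvature (christoffelBilin G) y u v a) b * G y b w +
        G y (curvature (christoffelBilin G) y u v a) (J y b) * G y (J y b) w) / gradSq G η y := by
    intro w
    rw [hF.inner_eq _ w, hF.symm a, hF.symm (J y a), hF.symm b, hF.symm (J y b), X0, eA, eB]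
    ring
  have Fb : ∀ w, G y (curvature (christoffelBilin G) y u v b) w =
      (-G y (curvature (christoffelBilin G) y u v a) b * G y a w +
        G y (curvature (christoffelBilin G) y u v a) (J y b) * G y (J y a) w) / gradSq G ξ y +
      G y (curvature (christoffelBilin G) y u v b) (J y b) * G y (J y b) w / gradSq G η y := by
    intro w
    rw [hF.inner_eq _ w, hF.symm a, hF.symm (J y a), hF.symm b, hF.symm (J y b), Y0, Y3, Y4, eA, eB]
    ring
  -- Skewness and commutation with J move R(u, v) from w onto the frame vectors a and b, where `Fa`
  -- and `Fb` apply.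
  have c1 : G y a (curvature (christoffelBilin G) y u v w) =
      -G y (curvature (christoffelBilin G) y u v a) w := by rw [hF.symm, hsk]
  have c2 : G y (J y a) (curvature (christoffelBilin G) y u v w) =
      G y (curvature (christoffelBilin G) y u v a) (J y w) := by
    rw [hF.symm, hsk, hRJ, hF.skew, neg_neg]
  have c3 : G y b (curvature (christoffelBilin G) y u v w) =
      -G y (curvature (christoffelBilin G) y u v b) w := by rw [hF.symm, hsk]
  have c4 : G y (J y b) (curvature (christoffelBilin G) y u v w) =
      G y (curvature (christoffelBilin G) y u v b) (J y w) := by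
    rw [hF.symm, hsk, hRJ, hF.skew, neg_neg]
  rw [hF.inner_eq, c1, c2, c3, c4, Fa w, Fa (J y w), Fb w, Fb (J y w), X1, X3, X4, Y1, eA, eB]
  simp only [hF.inner_end, planeForm, mixedForm, hJJ, map_neg, neg_apply]
  field_simp
  ring

/-- In the trace for a vector of one plane, its own plane contributes `curvPlane` and the two
vectors of the other plane contribute `curvMixed` each, without cross terms. Thus Ricci is a scalar
on each plane. -/
theorem ricci_eq (h : IsOrthotoricOn G J ξ η U) (hy : y ∈ U) (v w : E) :
    ricciForm (christoffelBilin G) y v w =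
      -((curvPlane G ξ η y + 2 * curvMixed G ξ η y) / gradSq G ξ y) *
        (G y (gradient G ξ y) v * G y (gradient G ξ y) w +
          G y (J y (gradient G ξ y)) v * G y (J y (gradient G ξ y)) w) -
      (curvPlane G η ξ y + 2 * curvMixed G ξ η y) / gradSq G η y *
        (G y (gradient G η y) v * G y (gradient G η y) w +
          G y (J y (gradient G η y)) v * G y (J y (gradient G η y)) w) := by
  have hF := h.frame y hy
  have hA : gradSq G ξ y ≠ 0 := h.gradSq_ne_zero hy
  have hB : gradSq G η y ≠ 0 := h.swap.gradSq_ne_zero hy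
  have hR := h.curvature_eq hy
  have eA : G y (gradient G ξ y) (gradient G ξ y) = gradSq G ξ y := rfl
  have eB : G y (gradient G η y) (gradient G η y) = gradSq G η y := rfl
  have hJJ := h.sq y hy
  change LinearMap.trace ℝ E (curvatureEnd (christoffelBilin G) y v w) = _
  rw [hF.trace_eq]
  change (G y _ (curvature _ _ _ _ _) + G y _ (curvature _ _ _ _ _)) / _ +
    (G y _ (curvature _ _ _ _ _) + G y _ (curvature _ _ _ _ _)) / _ = _
  generalize gradient G ξ y = a at *
  generalize gradient G η y = b at *
  obtain ⟨g1, g2, g3, g4, g5, g6, g7, g8, g9, g10, g11, g12, g13, g14⟩ := hF.gram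
  rw [hF.symm a (curvature _ _ _ _ _), hF.symm (J y a) (curvature _ _ _ _ _),
    hF.symm b (curvature _ _ _ _ _), hF.symm (J y b) (curvature _ _ _ _ _), hR, hR, hR, hR]
  simp only [planeForm, mixedForm, hJJ, map_neg, neg_apply, g1, g2, g3, g4, g5, g6, g7, g8, g9,
    g10, g11, g12, g13, g14, eA, eB]
  field_simp
  ring

theorem scalarCurvature_eq (h : IsOrthotoricOn G J ξ η U) (hy : y ∈ U) :
    scalarCurvature G y =
      -2 * (curvPlane G ξ η y + curvPlane G η ξ y + 4 * curvMixed G ξ η y) := by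
  have hF := h.frame y hy
  have hA : gradSq G ξ y ≠ 0 := h.gradSq_ne_zero hy
  have hB : gradSq G η y ≠ 0 := h.swap.gradSq_ne_zero hy
  have eA : G y (gradient G ξ y) (gradient G ξ y) = gradSq G ξ y := rfl
  have eB : G y (gradient G η y) (gradient G η y) = gradSq G η y := rfl
  obtain ⟨g1, g2, g3, g4, g5, g6, g7, g8, g9, g10, g11, g12, g13, g14⟩ := hF.gram
  have hinv : ∀ v w, G y v ((G y).inverse
      (LinearMap.toContinuousLinearMap (ricciForm (christoffelBilin G) y w))) =
      ricciForm (christoffelBilin G) y w v := by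
    intro v w
    rw [hF.symm, h.apply_inverse hy]
    rfl
  rw [scalarCurvature, hF.trace_eq]
  change (G y _ ((G y).inverse (LinearMap.toContinuousLinearMap _)) +
    G y _ ((G y).inverse (LinearMap.toContinuousLinearMap _))) / _ +
    (G y _ ((G y).inverse (LinearMap.toContinuousLinearMap _)) +
    G y _ ((G y).inverse (LinearMap.toContinuousLinearMap _))) / _ = _
  rw [hinv, hinv, hinv, hinv]
  simp only [h.ricci_eq hy, g1, g2, g3, g4, g5, g6, g7, g8, g9, g10, g11, g12, g13, g14, eA, eB]
  field_simp
  ring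

theorem contDiffOn_conjEnd (h : IsOrthotoricOn G J ξ η U) :
    ContDiffOn ℝ ∞ (fun z => conjEnd (G z) (J z) (gradient G ξ z)) U := by
  refine contDiffOn_clm_apply.mpr fun v => ?_
  simp only [conjEnd_apply]
  have h1 := h.contDiffOn_grad
  have h2 := h.contDiffOn_end_apply h1
  have h3 : ContDiffOn ℝ ∞ (fun z => J z v) U := h.contDiffOn_end_apply contDiffOn_const
  have h4 : ContDiffOn ℝ ∞ (fun z => G z (gradient G ξ z) v) U :=
    (h.contDiffOn.clm_apply h1).clm_apply contDiffOn_const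
  have h5 : ContDiffOn ℝ ∞ (fun z => G z (J z (gradient G ξ z)) v) U :=
    (h.contDiffOn.clm_apply h2).clm_apply contDiffOn_const
  exact ((contDiffOn_const.div h.contDiffOn_gradSq fun z hz => h.gradSq_ne_zero hz).smul
    ((h4.smul h2).sub (h5.smul h1))).sub h3

end IsOrthotoricOn

/-! ### Integrability of the opposite complex structure -/

theorem covDerivEnd_add_right (G : E → E →L[ℝ] E →L[ℝ] ℝ) (J : E → E →L[ℝ] E) (y u v w : E) :
    covDerivEnd G J y u (v + w) = covDerivEnd G J y u v + covDerivEnd G J y u w := by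
  simp only [covDerivEnd, map_add, christoffel_add_right]
  abel

theorem covDerivEnd_smul_right (G : E → E →L[ℝ] E →L[ℝ] ℝ) (J : E → E →L[ℝ] E) (y u v : E)
    (c : ℝ) : covDerivEnd G J y u (c • v) = c • covDerivEnd G J y u v := by
  simp only [covDerivEnd, map_smul, christoffel_smul_right, smul_sub, smul_add]

theorem covDerivEnd_apply {G : E → E →L[ℝ] E →L[ℝ] ℝ} {J : E → E →L[ℝ] E} {y : E}
    (hJ : DifferentiableAt ℝ J y) {V : E → E} (hV : DifferentiableAt ℝ V y) (u : E) :
    covDerivEnd G J y u (V y) =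
      covDeriv G (fun z => J z (V z)) y u - J y (covDeriv G V y u) := by
  rw [covDerivEnd, covDeriv, fderiv_clm_apply_apply hJ hV, covDeriv, map_add]
  abel

/-- The Nijenhuis tensor in terms of the Levi-Civita connection. -/
theorem IsMetricOn.nijenhuis_eq {G : E → E →L[ℝ] E →L[ℝ] ℝ} {J : E → E →L[ℝ] E} {U : Set E}
    {y : E} [FiniteDimensional ℝ E] (h : IsMetricOn G U) (hy : y ∈ U)
    (hJ : DifferentiableAt ℝ J y) (u v : E) :
    nijenhuis J y u v = covDerivEnd G J y (J y u) v - covDerivEnd G J y (J y v) u +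
      J y (covDerivEnd G J y v u) - J y (covDerivEnd G J y u v) := by
  have hd : ∀ w t, fderiv ℝ (fun z => J z t) y w = fderiv ℝ J y w t := fun w t => by
    rw [fderiv_clm_apply_apply hJ (differentiableAt_const t)]
    simp
  simp only [nijenhuis, VectorField.lieBracket, hd, fderiv_fun_const, Pi.zero_apply, zero_apply,
    zero_sub, sub_zero, covDerivEnd, map_sub, map_add, map_neg]
  -- The connection has no torsion, so the Christoffel terms on the right cancel and only the
  -- derivatives of J in the Lie brackets remain.
  rw [h.christoffel_symm hy (J y v) (J y u), h.christoffel_symm hy (J y v) u,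
    h.christoffel_symm hy v (J y u), h.christoffel_symm hy v u]
  abel

namespace IsOrthotoricOn

variable {G : E → E →L[ℝ] E →L[ℝ] ℝ} {J : E → E →L[ℝ] E} {ξ η : E → ℝ} {U : Set E} {y : E}
  [FiniteDimensional ℝ E]

/-- The covariant derivative of the opposite almost complex structure. -/
theorem inner_covDerivEnd_conjEnd (h : IsOrthotoricOn G J ξ η U) (hy : y ∈ U) (u v : E) :
    G y (gradient G ξ y)
      (covDerivEnd G (fun z => conjEnd (G z) (J z) (gradient G ξ z)) y u v) =
      2 / gradSq G η y * (G y (gradient G η y) v * G y (J y (gradient G ξ y))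
        (covDeriv G (gradient G η) y u) + G y (J y (gradient G η y)) v * G y (gradient G ξ y)
        (covDeriv G (gradient G η) y u)) ∧
    G y (J y (gradient G ξ y))
      (covDerivEnd G (fun z => conjEnd (G z) (J z) (gradient G ξ z)) y u v) =
      2 / gradSq G η y * (-G y (gradient G η y) v * G y (gradient G ξ y)
        (covDeriv G (gradient G η) y u) + G y (J y (gradient G η y)) v *
        G y (J y (gradient G ξ y)) (covDeriv G (gradient G η) y u)) ∧
    G y (gradient G η y)
      (covDerivEnd G (fun z => conjEnd (G z) (J z) (gradient G ξ z)) y u v) =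
      -2 / gradSq G ξ y * (G y (gradient G ξ y) v * G y (J y (gradient G η y))
        (covDeriv G (gradient G ξ) y u) + G y (J y (gradient G ξ y)) v * G y (gradient G η y)
        (covDeriv G (gradient G ξ) y u)) ∧
    G y (J y (gradient G η y))
      (covDerivEnd G (fun z => conjEnd (G z) (J z) (gradient G ξ z)) y u v) =
      -2 / gradSq G ξ y * (-G y (gradient G ξ y) v * G y (gradient G η y)
        (covDeriv G (gradient G ξ) y u) + G y (J y (gradient G ξ y)) v *
        G y (J y (gradient G η y)) (covDeriv G (gradient G ξ) y u)) := by
  have hF := h.frame y hy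
  have hJ' := h.differentiableAt_of_contDiffOn hy h.contDiffOn_conjEnd
  have hA : gradSq G ξ y ≠ 0 := h.gradSq_ne_zero hy
  have hB : gradSq G η y ≠ 0 := h.swap.gradSq_ne_zero hy
  have d1 := h.differentiableAt_grad hy
  have d2 := h.differentiableAt_end_grad hy
  have d3 := h.swap.differentiableAt_grad hy
  have d4 := h.swap.differentiableAt_end_grad hy
  -- The opposite structure permutes the frame up to sign: a ↦ Ja, Ja ↦ -a, b ↦ -Jb, Jb ↦ b.
  -- Differentiating each such identity gives its covariant derivative on a frame vector.
  have key : ∀ (V W : E → E), DifferentiableAt ℝ V y →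
      (∀ z ∈ U, conjEnd (G z) (J z) (gradient G ξ z) (V z) = W z) →
      covDerivEnd G (fun z => conjEnd (G z) (J z) (gradient G ξ z)) y u (V y) =
        covDeriv G W y u - conjEnd (G y) (J y) (gradient G ξ y) (covDeriv G V y u) := by
    intro V W hV hVW
    rw [covDerivEnd_apply hJ' hV, covDeriv_congr (W := W)]
    filter_upwards [h.mem_nhds hy] with z hz using hVW z hz
  have c1 := key _ _ d1 fun z hz => (h.frame z hz).conjEnd_fst
  have c2 := key _ (fun z => -gradient G ξ z) d2 fun z hz => by
    rw [← (h.frame z hz).conjEnd_fst, (h.frame z hz).conjEnd_sq]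
  have c3 := key _ (fun z => -J z (gradient G η z)) d3 fun z hz => (h.frame z hz).conjEnd_snd
  have c4 := key _ (gradient G η) d4 fun z hz => by
    rw [← neg_neg (J z _), ← (h.frame z hz).conjEnd_snd, map_neg, (h.frame z hz).conjEnd_sq,
      neg_neg]
  have hneg : ∀ V : E → E, covDeriv G (fun z => -V z) y u = -covDeriv G V y u := by
    intro V
    simp only [covDeriv, fderiv_fun_neg, neg_apply]
    rw [← neg_one_smul ℝ (V y), christoffel_smul_right, neg_one_smul, neg_add]
  rw [h.covDeriv_end hy d1] at c1
  rw [h.covDeriv_end hy d1, hneg] at c2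
  rw [hneg, h.covDeriv_end hy d3] at c3
  rw [h.covDeriv_end hy d3] at c4
  have hdec := hF.decomp v
  have hC : covDerivEnd G (fun z => conjEnd (G z) (J z) (gradient G ξ z)) y u v =
      (G y (gradient G ξ y) v / gradSq G ξ y) •
        covDerivEnd G (fun z => conjEnd (G z) (J z) (gradient G ξ z)) y u (gradient G ξ y) +
      (G y (J y (gradient G ξ y)) v / gradSq G ξ y) •
        covDerivEnd G (fun z => conjEnd (G z) (J z) (gradient G ξ z)) y u (J y (gradient G ξ y)) +
      (G y (gradient G η y) v / gradSq G η y) •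
        covDerivEnd G (fun z => conjEnd (G z) (J z) (gradient G ξ z)) y u (gradient G η y) +
      (G y (J y (gradient G η y)) v / gradSq G η y) •
        covDerivEnd G (fun z => conjEnd (G z) (J z) (gradient G ξ z)) y u
          (J y (gradient G η y)) := by
    conv_lhs => rw [hdec]
    simp only [covDerivEnd_add_right, covDerivEnd_smul_right]
    rfl
  rw [hC, c1, c2, c3, c4]
  simp only [map_add, map_smul, map_sub, map_neg, smul_eq_mul, hF.inner_end, hF.inner_conjEnd]
  refine ⟨?_, ?_, ?_, ?_⟩ <;> field_simp <;> ring

/-- The components of ∇J̄ involve only Hessian entries mixing the two planes, in which `hessRatio`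
does not appear. With their values from `hess_eq`, the four terms of `nijenhuis_eq` cancel. -/
theorem nijenhuis_conjEnd (h : IsOrthotoricOn G J ξ η U) (hy : y ∈ U) (u v : E) :
    nijenhuis (fun z => conjEnd (G z) (J z) (gradient G ξ z)) y u v = 0 := by
  have hF := h.frame y hy
  have hJ' := h.differentiableAt_of_contDiffOn hy h.contDiffOn_conjEnd
  have hA : gradSq G ξ y ≠ 0 := h.gradSq_ne_zero hy
  have hB : gradSq G η y ≠ 0 := h.swap.gradSq_ne_zero hy
  have hs : ξ y - η y ≠ 0 := sub_ne_zero.mpr (h.ne y hy)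
  have hC := h.inner_covDerivEnd_conjEnd hy
  have hH := h.hess_eq hy
  have hH' := h.swap.hess_eq hy
  rw [h.nijenhuis_eq hy hJ']
  have hneg : η y - ξ y = -(ξ y - η y) := by ring
  refine hF.ext ?_ ?_ ?_ ?_ <;>
  · simp only [map_add, map_sub, map_zero, hF.inner_conjEnd, hC, hH, hH', hneg]
    generalize ξ y - η y = s at *
    field_simp
    ring

end IsOrthotoricOn

end ChartCalculus

/-! ### Naturality under local isometries -/

namespace ChartCalculus

variable {E : Type*} [NormedAddCommGroup E] [NormedSpace ℝ E]

/-- On the open set `V`, the map `φ` is a local isometry from `G₁` to `G₂`. -/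
structure IsLocalIsometry (φ : E → E) (V : Set E) (G₁ G₂ : E → E →L[ℝ] E →L[ℝ] ℝ)
    (U₁ U₂ : Set E) : Prop where
  isOpen : IsOpen V
  contDiffOn : ContDiffOn ℝ ∞ φ V
  subset : V ⊆ U₁
  mapsTo : Set.MapsTo φ V U₂
  isInvertible : ∀ z ∈ V, (fderiv ℝ φ z).IsInvertible
  fst : IsMetricOn G₁ U₁
  snd : IsMetricOn G₂ U₂
  metric : ∀ z ∈ V, ∀ u v, G₁ z u v = G₂ (φ z) (fderiv ℝ φ z u) (fderiv ℝ φ z v)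

namespace IsLocalIsometry

variable {φ : E → E} {V U₁ U₂ : Set E} {G₁ G₂ : E → E →L[ℝ] E →L[ℝ] ℝ} {y : E}

theorem mem_nhds (h : IsLocalIsometry φ V G₁ G₂ U₁ U₂) (hy : y ∈ V) : V ∈ nhds y :=
  h.isOpen.mem_nhds hy

theorem differentiableAt (h : IsLocalIsometry φ V G₁ G₂ U₁ U₂) (hy : y ∈ V) :
    DifferentiableAt ℝ φ y :=
  (h.contDiffOn.contDiffAt (h.mem_nhds hy)).differentiableAt (by simp)

theorem differentiableAt_fderiv (h : IsLocalIsometry φ V G₁ G₂ U₁ U₂) (hy : y ∈ V) :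
    DifferentiableAt ℝ (fderiv ℝ φ) y :=
  ((h.contDiffOn.contDiffAt (h.mem_nhds hy)).fderiv_right (m := ∞) (by simp)).differentiableAt
    (by simp)

theorem injective (h : IsLocalIsometry φ V G₁ G₂ U₁ U₂) (hy : y ∈ V) :
    Function.Injective (fderiv ℝ φ y) := by
  obtain ⟨e, he⟩ := h.isInvertible y hy
  rw [← he]
  exact e.injective

theorem surjective (h : IsLocalIsometry φ V G₁ G₂ U₁ U₂) (hy : y ∈ V) :
    Function.Surjective (fderiv ℝ φ y) := by
  obtain ⟨e, he⟩ := h.isInvertible y hy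
  rw [← he]
  exact e.surjective

theorem snd_fderiv_symm (h : IsLocalIsometry φ V G₁ G₂ U₁ U₂) (hy : y ∈ V) (u v : E) :
    fderiv ℝ (fderiv ℝ φ) y u v = fderiv ℝ (fderiv ℝ φ) y v u :=
  ((h.contDiffOn.contDiffAt (h.mem_nhds hy)).isSymmSndFDerivAt
    (by rw [minSmoothness_of_isRCLikeNormedField];
        exact WithTop.coe_le_coe.mpr (le_top : (2 : ℕ∞) ≤ ⊤))).eq u v

theorem fderiv_comp_apply (h : IsLocalIsometry φ V G₁ G₂ U₁ U₂) (hy : y ∈ V) {F : Type*}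
    [NormedAddCommGroup F] [NormedSpace ℝ F] {f : E → F} (hf : DifferentiableAt ℝ f (φ y))
    (u : E) : fderiv ℝ (fun z => f (φ z)) y u = fderiv ℝ f (φ y) (fderiv ℝ φ y u) := by
  have := fderiv_comp y hf (h.differentiableAt hy)
  exact congrArg (fun L : E →L[ℝ] F => L u) this

theorem differentiableAt_comp (h : IsLocalIsometry φ V G₁ G₂ U₁ U₂) (hy : y ∈ V) {F : Type*}
    [NormedAddCommGroup F] [NormedSpace ℝ F] {f : E → F} (hf : DifferentiableAt ℝ f (φ y)) :
    DifferentiableAt ℝ (fun z => f (φ z)) y :=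
  hf.comp y (h.differentiableAt hy)

theorem fderiv_fderiv_apply (h : IsLocalIsometry φ V G₁ G₂ U₁ U₂) (hy : y ∈ V) {W : E → E}
    (hW : DifferentiableAt ℝ W y) (u : E) :
    fderiv ℝ (fun z => fderiv ℝ φ z (W z)) y u =
      fderiv ℝ (fderiv ℝ φ) y u (W y) + fderiv ℝ φ y (fderiv ℝ W y u) :=
  fderiv_clm_apply_apply (h.differentiableAt_fderiv hy) hW u

-- The derivative of G₁ = φ*G₂. The second derivatives of φ become the inhomogeneous term in the
-- transformation law of the Christoffel symbols.
set_option synthInstance.maxHeartbeats 80000 in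
theorem fderiv_metric (h : IsLocalIsometry φ V G₁ G₂ U₁ U₂) (hy : y ∈ V) (u v w : E) :
    fderiv ℝ G₁ y u v w = fderiv ℝ G₂ (φ y) (fderiv ℝ φ y u) (fderiv ℝ φ y v) (fderiv ℝ φ y w) +
      G₂ (φ y) (fderiv ℝ (fderiv ℝ φ) y u v) (fderiv ℝ φ y w) +
      G₂ (φ y) (fderiv ℝ φ y v) (fderiv ℝ (fderiv ℝ φ) y u w) := by
  have hG₁ := h.fst.differentiableAt (h.subset hy)
  have hG₂ := h.snd.differentiableAt (h.mapsTo hy)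
  have e1 : fderiv ℝ (fun z => G₁ z v w) y u = fderiv ℝ G₁ y u v w := by
    rw [fderiv_clm_apply_apply (hG₁.clm_apply (differentiableAt_const v))
      (differentiableAt_const w), fderiv_clm_apply_apply hG₁ (differentiableAt_const v)]
    simp
  have e2 : (fun z => G₁ z v w) =ᶠ[nhds y]
      fun z => G₂ (φ z) (fderiv ℝ φ z v) (fderiv ℝ φ z w) := by
    filter_upwards [h.mem_nhds hy] with z hz using h.metric z hz v w
  have hc := h.differentiableAt_comp (F := E →L[ℝ] E →L[ℝ] ℝ) hy hG₂
  have hd : ∀ v, DifferentiableAt ℝ (fun z => fderiv ℝ φ z v) y := fun v =>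
    (h.differentiableAt_fderiv hy).clm_apply (differentiableAt_const v)
  rw [← e1, e2.fderiv_eq, fderiv_clm_apply_apply (hc.clm_apply (hd v)) (hd w),
    fderiv_clm_apply_apply hc (hd v), h.fderiv_fderiv_apply hy (differentiableAt_const v),
    h.fderiv_fderiv_apply hy (differentiableAt_const w), 
    h.fderiv_comp_apply (F := E →L[ℝ] E →L[ℝ] ℝ) hy hG₂]
  simp

theorem fderiv_gradient [FiniteDimensional ℝ E] (h : IsLocalIsometry φ V G₁ G₂ U₁ U₂) (hy : y ∈ V)
    {f₁ f₂ : E → ℝ}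
    (hf : ∀ z ∈ V, f₁ z = f₂ (φ z)) (hd : DifferentiableAt ℝ f₂ (φ y)) :
    fderiv ℝ φ y (gradient G₁ f₁ y) = gradient G₂ f₂ (φ y) := by
  refine h.snd.ext (h.mapsTo hy) fun x => ?_
  obtain ⟨w, rfl⟩ := h.surjective hy x
  rw [← h.metric y hy, h.fst.apply_gradient (h.subset hy), h.snd.apply_gradient (h.mapsTo hy),
    ← h.fderiv_comp_apply hy hd]
  congr 1
  apply Filter.EventuallyEq.fderiv_eq
  filter_upwards [h.mem_nhds hy] with z hz using hf z hz

theorem gradSq_eq [FiniteDimensional ℝ E] (h : IsLocalIsometry φ V G₁ G₂ U₁ U₂) (hy : y ∈ V)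
    {f₁ f₂ : E → ℝ}
    (hf : ∀ z ∈ V, f₁ z = f₂ (φ z)) (hd : DifferentiableAt ℝ f₂ (φ y)) :
    gradSq G₁ f₁ y = gradSq G₂ f₂ (φ y) := by
  rw [gradSq, gradSq, h.metric y hy, h.fderiv_gradient hy hf hd]

/-- Derivatives in the direction of a gradient are natural. -/
theorem fderiv_gradient_apply [FiniteDimensional ℝ E] (h : IsLocalIsometry φ V G₁ G₂ U₁ U₂)
    (hy : y ∈ V) {f₁ f₂ p₁ p₂ : E → ℝ}
    (hf : ∀ z ∈ V, f₁ z = f₂ (φ z)) (hd : DifferentiableAt ℝ f₂ (φ y))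
    (hp : ∀ z ∈ V, p₁ z = p₂ (φ z)) (hpd : DifferentiableAt ℝ p₂ (φ y)) :
    fderiv ℝ p₁ y (gradient G₁ f₁ y) = fderiv ℝ p₂ (φ y) (gradient G₂ f₂ (φ y)) := by
  rw [← h.fderiv_gradient hy hf hd, ← h.fderiv_comp_apply hy hpd]
  congr 1
  apply Filter.EventuallyEq.fderiv_eq
  filter_upwards [h.mem_nhds hy] with z hz using hp z hz

/-- The coefficient is built from the metric, the two functions, their gradients and derivatives
along gradients, all of which an isometry preserves. This makes it a well-defined smooth function on
a manifold although each point uses its own chart. -/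
theorem curvPlane_eq [FiniteDimensional ℝ E] (h : IsLocalIsometry φ V G₁ G₂ U₁ U₂)
    {J : E → E →L[ℝ] E} {ξ₁ ξ₂ η₁ η₂ : E → ℝ} (hO : IsOrthotoricOn G₂ J ξ₂ η₂ U₂)
    (hξ : ∀ z ∈ V, ξ₁ z = ξ₂ (φ z)) (hη : ∀ z ∈ V, η₁ z = η₂ (φ z)) (hy : y ∈ V) :
    curvPlane G₁ ξ₁ η₁ y = curvPlane G₂ ξ₂ η₂ (φ y) := by
  have dξ : ∀ z ∈ V, DifferentiableAt ℝ ξ₂ (φ z) := fun z hz =>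
    hO.differentiableAt_fst (h.mapsTo hz)
  have dη : ∀ z ∈ V, DifferentiableAt ℝ η₂ (φ z) := fun z hz =>
    hO.swap.differentiableAt_fst (h.mapsTo hz)
  have e1 : ∀ z ∈ V, gradSq G₁ ξ₁ z = gradSq G₂ ξ₂ (φ z) := fun z hz =>
    h.gradSq_eq hz hξ (dξ z hz)
  have e2 : ∀ z ∈ V, hessRatio G₁ ξ₁ z = hessRatio G₂ ξ₂ (φ z) := fun z hz => by
    rw [hessRatio, hessRatio, e1 z hz, h.fderiv_gradient_apply hz hξ (dξ z hz) e1
      (hO.differentiableAt_of_contDiffOn (h.mapsTo hz) hO.contDiffOn_gradSq)]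
  have e3 : hessRatioDeriv G₁ ξ₁ y = hessRatioDeriv G₂ ξ₂ (φ y) := by
    rw [hessRatioDeriv, hessRatioDeriv, e1 y hy, h.fderiv_gradient_apply hy hξ (dξ y hy) e2
      (hO.differentiableAt_of_contDiffOn (h.mapsTo hy) hO.contDiffOn_hessRatio)]
  rw [curvPlane, curvPlane, e1 y hy, e2 y hy, e3, h.gradSq_eq hy hη (dη y hy), hξ y hy, hη y hy]

/-- The Lie derivative of the metric is natural. -/
theorem lieDerivMetric_eq (h : IsLocalIsometry φ V G₁ G₂ U₁ U₂) (hy : y ∈ V)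
    {K₁ K₂ : E → E} (hK₁ : DifferentiableAt ℝ K₁ y) (hK₂ : DifferentiableAt ℝ K₂ (φ y))
    (hK : ∀ z ∈ V, fderiv ℝ φ z (K₁ z) = K₂ (φ z)) (u v : E) :
    lieDerivMetric G₁ K₁ y u v =
      lieDerivMetric G₂ K₂ (φ y) (fderiv ℝ φ y u) (fderiv ℝ φ y v) := by
  have e2 : (fun z => fderiv ℝ φ z (K₁ z)) =ᶠ[nhds y] fun z => K₂ (φ z) := by
    filter_upwards [h.mem_nhds hy] with z hz using hK z hz
  have key : ∀ u, fderiv ℝ φ y (fderiv ℝ K₁ y u) =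
      fderiv ℝ K₂ (φ y) (fderiv ℝ φ y u) - fderiv ℝ (fderiv ℝ φ) y u (K₁ y) := by
    intro u
    rw [← h.fderiv_comp_apply hy hK₂, ← e2.fderiv_eq, h.fderiv_fderiv_apply hy hK₁]
    abel
  simp only [lieDerivMetric, h.fderiv_metric hy, h.metric y hy, key, hK y hy, map_sub, sub_apply,
    h.snd_fderiv_symm hy _ (K₁ y)]
  ring

variable [FiniteDimensional ℝ E]

/-- When the derivatives of G₁ are combined into Christoffel symbols of the first kind, symmetry of
the second derivative of φ leaves exactly one of its terms. -/
theorem fderiv_christoffel (h : IsLocalIsometry φ V G₁ G₂ U₁ U₂) (hy : y ∈ V) (u v : E) :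
    fderiv ℝ φ y (christoffel G₁ y u v) =
      christoffel G₂ (φ y) (fderiv ℝ φ y u) (fderiv ℝ φ y v) + fderiv ℝ (fderiv ℝ φ) y u v := by
  refine h.snd.ext (h.mapsTo hy) fun x => ?_
  obtain ⟨w, rfl⟩ := h.surjective hy x
  rw [← h.metric y hy, h.fst.apply_christoffel (h.subset hy), map_add, add_apply,
    h.snd.apply_christoffel (h.mapsTo hy), christoffelFirst_apply, christoffelFirst_apply,
    h.fderiv_metric hy, h.fderiv_metric hy, h.fderiv_metric hy, h.snd_fderiv_symm hy w u,
    h.snd_fderiv_symm hy w v, h.snd_fderiv_symm hy v u,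
    h.snd.symm (φ y) (h.mapsTo hy) (fderiv ℝ φ y v) (fderiv ℝ (fderiv ℝ φ) y u w)]
  ring

/-- The covariant derivative of an endomorphism field is natural. -/
theorem fderiv_covDerivEnd (h : IsLocalIsometry φ V G₁ G₂ U₁ U₂) (hy : y ∈ V)
    {J₁ J₂ : E → E →L[ℝ] E} (hJ₁ : DifferentiableAt ℝ J₁ y) (hJ₂ : DifferentiableAt ℝ J₂ (φ y))
    (hJ : ∀ z ∈ V, ∀ v, fderiv ℝ φ z (J₁ z v) = J₂ (φ z) (fderiv ℝ φ z v)) (u v : E) :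
    fderiv ℝ φ y (covDerivEnd G₁ J₁ y u v) =
      covDerivEnd G₂ J₂ (φ y) (fderiv ℝ φ y u) (fderiv ℝ φ y v) := by
  have hd : DifferentiableAt ℝ (fun z => J₁ z v) y := hJ₁.clm_apply (differentiableAt_const v)
  have e1 := h.fderiv_fderiv_apply hy hd u
  have e2 : (fun z => fderiv ℝ φ z (J₁ z v)) =ᶠ[nhds y]
      fun z => J₂ (φ z) (fderiv ℝ φ z v) := by
    filter_upwards [h.mem_nhds hy] with z hz using hJ z hz v
  have e3 : fderiv ℝ (fun z => J₁ z v) y u = fderiv ℝ J₁ y u v := by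
    rw [fderiv_clm_apply_apply hJ₁ (differentiableAt_const v)]
    simp
  have hc : DifferentiableAt ℝ (fun z => J₂ (φ z)) y := hJ₂.comp y (h.differentiableAt hy)
  rw [e2.fderiv_eq, fderiv_clm_apply_apply hc ((h.differentiableAt_fderiv hy).clm_apply
    (differentiableAt_const v)), h.fderiv_fderiv_apply hy (differentiableAt_const v),
    h.fderiv_comp_apply hy hJ₂, e3] at e1
  simp only [fderiv_fun_const, Pi.zero_apply, zero_apply, map_zero, add_zero] at e1
  simp only [covDerivEnd, map_add, map_sub, h.fderiv_christoffel hy, hJ y hy,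
    eq_sub_of_add_eq' e1.symm]
  abel

end IsLocalIsometry

end ChartCalculus

/-! ### Smooth sections and their components in a chart -/

namespace KahlerSurface

variable {M : Type*} [TopologicalSpace M] [ChartedSpace E4 M]

/-- All tangent spaces are definitionally the model space, so a field can be moved along an equality
of base points without casts. -/
theorem endField_congr (J : EndField M) {p q : M} (h : p = q) :
    (J p : E4 →L[ℝ] E4) = J q := by
  subst h
  rfl

theorem vecField_congr (K : VecField M) {p q : M} (h : p = q) : (K p : E4) = K q := by
  subst h
  rfl

variable [IsManifold (𝓡 4) ∞ M]

instance : IsManifold (𝓡 4) 1 M := .of_le (n := ∞) (by simp)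

theorem inner_congr (g : Metric M) {p q : M} (h : p = q) :
    (g.inner p : E4 →L[ℝ] E4 →L[ℝ] ℝ) = g.inner q := by
  subst h
  rfl

theorem ofChart_isInvertible {x : M} {z : E4} (hz : z ∈ (extChartAt (𝓡 4) x).target) :
    (ofChart x z).IsInvertible := by
  have := isInvertible_mfderivWithin_extChartAt_symm (I := 𝓡 4) hz
  rwa [ModelWithCorners.range_eq_univ, mfderivWithin_univ] at this

/-- Bundle smoothness is tested in trivialisations. Identifying them with the chart differentials
turns it into smoothness of the chart components. -/
theorem ofChart_eq_symmL {x p : M} (hp : p ∈ (chartAt E4 x).source) :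
    (ofChart x (extChartAt (𝓡 4) x p) : E4 →L[ℝ] E4) =
      (trivializationAt E4 (TangentSpace (𝓡 4)) x).symmL ℝ p := by
  rw [TangentBundle.symmL_trivializationAt hp, ModelWithCorners.range_eq_univ, mfderivWithin_univ]
  rfl

theorem inverse_ofChart {x p : M} (hp : p ∈ (chartAt E4 x).source) :
    ((ofChart x (extChartAt (𝓡 4) x p)).inverse : E4 →L[ℝ] E4) =
      (trivializationAt E4 (TangentSpace (𝓡 4)) x).continuousLinearMapAt ℝ p := by
  have hp' : p ∈ (trivializationAt E4 (TangentSpace (𝓡 4)) x).baseSet := hp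
  refine (congrArg ContinuousLinearMap.inverse (ofChart_eq_symmL hp)).trans
    (ContinuousLinearMap.inverse_eq ?_ ?_)
  · exact ContinuousLinearMap.ext fun v =>
      (trivializationAt E4 (TangentSpace (𝓡 4)) x).symmL_continuousLinearMapAt (R := ℝ) hp' v
  · exact ContinuousLinearMap.ext fun v =>
      (trivializationAt E4 (TangentSpace (𝓡 4)) x).continuousLinearMapAt_symmL (R := ℝ) hp' v

theorem contMDiffAt_iff_inChart {W : Type*} [NormedAddCommGroup W] [NormedSpace ℝ W] {f : M → W}
    {F : E4 → W} {x p : M} (hp : p ∈ (extChartAt (𝓡 4) x).source)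
    (h : ∀ q ∈ (extChartAt (𝓡 4) x).source, f q = F (extChartAt (𝓡 4) x q)) :
    ContMDiffAt (𝓡 4) 𝓘(ℝ, W) ∞ f p ↔ ContDiffAt ℝ ∞ F (extChartAt (𝓡 4) x p) := by
  have hs : (extChartAt (𝓡 4) x).source ∈ nhds p :=
    (isOpen_extChartAt_source (I := 𝓡 4) x).mem_nhds hp
  have ht : (extChartAt (𝓡 4) x).target ∈ nhds (extChartAt (𝓡 4) x p) :=
    (isOpen_extChartAt_target (I := 𝓡 4) x).mem_nhds ((extChartAt (𝓡 4) x).map_source hp)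
  rw [← contMDiffAt_iff_contDiffAt]
  constructor
  · intro hf
    have hsy : ContMDiffAt 𝓘(ℝ, E4) (𝓡 4) ∞ (extChartAt (𝓡 4) x).symm (extChartAt (𝓡 4) x p) :=
      (contMDiffOn_extChartAt_symm x).contMDiffAt ht
    rw [← (extChartAt (𝓡 4) x).left_inv hp] at hf
    refine (hf.comp _ hsy).congr_of_eventuallyEq ?_
    filter_upwards [ht] with z hz
    rw [Function.comp_apply, h _ ((extChartAt (𝓡 4) x).map_target hz),
      (extChartAt (𝓡 4) x).right_inv hz]
  · intro hF
    rw [extChartAt_source] at hp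
    refine (hF.comp p (contMDiffAt_extChartAt' hp)).congr_of_eventuallyEq ?_
    filter_upwards [hs] with q hq using h q hq

theorem smoothVecAt_iff (X : VecField M) {x p : M} (hp : p ∈ (extChartAt (𝓡 4) x).source) :
    SmoothVecAt X p ↔ ContDiffAt ℝ ∞ (vecInChart X x) (extChartAt (𝓡 4) x p) := by
  have hp' : p ∈ (trivializationAt E4 (TangentSpace (𝓡 4)) x).baseSet := by
    rwa [extChartAt_source] at hp
  refine ((trivializationAt E4 (TangentSpace (𝓡 4)) x).contMDiffAt_section_iff hp').trans
    (contMDiffAt_iff_inChart hp ?_)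
  intro q hq
  have hq' : q ∈ (chartAt E4 x).source := by rwa [extChartAt_source] at hq
  have e1 := congrArg (fun L : E4 →L[ℝ] E4 => L (X q)) (inverse_ofChart hq')
  have e2 := vecField_congr X ((extChartAt (𝓡 4) x).left_inv hq)
  refine Eq.trans ?_ (e1.symm.trans ?_)
  · exact ((trivializationAt E4 (TangentSpace (𝓡 4)) x).continuousLinearMapAt_apply_of_mem
      (R := ℝ) hq' (X q)).symm
  · exact congrArg (ofChart x (extChartAt (𝓡 4) x q)).inverse e2.symm

theorem smoothEnd_iff (J : EndField M) : SmoothEnd J ↔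
    ∀ x : M, ContDiffOn ℝ ∞ (endInChart J x) (extChartAt (𝓡 4) x).target := by
  have key : ∀ x p : M, p ∈ (extChartAt (𝓡 4) x).source →
      (ContMDiffAt (𝓡 4) ((𝓡 4).prod 𝓘(ℝ, E4 →L[ℝ] E4)) ∞
        (fun x => TotalSpace.mk' (E4 →L[ℝ] E4)
          (E := fun x : M => TangentSpace (𝓡 4) x →L[ℝ] TangentSpace (𝓡 4) x) x (J x)) p ↔
      ContDiffAt ℝ ∞ (endInChart J x) (extChartAt (𝓡 4) x p)) := by
    intro x p hp
    have hp' : p ∈ (trivializationAt (E4 →L[ℝ] E4)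
        (fun x : M => TangentSpace (𝓡 4) x →L[ℝ] TangentSpace (𝓡 4) x) x).baseSet := by
      rw [extChartAt_source] at hp
      exact ⟨hp, hp⟩
    refine (Trivialization.contMDiffAt_section_iff _ hp').trans (contMDiffAt_iff_inChart hp ?_)
    intro q hq
    have hq' : q ∈ (chartAt E4 x).source := by rwa [extChartAt_source] at hq
    -- The trivialisation of the endomorphism bundle is conjugation by that of the tangent bundle,
    -- which is how `endInChart` is formed.
    rw [hom_trivializationAt_apply]
    change ((trivializationAt E4 (TangentSpace (𝓡 4)) x).continuousLinearMapAt ℝ q : E4 →L[ℝ] E4) ∘L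
      (J q : E4 →L[ℝ] E4) ∘L ((trivializationAt E4 (TangentSpace (𝓡 4)) x).symmL ℝ q :
        E4 →L[ℝ] E4) = _
    rw [← inverse_ofChart hq', ← ofChart_eq_symmL hq',
      ← endField_congr J ((extChartAt (𝓡 4) x).left_inv hq)]
    rfl
  constructor
  · intro h x z hz
    have := (key x _ ((extChartAt (𝓡 4) x).map_target hz)).mp (h _)
    rw [(extChartAt (𝓡 4) x).right_inv hz] at this
    exact this.contDiffWithinAt
  · intro h x
    exact (key x x (mem_extChartAt_source x)).mpr ((h x).contDiffAt
      ((isOpen_extChartAt_target (I := 𝓡 4) x).mem_nhds (mem_extChartAt_target x)))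

set_option synthInstance.maxHeartbeats 400000 in
theorem contDiffOn_metricInChart (g : Metric M) (x : M) :
    ContDiffOn ℝ ∞ (metricInChart g x) (extChartAt (𝓡 4) x).target := by
  refine contDiffOn_clm_apply.mpr fun u => contDiffOn_clm_apply.mpr fun v => ?_
  intro z hz
  refine ContDiffAt.contDiffWithinAt ?_
  have hp := (extChartAt (𝓡 4) x).map_target hz
  rw [← (extChartAt (𝓡 4) x).right_inv hz]
  set p := (extChartAt (𝓡 4) x).symm z
  have hp' : p ∈ (trivializationAt (E4 →L[ℝ] E4 →L[ℝ] ℝ)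
      (fun x : M => TangentSpace (𝓡 4) x →L[ℝ] TangentSpace (𝓡 4) x →L[ℝ] ℝ) x).baseSet := by
    rw [extChartAt_source] at hp
    exact ⟨hp, hp, Set.mem_univ _⟩
  have h1 := ((trivializationAt (E4 →L[ℝ] E4 →L[ℝ] ℝ)
    (fun x : M => TangentSpace (𝓡 4) x →L[ℝ] TangentSpace (𝓡 4) x →L[ℝ] ℝ)
      x).contMDiffAt_section_iff hp').mp (g.contMDiff p)
  have h2 : ContMDiffAt (𝓡 4) 𝓘(ℝ, ℝ) ∞ (fun q => (trivializationAt (E4 →L[ℝ] E4 →L[ℝ] ℝ)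
      (fun x : M => TangentSpace (𝓡 4) x →L[ℝ] TangentSpace (𝓡 4) x →L[ℝ] ℝ) x
      ⟨q, g.inner q⟩).2 u v) p :=
    (h1.clm_apply contMDiffAt_const).clm_apply contMDiffAt_const
  refine (contMDiffAt_iff_inChart hp ?_).mp h2
  intro q hq
  have hq' : q ∈ (chartAt E4 x).source := by rwa [extChartAt_source] at hq
  rw [hom_trivializationAt_apply]
  change ContinuousLinearMap.inCoordinates E4 (TangentSpace (𝓡 4)) (E4 →L[ℝ] ℝ)
    (fun x : M => TangentSpace (𝓡 4) x →L[ℝ] ℝ) x q x q (g.inner q) u v = _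
  refine Eq.trans (b := g.inner q
    ((trivializationAt E4 (TangentSpace (𝓡 4)) x).symmL ℝ q u)
    ((trivializationAt E4 (TangentSpace (𝓡 4)) x).symmL ℝ q v)) ?_ ?_
  · rw [inCoordinates_apply_eq₂ hq' hq' (Set.mem_univ _)]
    have hs := fun w => (trivializationAt E4 (TangentSpace (𝓡 4)) x).symmL_apply (R := ℝ)
      (b := q) hq' w
    rw [hs, hs]
    simp
  · change _ = (g.inner _ : E4 →L[ℝ] E4 →L[ℝ] ℝ)
      ((ofChart x (extChartAt (𝓡 4) x q) : E4 →L[ℝ] E4) u)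
      ((ofChart x (extChartAt (𝓡 4) x q) : E4 →L[ℝ] E4) v)
    rw [inner_congr g ((extChartAt (𝓡 4) x).left_inv hq), ofChart_eq_symmL hq']
    rfl

end KahlerSurface

/-! ### Coordinate changes, and the Kähler and Killing conditions on a whole chart -/

namespace KahlerSurface

open ChartCalculus

variable {M : Type*} [TopologicalSpace M] [ChartedSpace E4 M]

/-- The coordinate change from the preferred chart around `x` to the one around `x'`. -/
def transition (x x' : M) (z : E4) : E4 := extChartAt (𝓡 4) x' ((extChartAt (𝓡 4) x).symm z)

/-- The domain of `transition x x'`. -/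
def transitionSource (x x' : M) : Set E4 :=
  (extChartAt (𝓡 4) x).target ∩ (extChartAt (𝓡 4) x).symm ⁻¹' (extChartAt (𝓡 4) x').source

theorem symm_transition {x x' : M} {z : E4} (hz : z ∈ transitionSource x x') :
    (extChartAt (𝓡 4) x').symm (transition x x' z) = (extChartAt (𝓡 4) x).symm z :=
  (extChartAt (𝓡 4) x').left_inv hz.2

theorem isOpen_transitionSource (x x' : M) : IsOpen (transitionSource x x') :=
  (continuousOn_extChartAt_symm (I := 𝓡 4) x).isOpen_inter_preimage
    (isOpen_extChartAt_target (I := 𝓡 4) x) (isOpen_extChartAt_source (I := 𝓡 4) x')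

theorem transition_mem {x x' : M} {z : E4} (hz : z ∈ transitionSource x x') :
    transition x x' z ∈ (extChartAt (𝓡 4) x').target :=
  (extChartAt (𝓡 4) x').map_source hz.2

theorem mem_transitionSource {x : M} {z : E4} (hz : z ∈ (extChartAt (𝓡 4) x).target) :
    z ∈ transitionSource x ((extChartAt (𝓡 4) x).symm z) :=
  ⟨hz, mem_extChartAt_source _⟩

variable [IsManifold (𝓡 4) ∞ M]

theorem contMDiffAt_symm {x : M} {z : E4} (hz : z ∈ (extChartAt (𝓡 4) x).target) :
    ContMDiffAt 𝓘(ℝ, E4) (𝓡 4) ∞ (extChartAt (𝓡 4) x).symm z :=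
  (contMDiffOn_extChartAt_symm x).contMDiffAt
    ((isOpen_extChartAt_target (I := 𝓡 4) x).mem_nhds hz)

theorem contDiffOn_transition (x x' : M) :
    ContDiffOn ℝ ∞ (transition x x') (transitionSource x x') := by
  intro z hz
  refine ContDiffAt.contDiffWithinAt (contMDiffAt_iff_contDiffAt.mp ?_)
  have h2 := hz.2
  rw [Set.mem_preimage, extChartAt_source] at h2
  exact (contMDiffAt_extChartAt' h2).comp z (contMDiffAt_symm hz.1)

/-- The chain rule for the inverse chart composed with the coordinate change; every transformation
law of chart components below rests on it. -/
theorem ofChart_transition {x x' : M} {z : E4} (hz : z ∈ transitionSource x x') (u : E4) :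
    (ofChart x' (transition x x' z) (fderiv ℝ (transition x x') z u) : E4) = ofChart x z u := by
  have hd : DifferentiableAt ℝ (transition x x') z :=
    ((contDiffOn_transition x x').contDiffAt
      ((isOpen_transitionSource x x').mem_nhds hz)).differentiableAt (by simp)
  have h1 : MDifferentiableAt 𝓘(ℝ, E4) (𝓡 4) (extChartAt (𝓡 4) x').symm (transition x x' z) :=
    (contMDiffAt_symm (transition_mem hz)).mdifferentiableAt (by simp)
  have h3 := mfderiv_comp z h1 hd.mdifferentiableAt
  have he : (extChartAt (𝓡 4) x').symm ∘ transition x x' =ᶠ[nhds z] (extChartAt (𝓡 4) x).symm := by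
    filter_upwards [(isOpen_transitionSource x x').mem_nhds hz] with w hw using symm_transition hw
  rw [he.mfderiv_eq, mfderiv_eq_fderiv] at h3
  exact (congrArg (fun L : E4 →L[ℝ] E4 => L u) h3).symm

theorem isInvertible_fderiv_transition {x x' : M} {z : E4} (hz : z ∈ transitionSource x x') :
    (fderiv ℝ (transition x x') z).IsInvertible := by
  obtain ⟨e, he⟩ := ofChart_isInvertible hz.1
  obtain ⟨e', he'⟩ := ofChart_isInvertible (transition_mem hz)
  refine ⟨(show E4 ≃L[ℝ] E4 from e).trans (show E4 ≃L[ℝ] E4 from e').symm,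
    ContinuousLinearMap.ext fun u => ?_⟩
  have h1 := ofChart_transition hz u
  rw [← he, ← he'] at h1
  exact ((show E4 ≃L[ℝ] E4 from e').symm_apply_eq.mpr h1.symm)

theorem metricInChart_apply (g : Metric M) (x : M) (z u v : E4) :
    metricInChart g x z u v =
      g.inner ((extChartAt (𝓡 4) x).symm z) (ofChart x z u) (ofChart x z v) := rfl

theorem ofChart_endInChart (J : EndField M) {x : M} {z : E4}
    (hz : z ∈ (extChartAt (𝓡 4) x).target) (u : E4) :
    ofChart x z (endInChart J x z u) = J ((extChartAt (𝓡 4) x).symm z) (ofChart x z u) :=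
  (ofChart_isInvertible hz).self_apply_inverse _

theorem ofChart_vecInChart (K : VecField M) {x : M} {z : E4}
    (hz : z ∈ (extChartAt (𝓡 4) x).target) :
    ofChart x z (vecInChart K x z) = K ((extChartAt (𝓡 4) x).symm z) :=
  (ofChart_isInvertible hz).self_apply_inverse _

theorem ofChart_injective {x : M} {z : E4} (hz : z ∈ (extChartAt (𝓡 4) x).target) :
    Function.Injective (ofChart x z) := by
  obtain ⟨e, he⟩ := ofChart_isInvertible hz
  rw [← he]
  exact e.injective

theorem ofChart_surjective {x : M} {z : E4} (hz : z ∈ (extChartAt (𝓡 4) x).target) :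
    Function.Surjective (ofChart x z) := by
  obtain ⟨e, he⟩ := ofChart_isInvertible hz
  rw [← he]
  exact e.surjective

theorem isMetricOn_inChart (g : Metric M) (x : M) :
    IsMetricOn (metricInChart g x) (extChartAt (𝓡 4) x).target where
  isOpen := isOpen_extChartAt_target (I := 𝓡 4) x
  contDiffOn := contDiffOn_metricInChart g x
  symm _ _ _ _ := g.symm _ _ _
  pos _ hz _ hu := g.pos _ _ fun h => hu (ofChart_injective hz (h.trans (map_zero _).symm))

theorem isLocalIsometry_transition (g : Metric M) (x x' : M) :
    IsLocalIsometry (transition x x') (transitionSource x x') (metricInChart g x)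
      (metricInChart g x') (extChartAt (𝓡 4) x).target (extChartAt (𝓡 4) x').target where
  isOpen := isOpen_transitionSource x x'
  contDiffOn := contDiffOn_transition x x'
  subset := Set.inter_subset_left
  mapsTo _ hz := transition_mem hz
  isInvertible _ hz := isInvertible_fderiv_transition hz
  fst := isMetricOn_inChart g x
  snd := isMetricOn_inChart g x'
  metric z hz u v := by
    change (g.inner _ : E4 →L[ℝ] E4 →L[ℝ] ℝ) (ofChart x z u : E4) (ofChart x z v : E4) =
      (g.inner _ : E4 →L[ℝ] E4 →L[ℝ] ℝ) (ofChart x' _ _ : E4) (ofChart x' _ _ : E4)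
    rw [ofChart_transition hz, ofChart_transition hz, inner_congr g (symm_transition hz)]
    rfl

theorem endInChart_transition (J : EndField M) {x x' : M} {z : E4}
    (hz : z ∈ transitionSource x x') (v : E4) :
    fderiv ℝ (transition x x') z (endInChart J x z v) =
      endInChart J x' (transition x x' z) (fderiv ℝ (transition x x') z v) := by
  refine ofChart_injective (transition_mem hz) ?_
  have h1 := ofChart_transition hz (endInChart J x z v)
  have h2 := ofChart_endInChart J (transition_mem hz) (fderiv ℝ (transition x x') z v)
  have h3 := ofChart_endInChart J hz.1 v
  refine h1.trans (h3.trans (Eq.trans ?_ h2.symm))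
  rw [ofChart_transition hz, endField_congr J (symm_transition hz)]
  rfl

theorem vecInChart_transition (K : VecField M) {x x' : M} {z : E4}
    (hz : z ∈ transitionSource x x') :
    fderiv ℝ (transition x x') z (vecInChart K x z) = vecInChart K x' (transition x x' z) := by
  refine ofChart_injective (transition_mem hz) ?_
  have h1 := ofChart_transition hz (vecInChart K x z)
  have h2 := ofChart_vecInChart K (transition_mem hz)
  have h3 := ofChart_vecInChart K hz.1
  exact h1.trans (h3.trans ((vecField_congr K (symm_transition hz)).symm.trans h2.symm))

theorem contDiffOn_inChart {f : M → ℝ} (hf : ContMDiff (𝓡 4) 𝓘(ℝ, ℝ) ∞ f) (x : M) :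
    ContDiffOn ℝ ∞ (fun z => f ((extChartAt (𝓡 4) x).symm z)) (extChartAt (𝓡 4) x).target := by
  intro z hz
  refine ContDiffAt.contDiffWithinAt ?_
  rw [← (extChartAt (𝓡 4) x).right_inv hz]
  refine (contMDiffAt_iff_inChart ((extChartAt (𝓡 4) x).map_target hz) ?_).mp (hf _)
  intro q hq
  rw [(extChartAt (𝓡 4) x).left_inv hq]

theorem fderiv_inChart {f : M → ℝ} (hf : ContMDiff (𝓡 4) 𝓘(ℝ, ℝ) ∞ f) {x : M} {z : E4}
    (hz : z ∈ (extChartAt (𝓡 4) x).target) (u : E4) :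
    fderiv ℝ (fun w => f ((extChartAt (𝓡 4) x).symm w)) z u =
      differential f ((extChartAt (𝓡 4) x).symm z) (ofChart x z u) := by
  have h1 := mfderiv_comp z ((hf _).mdifferentiableAt (by simp))
    ((contMDiffAt_symm hz).mdifferentiableAt (by simp))
  rw [mfderiv_eq_fderiv] at h1
  exact congrArg (fun L : E4 →L[ℝ] ℝ => L u) h1

theorem inner_grad (g : Metric M) (f : M → ℝ) (x : M) (X : TangentSpace (𝓡 4) x) :
    g.inner x (grad g f x) X = differential f x X := by
  have h : (g.inner x : E4 →L[ℝ] E4 →L[ℝ] ℝ).IsInvertible := isInvertible_of_pos (E := E4) (g.pos x)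
  exact congrArg (fun L : E4 →L[ℝ] ℝ => L X) (h.self_apply_inverse (differential f x))

theorem ofChart_gradient (g : Metric M) {f : M → ℝ} (hf : ContMDiff (𝓡 4) 𝓘(ℝ, ℝ) ∞ f) {x : M}
    {z : E4} (hz : z ∈ (extChartAt (𝓡 4) x).target) :
    ofChart x z (gradient (metricInChart g x) (fun w => f ((extChartAt (𝓡 4) x).symm w)) z) =
      grad g f ((extChartAt (𝓡 4) x).symm z) := by
  obtain ⟨w, hw⟩ := ofChart_surjective hz (grad g f ((extChartAt (𝓡 4) x).symm z))
  rw [← hw]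
  congr 1
  refine (isMetricOn_inChart g x).ext hz fun u => ?_
  rw [(isMetricOn_inChart g x).apply_gradient hz, fderiv_inChart hf hz, metricInChart_apply, hw,
    inner_grad]

/-- Parallelism of J is assumed only at chart centres. For another point z of the chart, the
transition to the chart centred there is a local isometry, and naturality of ∇J brings the condition
back to z. -/
theorem isKahlerOn_inChart {g : Metric M} {J : EndField M} (h : IsKahler g J) (x : M) :
    IsKahlerOn (metricInChart g x) (endInChart J x) (extChartAt (𝓡 4) x).target where
  toIsMetricOn := isMetricOn_inChart g x
  contDiffOn_end := (smoothEnd_iff J).mp h.smooth x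
  sq z hz v := ofChart_injective hz (by
    rw [ofChart_endInChart J hz, ofChart_endInChart J hz, h.sq, map_neg])
  isometry z hz u v := by
    rw [metricInChart_apply, ofChart_endInChart J hz, ofChart_endInChart J hz, h.isometry]
    rfl
  parallel z hz u v := by
    have hT := mem_transitionSource hz
    have hI := isLocalIsometry_transition g x ((extChartAt (𝓡 4) x).symm z)
    have hd : ∀ y : M, ∀ w ∈ (extChartAt (𝓡 4) y).target, DifferentiableAt ℝ (endInChart J y) w :=
      fun y w hw => (((smoothEnd_iff J).mp h.smooth y).contDiffAt
        ((isOpen_extChartAt_target (I := 𝓡 4) y).mem_nhds hw)).differentiableAt (by simp)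
    refine hI.injective hT ?_
    rw [hI.fderiv_covDerivEnd hT (hd _ _ hz) (hd _ _ (transition_mem hT))
      (fun w hw v => endInChart_transition J hw v), map_zero]
    exact h.parallel _ _ _

/-- As for ∇J: the Killing equation at z is transported from the centre of the chart around the
point represented by z. -/
theorem lieDerivMetric_inChart {g : Metric M} {K : VecField M} (h : IsKilling g K) {x : M} {z : E4}
    (hz : z ∈ (extChartAt (𝓡 4) x).target) (u v : E4) :
    lieDerivMetric (metricInChart g x) (vecInChart K x) z u v = 0 := by
  have hT := mem_transitionSource hz
  have hI := isLocalIsometry_transition g x ((extChartAt (𝓡 4) x).symm z)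
  have hd : ∀ y : M, ∀ w ∈ (extChartAt (𝓡 4) y).target, DifferentiableAt ℝ (vecInChart K y) w := by
    intro y w hw
    have := (smoothVecAt_iff K ((extChartAt (𝓡 4) y).map_target hw)).mp (h.1 _)
    rw [(extChartAt (𝓡 4) y).right_inv hw] at this
    exact this.differentiableAt (by simp)
  rw [hI.lieDerivMetric_eq hT (hd _ _ hz) (hd _ _ (transition_mem hT))
    (fun w hw => vecInChart_transition K hw)]
  exact h.2 _ _ _

/-- A Hamiltonian vector field is the rotated gradient of its momentum map. -/
theorem IsHamiltonian.eq_end_grad {g : Metric M} {J : EndField M} {K : VecField M} {f : M → ℝ}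
    (hJ : IsAlmostHermitian g J) (h : IsHamiltonian g J K f) (x : M) :
    K x = J x (grad g f x) := by
  have h1 : J x (K x) = -grad g f x := by
    have hx := fun X => (h x X).trans (congrArg Neg.neg (inner_grad g f x X).symm)
    by_contra hne
    have hp := g.pos x (J x (K x) + grad g f x) fun h0 => hne (eq_neg_of_add_eq_zero_left h0)
    have h2 := hx (J x (K x) + grad g f x)
    rw [fundForm] at h2
    rw [map_add, g.symm x _ (J x (K x)), g.symm x _ (grad g f x), h2] at hp
    linarith
  have h2 := congrArg (J x) h1
  rw [hJ.sq, map_neg] at h2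
  exact neg_injective h2

end KahlerSurface

/-! ### The adapted frame of an orthotoric surface -/

namespace KahlerSurface

open ChartCalculus

variable {M : Type*} [TopologicalSpace M] [ChartedSpace E4 M]

theorem symm_chartPt (x : M) : (extChartAt (𝓡 4) x).symm (chartPt x) = x :=
  extChartAt_to_inv x

theorem chartPt_mem (x : M) : chartPt x ∈ (extChartAt (𝓡 4) x).target := mem_extChartAt_target x

variable [IsManifold (𝓡 4) ∞ M] {g : Metric M}
  {J : EndField M}

theorem grad_add {f k : M → ℝ} (hf : ContMDiff (𝓡 4) 𝓘(ℝ, ℝ) ∞ f)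
    (hk : ContMDiff (𝓡 4) 𝓘(ℝ, ℝ) ∞ k) (x : M) :
    grad g (fun y => f y + k y) x = grad g f x + grad g k x := by
  have h := mvfderiv_add ((hf x).mdifferentiableAt (by simp)) ((hk x).mdifferentiableAt (by simp))
  exact (congrArg (g.inner x).inverse h).trans (map_add _ _ _)

theorem grad_mul {f k : M → ℝ} (hf : ContMDiff (𝓡 4) 𝓘(ℝ, ℝ) ∞ f)
    (hk : ContMDiff (𝓡 4) 𝓘(ℝ, ℝ) ∞ k) (x : M) :
    grad g (fun y => f y * k y) x = f x • grad g k x + k x • grad g f x := by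
  have h := mvfderiv_mul ((hf x).mdifferentiableAt (by simp)) ((hk x).mdifferentiableAt (by simp))
  refine (congrArg (g.inner x).inverse h).trans ((map_add _ _ _).trans ?_)
  exact congrArg₂ _ (map_smul _ _ _) (map_smul _ _ _)

theorem IsAlmostHermitian.skew (hJ : IsAlmostHermitian g J) (x : M) (X Y : TangentSpace (𝓡 4) x) :
    g.inner x (J x X) Y = -g.inner x (J x Y) X := by
  rw [← hJ.isometry x (J x X) Y, hJ.sq, map_neg, g.symm]
  rfl

namespace IsOrthotoric

variable {ξ η : M → ℝ}

/-- Independence of the Hamiltonian Killing fields, expressed by the gradients. -/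
theorem end_grad_ne_zero (hJ : IsAlmostHermitian g J) (h : IsOrthotoric g J ξ η) (x : M) (c : ℝ) :
    (η x - c) • grad g ξ x + (ξ x - c) • grad g η x ≠ 0 := by
  obtain ⟨K₁, K₂, -, -, h₁, h₂, hli, -⟩ := h.exists_killing
  intro h0
  -- The coefficients come from K₁ - c K₂ = J((η - c) grad ξ + (ξ - c) grad η).
  have hp := LinearIndependent.pair_iff.mp (hli x) 1 (-c)
  rw [h₁.eq_end_grad hJ, h₂.eq_end_grad hJ, grad_add h.smooth_fst h.smooth_snd,
    grad_mul h.smooth_fst h.smooth_snd] at hp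
  refine one_ne_zero (hp ?_).1
  rw [← map_smul, ← map_smul, ← map_add, ← map_zero (J x), ← h0]
  congr 1
  module

theorem ne (hJ : IsAlmostHermitian g J) (h : IsOrthotoric g J ξ η) (x : M) : ξ x ≠ η x := by
  intro he
  refine h.end_grad_ne_zero hJ x (ξ x) ?_
  rw [he, sub_self, zero_smul, zero_smul, add_zero]

/-- The gradients of the orthotoric coordinates span an adapted frame. -/
theorem frame (hJ : IsAlmostHermitian g J) (h : IsOrthotoric g J ξ η) (x : M) :
    IsAdaptedFrame (E := E4) (g.inner x) (J x) (grad g ξ x) (grad g η x) where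
  symm := g.symm x
  pos := g.pos x
  sq := hJ.sq x
  isometry := hJ.isometry x
  -- The choice c = ξ removes grad η from the nonvanishing combination, leaving only a multiple of
  -- grad ξ; c = η does the opposite.
  ne_fst h0 := h.end_grad_ne_zero hJ x (ξ x) (by
    rw [show grad g ξ x = 0 from h0, smul_zero, sub_self, zero_smul, add_zero])
  ne_snd h0 := h.end_grad_ne_zero hJ x (η x) (by
    rw [show grad g η x = 0 from h0, smul_zero, sub_self, zero_smul, add_zero])
  inner_eq_zero := h.orthogonal x
  inner_end_eq_zero := by
    obtain ⟨K₁, K₂, -, -, h₁, h₂, -, hω⟩ := h.exists_killing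
    have h0 := hω x
    rw [fundForm, h₁.eq_end_grad hJ, h₂.eq_end_grad hJ, hJ.isometry,
      grad_add h.smooth_fst h.smooth_snd, grad_mul h.smooth_fst h.smooth_snd] at h0
    simp only [map_add, map_smul, add_apply, smul_apply, smul_eq_mul] at h0
    have e1 := hJ.skew x (grad g ξ x) (grad g ξ x)
    have e2 := hJ.skew x (grad g η x) (grad g η x)
    have e3 := hJ.skew x (grad g η x) (grad g ξ x)
    have e4 : g.inner x (J x (grad g ξ x)) (grad g ξ x) = 0 := by linarith
    have e5 : g.inner x (J x (grad g η x)) (grad g η x) = 0 := by linarith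
    -- Expanding ω(K₁, K₂) bilinearly gives (η - ξ) g(J grad ξ, grad η), because the diagonal terms
    -- vanish by skewness.
    have e6 : (η x - ξ x) * g.inner x (J x (grad g ξ x)) (grad g η x) = 0 := by
      rw [e4, e5, e3] at h0
      linarith
    exact (mul_eq_zero.mp e6).resolve_left (sub_ne_zero.mpr (h.ne hJ x).symm)
  finrank_eq := by simp

theorem frame_inChart (hJ : IsAlmostHermitian g J) (h : IsOrthotoric g J ξ η) {x : M} {z : E4}
    (hz : z ∈ (extChartAt (𝓡 4) x).target) :
    IsAdaptedFrame (metricInChart g x z) (endInChart J x z)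
      (gradient (metricInChart g x) (fun w => ξ ((extChartAt (𝓡 4) x).symm w)) z)
      (gradient (metricInChart g x) (fun w => η ((extChartAt (𝓡 4) x).symm w)) z) := by
  have hF := h.frame hJ ((extChartAt (𝓡 4) x).symm z)
  have hG := isMetricOn_inChart g x
  have e1 := ofChart_gradient g h.smooth_fst hz
  have e2 := ofChart_gradient g h.smooth_snd hz
  refine
    { symm := hG.symm z hz
      pos := hG.pos z hz
      sq := fun v => ofChart_injective hz ?_
      isometry := fun u v => ?_
      ne_fst := fun h0 => hF.ne_fst ?_
      ne_snd := fun h0 => hF.ne_snd ?_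
      inner_eq_zero := ?_
      inner_end_eq_zero := ?_
      finrank_eq := hF.finrank_eq }
  · rw [ofChart_endInChart J hz, ofChart_endInChart J hz, hJ.sq, map_neg]
  · rw [metricInChart_apply, ofChart_endInChart J hz, ofChart_endInChart J hz, hJ.isometry]
    rfl
  · rw [h0, map_zero] at e1
    exact e1.symm
  · rw [h0, map_zero] at e2
    exact e2.symm
  · rw [metricInChart_apply, e1, e2]
    exact hF.inner_eq_zero
  · rw [metricInChart_apply, ofChart_endInChart J hz, e1, e2]
    exact hF.inner_end_eq_zero

/-- K coincides with J grad f on the chart, so its Killing equation takes the form required by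
`IsOrthotoricOn`, in which only the potential appears. -/
theorem killing_inChart (hJ : IsAlmostHermitian g J) {f : M → ℝ}
    (hf : ContMDiff (𝓡 4) 𝓘(ℝ, ℝ) ∞ f) {K : VecField M} (hK : IsKilling g K)
    (h : IsHamiltonian g J K f) {x : M} {z : E4} (hz : z ∈ (extChartAt (𝓡 4) x).target)
    (u v : E4) :
    lieDerivMetric (metricInChart g x) (fun w => endInChart J x w (gradient (metricInChart g x)
      (fun y => f ((extChartAt (𝓡 4) x).symm y)) w)) z u v = 0 := by
  have he : ∀ w ∈ (extChartAt (𝓡 4) x).target, endInChart J x w (gradient (metricInChart g x)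
      (fun y => f ((extChartAt (𝓡 4) x).symm y)) w) = vecInChart K x w := fun w hw =>
    ofChart_injective hw (by
      rw [ofChart_endInChart J hw, ofChart_gradient g hf hw, ofChart_vecInChart K hw,
        h.eq_end_grad hJ])
  have he' : (fun w => endInChart J x w (gradient (metricInChart g x)
      (fun y => f ((extChartAt (𝓡 4) x).symm y)) w)) =ᶠ[nhds z] vecInChart K x := by
    filter_upwards [(isMetricOn_inChart g x).mem_nhds hz] with w hw using he w hw
  rw [lieDerivMetric, he'.fderiv_eq, he'.eq_of_nhds]
  exact lieDerivMetric_inChart hK hz u v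

theorem isOrthotoricOn_inChart (hJ : IsKahler g J) (h : IsOrthotoric g J ξ η) (x : M) :
    IsOrthotoricOn (metricInChart g x) (endInChart J x)
      (fun z => ξ ((extChartAt (𝓡 4) x).symm z)) (fun z => η ((extChartAt (𝓡 4) x).symm z))
      (extChartAt (𝓡 4) x).target := by
  obtain ⟨K₁, K₂, hK₁, hK₂, h₁, h₂, -, -⟩ := h.exists_killing
  exact
    { toIsKahlerOn := isKahlerOn_inChart hJ x
      contDiffOn_fst := contDiffOn_inChart h.smooth_fst x
      contDiffOn_snd := contDiffOn_inChart h.smooth_snd x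
      killing_mul := fun _ hz u v => killing_inChart hJ.toIsAlmostHermitian
        (h.smooth_fst.mul h.smooth_snd) hK₁ h₁ hz u v
      killing_add := fun _ hz u v => killing_inChart hJ.toIsAlmostHermitian
        (h.smooth_fst.add h.smooth_snd) hK₂ h₂ hz u v
      ne := fun _ _ => h.ne hJ.toIsAlmostHermitian _
      frame := fun _ hz => h.frame_inChart hJ.toIsAlmostHermitian hz }

end IsOrthotoric

/-! ### The centre of a chart -/

theorem ofChart_toChart (x : M) (X : TangentSpace (𝓡 4) x) :
    (ofChart x (chartPt x) (toChart x X) : E4) = X := by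
  have h := mfderivWithin_extChartAt_symm_comp_mfderiv_extChartAt' (I := 𝓡 4)
    (mem_extChartAt_source (I := 𝓡 4) x)
  rw [ModelWithCorners.range_eq_univ, mfderivWithin_univ] at h
  exact congrArg (fun L : E4 →L[ℝ] E4 => L X) h

theorem metricInChart_toChart (x : M) (X Y : TangentSpace (𝓡 4) x) :
    metricInChart g x (chartPt x) (toChart x X) (toChart x Y) = g.inner x X Y := by
  change (g.inner _ : E4 →L[ℝ] E4 →L[ℝ] ℝ) (ofChart x (chartPt x) (toChart x X) : E4)
    (ofChart x (chartPt x) (toChart x Y) : E4) = _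
  rw [ofChart_toChart, ofChart_toChart, inner_congr g (symm_chartPt x)]
  rfl

theorem endInChart_toChart (J : EndField M) (x : M) (X : TangentSpace (𝓡 4) x) :
    endInChart J x (chartPt x) (toChart x X) = toChart x (J x X) := by
  refine ofChart_injective (chartPt_mem x) ((ofChart_endInChart J (chartPt_mem x) _).trans ?_)
  refine Eq.trans ?_ (ofChart_toChart x (J x X)).symm
  rw [ofChart_toChart, endField_congr J (symm_chartPt x)]
  rfl

theorem toChart_grad {f : M → ℝ} (hf : ContMDiff (𝓡 4) 𝓘(ℝ, ℝ) ∞ f) (x : M) :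
    toChart x (grad g f x) = gradient (metricInChart g x)
      (fun w => f ((extChartAt (𝓡 4) x).symm w)) (chartPt x) := by
  refine ofChart_injective (chartPt_mem x) ?_
  refine (ofChart_toChart x _).trans (Eq.trans ?_ (ofChart_gradient g hf (chartPt_mem x)).symm)
  exact (vecField_congr (grad g f) (symm_chartPt x)).symm

end KahlerSurface

/-! ### Ricci form and holomorphic curvature in a chart -/

namespace ChartCalculus

theorem nijenhuis_congr {E : Type*} [NormedAddCommGroup E] [NormedSpace ℝ E] {J J' : E → E →L[ℝ] E}
    {y : E} (h : J =ᶠ[nhds y] J') (u v : E) : nijenhuis J y u v = nijenhuis J' y u v := by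
  have hw : ∀ w, (fun z => J z w) =ᶠ[nhds y] fun z => J' z w := fun w =>
    h.mono fun z hz => congrArg (fun L : E →L[ℝ] E => L w) hz
  rw [nijenhuis, nijenhuis, (hw u).lieBracket_vectorField_eq (hw v),
    (hw u).lieBracket_vectorField_eq (Filter.EventuallyEq.refl _ _),
    (Filter.EventuallyEq.refl _ _).lieBracket_vectorField_eq (hw v), h.eq_of_nhds]

namespace IsOrthotoricOn

variable {E : Type*} [NormedAddCommGroup E] [NormedSpace ℝ E] {G : E → E →L[ℝ] E →L[ℝ] ℝ}
  {J : E → E →L[ℝ] E} {ξ η : E → ℝ} {U : Set E} {y : E} [FiniteDimensional ℝ E]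

/-- `conjEnd` acts isometrically on each of the two planes, and Ricci is a multiple of the metric on
each. -/
theorem ricciForm_conjEnd (h : IsOrthotoricOn G J ξ η U) (hy : y ∈ U) (v w : E) :
    ricciForm (christoffelBilin G) y (conjEnd (G y) (J y) (gradient G ξ y) v)
      (conjEnd (G y) (J y) (gradient G ξ y) w) = ricciForm (christoffelBilin G) y v w := by
  have hF := h.frame y hy
  rw [h.ricci_eq hy, h.ricci_eq hy]
  simp only [hF.inner_conjEnd]
  ring

/-- The trace-free Ricci form is a multiple of the fundamental form of the opposite almost complex
structure. -/
theorem ricci_traceFree_eq (h : IsOrthotoricOn G J ξ η U) (hy : y ∈ U) (v w : E) :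
    ricciForm (christoffelBilin G) y (J y v) w - scalarCurvature G y / 4 * G y (J y v) w =
      (curvPlane G η ξ y - curvPlane G ξ η y) / 2 *
        G y (conjEnd (G y) (J y) (gradient G ξ y) v) w := by
  have hF := h.frame y hy
  have hA : gradSq G ξ y ≠ 0 := h.gradSq_ne_zero hy
  have hB : gradSq G η y ≠ 0 := h.swap.gradSq_ne_zero hy
  have eA : G y (gradient G ξ y) (gradient G ξ y) = gradSq G ξ y := rfl
  have eB : G y (gradient G η y) (gradient G η y) = gradSq G η y := rfl
  -- Removing a quarter of the scalar curvature leaves opposite Ricci eigenvalues on the two planes,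
  -- the first being (C_η - C_ξ)/2. The change of sign is the one that distinguishes `conjEnd` from
  -- J.
  rw [h.ricci_eq hy, h.scalarCurvature_eq hy, hF.inner_eq (J y v) w, hF.inner_eq (conjEnd _ _ _ v) w]
  simp only [hF.inner_conjEnd, hF.inner_end, eA, eB]
  field_simp
  ring

/-- The curvature of the holomorphic planes of an orthotoric surface. -/
theorem holomorphic_curvature_eq (h : IsOrthotoricOn G J ξ η U) (hy : y ∈ U) (u : E) {s t : ℝ}
    (hs : (G y (gradient G ξ y) u ^ 2 + G y (J y (gradient G ξ y)) u ^ 2) / gradSq G ξ y = s)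
    (ht : (G y (gradient G η y) u ^ 2 + G y (J y (gradient G η y)) u ^ 2) / gradSq G η y = t) :
    G y (curvature (christoffelBilin G) y u (J y u) (J y u)) u =
      -(curvPlane G ξ η y * s ^ 2 + curvPlane G η ξ y * t ^ 2 +
        8 * curvMixed G ξ η y * (s * t)) := by
  have hF := h.frame y hy
  have hA : gradSq G ξ y ≠ 0 := h.gradSq_ne_zero hy
  have hB : gradSq G η y ≠ 0 := h.swap.gradSq_ne_zero hy
  rw [h.curvature_eq hy]
  -- On the pair u, Ju the plane forms are A s and B t, and the squares of the two mixed forms sum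
  -- to 4AB st. The constant 8 is 4 from the products of plane forms plus 4 from the mixed forms.
  simp only [planeForm, mixedForm, hF.inner_end, h.sq y hy, map_neg, neg_apply]
  subst hs ht
  field_simp
  ring

end IsOrthotoricOn

end ChartCalculus

/-! ### The opposite Hermitian structure on the manifold -/

namespace KahlerSurface

open ChartCalculus

variable {M : Type*} [TopologicalSpace M] [ChartedSpace E4 M] [IsManifold (𝓡 4) ∞ M]

/-- The almost complex structure which agrees with `J` on the span of `grad ξ`, `J grad ξ` and with
`-J` on its orthogonal complement. -/
def oppositeEnd (g : Metric M) (J : EndField M) (ξ : M → ℝ) : EndField M :=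
  fun x => conjEnd (E := E4) (g.inner x) (J x) (grad g ξ x)

/-- The holomorphic sectional curvature of the plane spanned by `grad ξ`, `J grad ξ`, up to sign. -/
def curvPlaneAt (g : Metric M) (ξ η : M → ℝ) (x : M) : ℝ :=
  curvPlane (metricInChart g x) (fun z => ξ ((extChartAt (𝓡 4) x).symm z))
    (fun z => η ((extChartAt (𝓡 4) x).symm z)) (chartPt x)

/-- The curvature coefficient that mixes the gradients of `ξ` and `η`. -/
def curvMixedAt (g : Metric M) (ξ η : M → ℝ) (x : M) : ℝ :=
  curvMixed (metricInChart g x) (fun z => ξ ((extChartAt (𝓡 4) x).symm z))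
    (fun z => η ((extChartAt (𝓡 4) x).symm z)) (chartPt x)

theorem gradSq_chartPt (g : Metric M) {f : M → ℝ} (hf : ContMDiff (𝓡 4) 𝓘(ℝ, ℝ) ∞ f) (x : M) :
    gradSq (metricInChart g x) (fun z => f ((extChartAt (𝓡 4) x).symm z)) (chartPt x) =
      g.inner x (grad g f x) (grad g f x) := by
  rw [gradSq, ← toChart_grad hf, metricInChart_toChart]

variable {g : Metric M} {J : EndField M} {ξ η : M → ℝ}

namespace IsOrthotoric

theorem endInChart_oppositeEnd (h : IsOrthotoric g J ξ η) {x : M} {z : E4}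
    (hz : z ∈ (extChartAt (𝓡 4) x).target) :
    endInChart (oppositeEnd g J ξ) x z = conjEnd (metricInChart g x z) (endInChart J x z)
      (gradient (metricInChart g x) (fun w => ξ ((extChartAt (𝓡 4) x).symm w)) z) := by
  refine ContinuousLinearMap.ext fun v => ofChart_injective hz ?_
  rw [ofChart_endInChart _ hz, conjEnd_apply, map_sub, map_smul, map_sub, map_smul, map_smul,
    ofChart_endInChart J hz, ofChart_endInChart J hz, metricInChart_apply, metricInChart_apply,
    metricInChart_apply, ofChart_endInChart J hz, ofChart_gradient g h.smooth_fst hz]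
  rfl

theorem isHermitian_oppositeEnd (hJ : IsKahler g J) (h : IsOrthotoric g J ξ η) :
    IsHermitian g (oppositeEnd g J ξ) where
  smooth := (smoothEnd_iff _).mpr fun x =>
    (h.isOrthotoricOn_inChart hJ x).contDiffOn_conjEnd.congr fun _ hz =>
      h.endInChart_oppositeEnd hz
  sq x X := (h.frame hJ.toIsAlmostHermitian x).conjEnd_sq X
  isometry x X Y := (h.frame hJ.toIsAlmostHermitian x).conjEnd_isometry X Y
  integrable x u v := by
    refine (nijenhuis_congr ?_ u v).trans
      ((h.isOrthotoricOn_inChart hJ x).nijenhuis_conjEnd (chartPt_mem x) u v)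
    filter_upwards [(isMetricOn_inChart g x).mem_nhds (chartPt_mem x)] with z hz using
      h.endInChart_oppositeEnd hz

theorem oppositeOrientation (hJ : IsAlmostHermitian g J) (h : IsOrthotoric g J ξ η) :
    OppositeOrientation g J (oppositeEnd g J ξ) := by
  intro x X Y Z W hli
  have h1 := (h.frame hJ x).conj_volume_eq ![X, Y, Z, W]
  have h2 := (h.frame hJ x).volume_ne_zero hli
  change volForm g (oppositeEnd g J ξ) x X Y Z W = -volForm g J x X Y Z W at h1
  change volForm g J x X Y Z W ≠ 0 at h2
  rw [h1, mul_neg, neg_lt_zero]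
  exact mul_self_pos.mpr h2

theorem toChart_oppositeEnd (h : IsOrthotoric g J ξ η) (x : M) (X : TangentSpace (𝓡 4) x) :
    toChart x (oppositeEnd g J ξ x X) = conjEnd (metricInChart g x (chartPt x))
      (endInChart J x (chartPt x)) (gradient (metricInChart g x)
        (fun w => ξ ((extChartAt (𝓡 4) x).symm w)) (chartPt x)) (toChart x X) := by
  rw [← endInChart_toChart, h.endInChart_oppositeEnd (chartPt_mem x)]

theorem preservesRicci_oppositeEnd (hJ : IsKahler g J) (h : IsOrthotoric g J ξ η) :
    PreservesRicci g (oppositeEnd g J ξ) := by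
  intro x X Y
  rw [ric, ric, h.toChart_oppositeEnd, h.toChart_oppositeEnd,
    (h.isOrthotoricOn_inChart hJ x).ricciForm_conjEnd (chartPt_mem x)]

theorem ricciFormTraceFree_eq (hJ : IsKahler g J) (h : IsOrthotoric g J ξ η) (x : M)
    (X Y : TangentSpace (𝓡 4) x) :
    ricciFormTraceFree g J x X Y =
      (curvPlaneAt g η ξ x - curvPlaneAt g ξ η x) / 2 * fundForm g (oppositeEnd g J ξ) x X Y := by
  have := (h.isOrthotoricOn_inChart hJ x).ricci_traceFree_eq (chartPt_mem x) (toChart x X)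
    (toChart x Y)
  rw [← h.toChart_oppositeEnd, endInChart_toChart, metricInChart_toChart,
    metricInChart_toChart] at this
  exact this

/-- The value at q is computed in the chart of q. Invariance under the coordinate change identifies
it, for all q near p, with one smooth function in the chart of p. -/
theorem contMDiff_curvPlaneAt (hJ : IsKahler g J) (h : IsOrthotoric g J ξ η) :
    ContMDiff (𝓡 4) 𝓘(ℝ, ℝ) ∞ (curvPlaneAt g ξ η) := by
  intro p
  refine (contMDiffAt_iff_inChart (mem_extChartAt_source p) (fun q hq => ?_)).mpr
    ((h.isOrthotoricOn_inChart hJ p).contDiffOn_curvPlane.contDiffAt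
      ((isMetricOn_inChart g p).mem_nhds (chartPt_mem p)))
  have hT : extChartAt (𝓡 4) p q ∈ transitionSource p q := by
    refine ⟨(extChartAt (𝓡 4) p).map_source hq, ?_⟩
    rw [Set.mem_preimage, (extChartAt (𝓡 4) p).left_inv hq]
    exact mem_extChartAt_source q
  have he : transition p q (extChartAt (𝓡 4) p q) = chartPt q := by
    rw [transition, (extChartAt (𝓡 4) p).left_inv hq]
    rfl
  have := (isLocalIsometry_transition g p q).curvPlane_eq (h.isOrthotoricOn_inChart hJ q)
    (ξ₁ := fun z => ξ ((extChartAt (𝓡 4) p).symm z))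
    (η₁ := fun z => η ((extChartAt (𝓡 4) p).symm z))
    (fun z hz => by rw [symm_transition hz]) (fun z hz => by rw [symm_transition hz]) hT
  rw [he] at this
  exact this.symm

theorem swap (h : IsOrthotoric g J ξ η) : IsOrthotoric g J η ξ where
  smooth_fst := h.smooth_snd
  smooth_snd := h.smooth_fst
  exists_killing := by
    obtain ⟨K₁, K₂, h₁, h₂, h₃, h₄, h₅, h₆⟩ := h.exists_killing
    refine ⟨K₁, K₂, h₁, h₂, ?_, ?_, h₅, h₆⟩
    · simpa only [mul_comm] using h₃
    · simpa only [add_comm] using h₄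
  orthogonal x := by rw [g.symm, h.orthogonal]

/-- The curvature of the holomorphic planes of an orthotoric surface. -/
theorem riemann_eq (hJ : IsKahler g J) (h : IsOrthotoric g J ξ η) (x : M)
    (X : TangentSpace (𝓡 4) x) {s t : ℝ}
    (hs : (g.inner x (grad g ξ x) X ^ 2 + g.inner x (J x (grad g ξ x)) X ^ 2) /
      g.inner x (grad g ξ x) (grad g ξ x) = s)
    (ht : (g.inner x (grad g η x) X ^ 2 + g.inner x (J x (grad g η x)) X ^ 2) /
      g.inner x (grad g η x) (grad g η x) = t) :
    riemann g x X (J x X) (J x X) X =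
      -(curvPlaneAt g ξ η x * s ^ 2 + curvPlaneAt g η ξ x * t ^ 2 +
        8 * curvMixedAt g ξ η x * (s * t)) := by
  have := (h.isOrthotoricOn_inChart hJ x).holomorphic_curvature_eq (chartPt_mem x) (toChart x X)
    (s := s) (t := t)
  rw [gradSq_chartPt g h.smooth_fst, gradSq_chartPt g h.smooth_snd, ← toChart_grad h.smooth_fst,
    ← toChart_grad h.smooth_snd] at this
  simp only [endInChart_toChart, metricInChart_toChart] at this
  exact this hs ht

theorem contMDiff_half_curvPlaneAt_sub (hJ : IsKahler g J) (h : IsOrthotoric g J ξ η) :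
    ContMDiff (𝓡 4) 𝓘(ℝ, ℝ) ∞ (fun x => (curvPlaneAt g η ξ x - curvPlaneAt g ξ η x) / 2) := by
  simp only [div_eq_mul_inv]
  exact ((h.swap.contMDiff_curvPlaneAt hJ).sub (h.contMDiff_curvPlaneAt hJ)).mul contMDiff_const

end IsOrthotoric

theorem IsOrthotoric.smoothVecAt_grad (h : IsOrthotoric g J ξ η) (hJ : IsKahler g J) (x : M) :
    SmoothVecAt (grad g ξ) x ∧ SmoothVecAt (fun y => J y (grad g ξ y)) x := by
  have hO := h.isOrthotoricOn_inChart hJ x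
  have hn := (isMetricOn_inChart g x).mem_nhds (chartPt_mem x)
  rw [smoothVecAt_iff _ (mem_extChartAt_source x), smoothVecAt_iff _ (mem_extChartAt_source x)]
  constructor
  · refine (hO.contDiffOn_grad.congr fun z hz => ?_).contDiffAt hn
    exact ofChart_injective hz (by
      rw [ofChart_vecInChart _ hz, ofChart_gradient g h.smooth_fst hz])
  · refine ((hO.contDiffOn_end_apply hO.contDiffOn_grad).congr fun z hz => ?_).contDiffAt hn
    exact ofChart_injective hz (by
      rw [ofChart_vecInChart _ hz, ofChart_endInChart J hz, ofChart_gradient g h.smooth_fst hz])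

end KahlerSurface

/-! ### The distribution and quasi-constant holomorphic curvature -/

namespace ChartCalculus.IsAdaptedFrame

variable {E : Type*} [NormedAddCommGroup E] [NormedSpace ℝ E] {g : E →L[ℝ] E →L[ℝ] ℝ}
  {j : E →L[ℝ] E} {a b : E}

theorem mem_span_iff (h : IsAdaptedFrame g j a b) (v : E) :
    v ∈ Submodule.span ℝ {a, j a} ↔ g b v = 0 ∧ g (j b) v = 0 := by
  obtain ⟨g1, g2, g3, g4, g5, g6, g7, g8, g9, g10, g11, g12, g13, g14⟩ := h.gram
  constructor
  · intro hv
    obtain ⟨s, t, rfl⟩ := Submodule.mem_span_pair.mp hv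
    constructor <;>
      simp only [map_add, map_smul, smul_eq_mul, g8, g9, g10, g11, mul_zero, add_zero]
  · rintro ⟨h1, h2⟩
    refine Submodule.mem_span_pair.mpr ⟨g a v / g a a, g (j a) v / g a a, ?_⟩
    conv_rhs => rw [h.decomp v, h1, h2, zero_div, zero_smul, zero_smul, add_zero, add_zero]

theorem finrank_span (h : IsAdaptedFrame g j a b) :
    Module.finrank ℝ (Submodule.span ℝ {a, j a}) = 2 := by
  have hli : LinearIndependent ℝ ![a, j a] := by
    refine LinearIndependent.pair_iff.mpr fun s t hst => ?_
    have h1 := congrArg (g a) hst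
    have h2 := congrArg (g (j a)) hst
    simp only [map_add, map_smul, smul_eq_mul, h.inner_self_end, h.isometry,
      h.symm (j a) a, map_zero, mul_zero, add_zero, zero_add] at h1 h2
    exact ⟨(mul_eq_zero.mp h1).resolve_right h.pos_fst.ne',
      (mul_eq_zero.mp h2).resolve_right h.pos_fst.ne'⟩
  have := finrank_span_eq_card hli
  rwa [Matrix.range_cons, Matrix.range_cons, Matrix.range_empty, Set.union_empty,
    Set.singleton_union, Fintype.card_fin] at this

/-- The squared lengths of the components of a vector along the plane of `a`, `j a` and along its
orthogonal complement. -/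
theorem projection_sq (h : IsAdaptedFrame g j a b) {v p : E} (hv : g v v = 1)
    (hb : g b p = 0 ∧ g (j b) p = 0) (ha : g (v - p) a = 0 ∧ g (v - p) (j a) = 0) :
    (g a v ^ 2 + g (j a) v ^ 2) / g a a = g p p ∧
      (g b v ^ 2 + g (j b) v ^ 2) / g b b = 1 - g p p := by
  have h1 := h.inner_eq p p
  have h2 := h.inner_eq v v
  have e1 : g a v = g a p := by
    have := ha.1
    rw [h.symm, map_sub] at this
    linarith
  have e2 : g (j a) v = g (j a) p := by
    have := ha.2
    rw [h.symm, map_sub] at this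
    linarith
  rw [hb.1, hb.2] at h1
  rw [hv, e1, e2] at h2
  rw [e1, e2]
  have h3 : (g a p ^ 2 + g (j a) p ^ 2) / g a a = g p p := by
    rw [h1]
    ring
  refine ⟨h3, ?_⟩
  rw [← h3, h2]
  ring

end ChartCalculus.IsAdaptedFrame

namespace KahlerSurface

open ChartCalculus

variable {M : Type*} [TopologicalSpace M] [ChartedSpace E4 M] [IsManifold (𝓡 4) ∞ M]
  {g : Metric M} {J : EndField M} {ξ η : M → ℝ}

namespace IsOrthotoric

theorem mem_kerDistribution_iff (hJ : IsAlmostHermitian g J) (h : IsOrthotoric g J ξ η) (x : M)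
    (X : TangentSpace (𝓡 4) x) : X ∈ kerDistribution J (oppositeEnd g J ξ) x ↔
      g.inner x (grad g η x) X = 0 ∧ g.inner x (J x (grad g η x)) X = 0 :=
  (h.frame hJ x).end_conjEnd_eq_neg_iff X

theorem kerDistribution_eq_span (hJ : IsAlmostHermitian g J) (h : IsOrthotoric g J ξ η) (x : M) :
    kerDistribution J (oppositeEnd g J ξ) x =
      Submodule.span ℝ {grad g ξ x, J x (grad g ξ x)} :=
  Submodule.ext fun X => (h.mem_kerDistribution_iff hJ x X).trans
    ((h.frame hJ x).mem_span_iff X).symm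

theorem isQCHWith (hJ : IsKahler g J) (h : IsOrthotoric g J ξ η) :
    IsQCHWith g J (kerDistribution J (oppositeEnd g J ξ)) where
  distribution := by
    have hs := h.kerDistribution_eq_span hJ.toIsAlmostHermitian
    refine ⟨fun x => ?_, fun x => ⟨grad g ξ, fun y => J y (grad g ξ y),
      (h.smoothVecAt_grad hJ x).1, (h.smoothVecAt_grad hJ x).2, Filter.Eventually.of_forall hs⟩⟩
    rw [hs]
    exact (h.frame hJ.toIsAlmostHermitian x).finrank_span
  invariant x X hX := by
    have hF := h.frame hJ.toIsAlmostHermitian x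
    rw [h.mem_kerDistribution_iff hJ.toIsAlmostHermitian] at hX ⊢
    obtain ⟨-, -, d3, d4⟩ := hF.inner_end X
    exact ⟨d3.trans (neg_eq_zero.mpr hX.2), d4.trans hX.1⟩
  curvature := by
    -- Here t is the length of the component in the distribution, so the squared lengths entering
    -- `riemann_eq` are t² and, for a unit vector, 1 - t².
    refine ⟨fun x t => -(curvPlaneAt g ξ η x * (t ^ 2) ^ 2 +
      curvPlaneAt g η ξ x * (1 - t ^ 2) ^ 2 +
      8 * curvMixedAt g ξ η x * (t ^ 2 * (1 - t ^ 2))), fun x X P hX hP => ?_⟩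
    have hF := h.frame hJ.toIsAlmostHermitian x
    have hs := h.kerDistribution_eq_span hJ.toIsAlmostHermitian x
    have hP0 : 0 ≤ g.inner x P P := by
      rcases eq_or_ne P 0 with rfl | hne
      · rw [map_zero]
      · exact (g.pos x P hne).le
    obtain ⟨h1, h2⟩ := hF.projection_sq hX
      ((h.mem_kerDistribution_iff hJ.toIsAlmostHermitian x P).mp hP.1)
      ⟨hP.2 _ (hs ▸ Submodule.subset_span (Set.mem_insert _ _)),
        hP.2 _ (hs ▸ Submodule.subset_span (Set.mem_insert_of_mem _ rfl))⟩
    beta_reduce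
    rw [Real.sq_sqrt hP0]
    exact h.riemann_eq hJ x X h1 h2

end IsOrthotoric

end KahlerSurface

end

theorem theorem4 {M : Type*} [TopologicalSpace M] [ChartedSpace (EuclideanSpace ℝ (Fin 4)) M]
    [IsManifold (𝓡 4) ∞ M] (g : KahlerSurface.Metric M) (J : KahlerSurface.EndField M)
    (hJ : KahlerSurface.IsKahler g J) (ξ η : M → ℝ) (hξη : KahlerSurface.IsOrthotoric g J ξ η) :
    KahlerSurface.IsQCH g J ∧
    ∃ J' : KahlerSurface.EndField M,
      KahlerSurface.IsHermitian g J' ∧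
      KahlerSurface.OppositeOrientation g J J' ∧
      (∀ x : M, J' x (KahlerSurface.grad g ξ x) = J x (KahlerSurface.grad g ξ x)) ∧
      (∀ x : M, J' x (KahlerSurface.grad g η x) = -J x (KahlerSurface.grad g η x)) ∧
      KahlerSurface.PreservesRicci g J' ∧
      (∃ δ : M → ℝ, ContMDiff (𝓡 4) 𝓘(ℝ, ℝ) ∞ δ ∧
        ∀ (x : M) (X Y : TangentSpace (𝓡 4) x),
          KahlerSurface.ricciFormTraceFree g J x X Y = δ x * KahlerSurface.fundForm g J' x X Y) ∧
      KahlerSurface.IsQCHWith g J (KahlerSurface.kerDistribution J J') :=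
  have hF := hξη.frame hJ.toIsAlmostHermitian
  ⟨⟨_, hξη.isQCHWith hJ⟩, KahlerSurface.oppositeEnd g J ξ, hξη.isHermitian_oppositeEnd hJ,
    hξη.oppositeOrientation hJ.toIsAlmostHermitian, fun x => (hF x).conjEnd_fst,
    fun x => (hF x).conjEnd_snd, hξη.preservesRicci_oppositeEnd hJ,
    ⟨_, hξη.contMDiff_half_curvPlaneAt_sub hJ, hξη.ricciFormTraceFree_eq hJ⟩, hξη.isQCHWith hJ⟩
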